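/- **Setting.** Let $\Xi$ (edge marks) and $\Theta$ (vertex marks) be finite sets; fix a total order on $\Xi$. A marked graph is a simple locally finite graph $G$ on a finite or countably infinite vertex set in which each vertex $v$ has a mark $\tau_G(v)\in\Theta$ and each edge $vw$ has two marks in $\Xi$: $\xi_G(v,w)$ towards $w$ and $\xi_G(w,v)$ towards $v$. $[G,o]$ is the isomorphism class (preserving root, adjacency and marks) of the connected component of $o$ rooted at $o$; $[G,o]_h$ is the class of the subgraph induced on the vertices at distance at most $h$ from $o$, rooted at $o$. $\bar{\mathcal G}_*$ is the space of all classes $[G,o]$ with the distance $d_*=1/(1+h_*)$, $h_*$ being the largest $h$ with $[G,o]_h=[G',o']_h$ (and $d_*=0$ if these agree for all $h$, $d_*=1$ if they agree for no $h$). $\bar{\mathcal T}_*\subset\bar{\mathcal G}_*$ consists of the classes of rooted marked forests, and $\bar{\mathcal T}_*^{k}$ of those in $\bar{\mathcal T}_*$ in which all vertices of the component of the root are within distance $k$ of the root. A Borel probability measure $\mu$ on $\bar{\mathcal G}_*$ is unimodular if $\int\sum_v f([G,o,v])\,d\mu([G,o])=\int\sum_v f([G,v,o])\,d\mu([G,o])$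 for all nonnegative measurable $f$ on the space of classes $[G,o,v]$ of graphs with two distinguished vertices in the same component, the sums being over the component of $o$. Write $\mu_h$ for the law of $[G,o]_h$, $\deg(\mu)$ for the expected degree of the root, $\deg_{x,x'}(\mu)$ for the expected number of neighbors $v$ of $o$ with $\xi_G(v,o)=x$, $\xi_G(o,v)=x'$, and $q_\theta(\mu)$ for the probability that $\tau_G(o)=\theta$, under $\mu$. Logarithms are natural, and $H$ is the Shannon entropy of a discrete distribution. **Upper BC entropy.** Let $m^{(n)}=(m^{(n)}(x,x'))_{x,x'\in\Xi}$ (symmetric) and $u^{(n)}=(u^{(n)}(\theta))_{\theta\in\Theta}$, $n\ge1$, be vectors of nonnegative integers, and $\|m^{(n)}\|_1=\sum_{x\le x'}m^{(n)}(x,x')$. The sequence $(m^{(n)},u^{(n)})$ is adapted to $(\vec d,Q)$, with $\vec d=(d_{x,x'})$ and $Q=(q_\theta)$, if $\|m^{(n)}\|_1\le\binom n2$ and $\sum_\theta u^{(n)}(\theta)=n$ for each $n$; $m^{(n)}(x,x)/n\to d_{x,x}/2$; $m^{(n)}(x,x')/n\to d_{x,x'}$ for $x\ne x'$; $u^{(n)}(\theta)/n\to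 q_\theta$; and $d_{x,x'}=0$ (resp. $q_\theta=0$) implies $m^{(n)}(x,x')=0$ (resp. $u^{(n)}(\theta)=0$) for all $n$. Let $\mathcal G^{(n)}(\mu,\epsilon)$ be the set of marked graphs $G$ on $\{1,\dots,n\}$ such that for all $x,x'$ exactly $m^{(n)}(x,x')$ edges have marks $x,x'$ (in either order), for all $\theta$ exactly $u^{(n)}(\theta)$ vertices have mark $\theta$, and the Lévy–Prokhorov distance between $\frac1n\sum_v\delta_{[G,v]}$ and $\mu$ is less than $\epsilon$. The upper BC entropy of $\mu$ along $(m^{(n)},u^{(n)})$ is $$\overline\Sigma(\mu)=\lim_{\epsilon\downarrow0}\ \limsup_{n\to\infty}\frac{\log|\mathcal G^{(n)}(\mu,\epsilon)|-\|m^{(n)}\|_1\log n}{n}\in[-\infty,\infty],\qquad \log 0=-\infty .$$ **The functional $J_h$.** For adjacent $u,v$ let $G[u,v]_{k}=(\xi_G(u,v),[G',v]_k)\in\Xi\times\bar{\mathcal G}_*$, where $G'$ is $G$ with the edge $uv$ removed. For $t,t'\in\Xi\times\bar{\mathcal T}_*^{h-1}$ let $E_h(t,t')(G,o)$ be the number of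 neighbors $v$ of $o$ with $G[v,o]_{h-1}=t$ and $G[o,v]_{h-1}=t'$. For a probability measure $P$ on $\bar{\mathcal T}^h_*$ with $H(P)<\infty$ and expected root degree $d\in(0,\infty)$ put $\pi_P(t,t')=\mathbb E_P[E_h(t,t')]/d$, $s(d)=\frac d2-\frac d2\log d$ and $$J_h(P)=-s(d)+H(P)-\tfrac d2H(\pi_P)-\sum_{t,t'\in\Xi\times\bar{\mathcal T}_*^{h-1}}\mathbb E_P\big[\log E_h(t,t')!\big]\in[-\infty,\infty).$$ **Proposition.** Let $h\ge1$, and let $\mu$ be a unimodular Borel probability measure on $\bar{\mathcal G}_*$ with $\mu(\bar{\mathcal T}_*)=1$, $0<\deg(\mu)<\infty$ and $H(\mu_h)<\infty$. If $(m^{(n)},u^{(n)})$ is adapted to $\big((\deg_{x,x'}(\mu))_{x,x'},(q_\theta(\mu))_\theta\big)$, then $$\overline\Sigma(\mu)\le J_h(\mu_h).$$ -/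

import Mathlib

open Set Filter Topology MeasureTheory
open scoped NNReal ENNReal

universe u v

/-! ### Marked graphs -/

/-- A simple locally finite marked graph on the vertex set `V`, with edge marks in `Ξ` and vertex
marks in `Θ`. For adjacent `v, w`, the mark of the edge `vw` towards `w` is `edgeMark v w _` (this
is `ξ_G(v, w)`), its mark towards `v` is `edgeMark w v _`. Non-adjacent pairs carry no mark. -/
structure MarkedGraph (V : Type*) (Ξ : Type u) (Θ : Type v) where
  graph : SimpleGraph V
  locallyFinite : ∀ w, (graph.neighborSet w).Finite
  edgeMark : ∀ v w, graph.Adj v w → Ξ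
  vertexMark : V → Θ

namespace MarkedGraph

variable {Ξ : Type u} {Θ : Type v} {V V' V'' : Type*}

/-- Isomorphisms of marked graphs: bijections of the vertex sets preserving the adjacency
structure, the edge marks and the vertex marks. -/
structure Iso (G : MarkedGraph V Ξ Θ) (G' : MarkedGraph V' Ξ Θ) extends V ≃ V' where
  adj_iff : ∀ v w, G.graph.Adj v w ↔ G'.graph.Adj (toFun v) (toFun w)
  edgeMark_eq : ∀ v w (a : G.graph.Adj v w) (a' : G'.graph.Adj (toFun v) (toFun w)),
    G'.edgeMark (toFun v) (toFun w) a' = G.edgeMark v w a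
  vertexMark_eq : ∀ v, G'.vertexMark (toFun v) = G.vertexMark v

/-- The marked subgraph induced on a set of vertices. -/
def induce (G : MarkedGraph V Ξ Θ) (s : Set V) : MarkedGraph s Ξ Θ where
  graph := G.graph.induce s
  locallyFinite w := (G.locallyFinite w).preimage (f := ((↑) : s → V)) Subtype.val_injective.injOn
  edgeMark v w a := G.edgeMark v w a
  vertexMark v := G.vertexMark v

/-- The marked graph obtained by removing the edge between `u` and `v`. -/
def deleteEdge (G : MarkedGraph V Ξ Θ) (u v : V) : MarkedGraph V Ξ Θ where
  graph := G.graph.deleteEdges {s(u, v)}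
  locallyFinite w := (G.locallyFinite w).subset fun _ a => (SimpleGraph.deleteEdges_adj.1 a).1
  edgeMark x y a := G.edgeMark x y (SimpleGraph.deleteEdges_adj.1 a).1
  vertexMark := G.vertexMark

/-- The vertex set of the connected component of `o`. -/
def componentSet (G : MarkedGraph V Ξ Θ) (o : V) : Set V := {v | G.graph.Reachable o v}

/-- The set of vertices at distance at most `h` from `o`. -/
def ballSet (G : MarkedGraph V Ξ Θ) (o : V) (h : ℕ) : Set V :=
  {v | ∃ p : G.graph.Walk o v, p.length ≤ h}

/-- The root, as a vertex of its connected component. -/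
def rootComponent (G : MarkedGraph V Ξ Θ) (o : V) : G.componentSet o :=
  ⟨o, SimpleGraph.Reachable.refl o⟩

/-- The root, as a vertex of its `h`-neighborhood. -/
def rootBall (G : MarkedGraph V Ξ Θ) (o : V) (h : ℕ) : G.ballSet o h :=
  ⟨o, SimpleGraph.Walk.nil, Nat.zero_le h⟩

/-! Basic facts about isomorphisms. -/

namespace Iso

variable {G : MarkedGraph V Ξ Θ} {G' : MarkedGraph V' Ξ Θ} {G'' : MarkedGraph V'' Ξ Θ}

def refl (G : MarkedGraph V Ξ Θ) : Iso G G where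
  toEquiv := Equiv.refl V
  adj_iff _ _ := Iff.rfl
  edgeMark_eq _ _ _ _ := rfl
  vertexMark_eq _ := rfl

def trans (e : Iso G G') (f : Iso G' G'') : Iso G G'' where
  toEquiv := e.toEquiv.trans f.toEquiv
  adj_iff v w := (e.adj_iff v w).trans (f.adj_iff _ _)
  edgeMark_eq v w a a' :=
    (f.edgeMark_eq _ _ ((e.adj_iff v w).1 a) a').trans (e.edgeMark_eq v w a _)
  vertexMark_eq v := (f.vertexMark_eq _).trans (e.vertexMark_eq v)

theorem edgeMark_congr (G : MarkedGraph V Ξ Θ) {v w v' w' : V} (hv : v = v') (hw : w = w')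
    (a : G.graph.Adj v w) (a' : G.graph.Adj v' w') : G.edgeMark v w a = G.edgeMark v' w' a' := by
  subst hv hw; rfl

def symm (e : Iso G G') : Iso G' G where
  toEquiv := e.toEquiv.symm
  adj_iff v w := by
    have := e.adj_iff (e.toEquiv.symm v) (e.toEquiv.symm w)
    simpa using this.symm
  edgeMark_eq v w a a' := by
    have hv : e.toFun (e.toEquiv.symm v) = v := e.toEquiv.apply_symm_apply v
    have hw : e.toFun (e.toEquiv.symm w) = w := e.toEquiv.apply_symm_apply w
    have h := e.edgeMark_eq (e.toEquiv.symm v) (e.toEquiv.symm w) a' (by rw [hv, hw]; exact a)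
    exact h.symm.trans (edgeMark_congr G' hv hw _ _)
  vertexMark_eq v := by
    have hv : e.toFun (e.toEquiv.symm v) = v := e.toEquiv.apply_symm_apply v
    have h := e.vertexMark_eq (e.toEquiv.symm v)
    rw [hv] at h
    exact h.symm

def induce (e : Iso G G') (s : Set V) (s' : Set V') (h : ∀ v, v ∈ s ↔ e.toEquiv v ∈ s') :
    Iso (G.induce s) (G'.induce s') where
  toEquiv := e.toEquiv.subtypeEquiv h
  adj_iff v w := e.adj_iff v w
  edgeMark_eq v w a a' := e.edgeMark_eq v w a a'
  vertexMark_eq v := e.vertexMark_eq v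

def deleteEdge (e : Iso G G') (u v : V) :
    Iso (G.deleteEdge u v) (G'.deleteEdge (e.toEquiv u) (e.toEquiv v)) where
  toEquiv := e.toEquiv
  adj_iff x y := by
    have h := e.adj_iff x y
    simp only [MarkedGraph.deleteEdge, SimpleGraph.deleteEdges_adj, mem_singleton_iff,
      Sym2.eq_iff, Equiv.toFun_as_coe, EmbeddingLike.apply_eq_iff_eq] at h ⊢
    rw [h]
  edgeMark_eq x y a a' := e.edgeMark_eq x y _ _
  vertexMark_eq x := e.vertexMark_eq x

/-- Iterated induced subgraphs. -/
def induceInduce (G : MarkedGraph V Ξ Θ) (s : Set V) (t : Set s) (u : Set V)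
    (h : ∀ v, v ∈ u ↔ ∃ hs : v ∈ s, (⟨v, hs⟩ : s) ∈ t) :
    Iso ((G.induce s).induce t) (G.induce u) where
  toFun x := ⟨x.1.1, (h _).2 ⟨x.1.2, x.2⟩⟩
  invFun y := ⟨⟨y.1, ((h _).1 y.2).choose⟩, ((h _).1 y.2).choose_spec⟩
  left_inv _ := rfl
  right_inv _ := rfl
  adj_iff _ _ := Iff.rfl
  edgeMark_eq _ _ _ _ := rfl
  vertexMark_eq _ := rfl

/-- Removing an edge commutes with passing to an induced subgraph. -/
def induceDeleteEdge (G : MarkedGraph V Ξ Θ) (s : Set V) (u v : s) :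
    Iso ((G.induce s).deleteEdge u v) ((G.deleteEdge u v).induce s) where
  toEquiv := Equiv.refl s
  adj_iff x y := by
    simp [MarkedGraph.deleteEdge, MarkedGraph.induce, Subtype.ext_iff]
  edgeMark_eq _ _ _ _ := rfl
  vertexMark_eq _ := rfl

theorem mem_ballSet (e : Iso G G') (o v : V) (h : ℕ) :
    v ∈ G.ballSet o h ↔ e.toEquiv v ∈ G'.ballSet (e.toEquiv o) h := by
  have key : ∀ {W W' : Type _} {K : MarkedGraph W Ξ Θ} {K' : MarkedGraph W' Ξ Θ}
      (f : Iso K K') (o v : W), v ∈ K.ballSet o h → f.toEquiv v ∈ K'.ballSet (f.toEquiv o) h := by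
    rintro W W' K K' f o v ⟨p, hp⟩
    refine ⟨p.map ⟨f.toEquiv, fun {a b} hab => (f.adj_iff a b).1 hab⟩, ?_⟩
    simpa using hp
  have key' : ∀ {W W' : Type _} {K : MarkedGraph W Ξ Θ} {K' : MarkedGraph W' Ξ Θ}
      (f : Iso K K') (o v : W), v ∈ K.ballSet o h → f.toEquiv v ∈ K'.ballSet (f.toEquiv o) h := by
    rintro W W' K K' f o v ⟨p, hp⟩
    refine ⟨p.map ⟨f.toEquiv, fun {a b} hab => (f.adj_iff a b).1 hab⟩, ?_⟩
    simpa using hp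
  refine ⟨key e o v, fun hv => ?_⟩
  have := key' e.symm _ _ hv
  simpa [symm] using this

end Iso

theorem mem_componentSet_iff (G : MarkedGraph V Ξ Θ) (o v : V) :
    v ∈ G.componentSet o ↔ ∃ h, v ∈ G.ballSet o h := by
  constructor
  · rintro ⟨p⟩
    exact ⟨p.length, p, le_rfl⟩
  · rintro ⟨_, p, _⟩
    exact ⟨p⟩

theorem Iso.mem_componentSet {G : MarkedGraph V Ξ Θ} {G' : MarkedGraph V' Ξ Θ} (e : Iso G G')
    (o v : V) : v ∈ G.componentSet o ↔ e.toEquiv v ∈ G'.componentSet (e.toEquiv o) := by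
  simp only [mem_componentSet_iff, ← e.mem_ballSet]

/-- Distances up to `k` from `o` may be computed in any vertex set containing the `k`-ball. -/
theorem mem_ballSet_induce (G : MarkedGraph V Ξ Θ) (s : Set V) (o v : s) (k : ℕ)
    (hs : G.ballSet o k ⊆ s) : v ∈ (G.induce s).ballSet o k ↔ (v : V) ∈ G.ballSet o k := by
  constructor
  · rintro ⟨p, hp⟩
    exact ⟨p.map (SimpleGraph.Embedding.induce s).toHom,
      (SimpleGraph.Walk.length_map _ p).trans_le hp⟩
  · classical
    rintro ⟨p, hp⟩
    have hsup : ∀ x ∈ p.support, x ∈ s := fun x hx =>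
      hs ⟨p.takeUntil x hx, (p.length_takeUntil_le_length hx).trans hp⟩
    refine ⟨p.induce s hsup, le_of_eq_of_le ?_ hp⟩
    exact (SimpleGraph.Walk.length_map (SimpleGraph.Embedding.induce s).toHom
      (p.induce s hsup)).symm.trans (congrArg _ (p.map_induce hsup))

theorem ballSet_mono (G : MarkedGraph V Ξ Θ) (o : V) {k h : ℕ} (hk : k ≤ h) :
    G.ballSet o k ⊆ G.ballSet o h := by
  rintro v ⟨p, hp⟩
  exact ⟨p, hp.trans hk⟩

theorem ballSet_subset_componentSet (G : MarkedGraph V Ξ Θ) (o : V) (h : ℕ) :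
    G.ballSet o h ⊆ G.componentSet o := by
  rintro v ⟨p, -⟩
  exact ⟨p⟩

theorem mem_componentSet_induce (G : MarkedGraph V Ξ Θ) (s : Set V) (o v : s)
    (hs : G.componentSet o ⊆ s) :
    v ∈ (G.induce s).componentSet o ↔ (v : V) ∈ G.componentSet o := by
  simp only [mem_componentSet_iff]
  exact exists_congr fun k =>
    G.mem_ballSet_induce s o v k ((G.ballSet_subset_componentSet o k).trans hs)

theorem componentSet_eq (G : MarkedGraph V Ξ Θ) {o v : V} (h : G.graph.Reachable o v) :
    G.componentSet v = G.componentSet o := by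
  ext w
  exact ⟨fun hw => h.trans hw, fun hw => h.symm.trans hw⟩

theorem deleteEdge_componentSet_subset (G : MarkedGraph V Ξ Θ) (a b o : V) :
    (G.deleteEdge a b).componentSet o ⊆ G.componentSet o := fun _ hv =>
  SimpleGraph.Reachable.mono (SimpleGraph.deleteEdges_le _) hv

end MarkedGraph

/-! ### Rooted marked graphs and their isomorphism classes -/

/-- A rooted marked graph `(G, o)` on a finite or countably infinite vertex set. -/
structure RootedMarkedGraph (Ξ : Type u) (Θ : Type v) where
  V : Type
  countable : Countable V
  G : MarkedGraph V Ξ Θ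
  root : V

namespace RootedMarkedGraph

open MarkedGraph

variable {Ξ : Type u} {Θ : Type v}

/-- `(G, o) ≡ (G', o')`: there is an isomorphism of the connected components of the roots that
maps the root to the root. -/
def Equivalent (r r' : RootedMarkedGraph Ξ Θ) : Prop :=
  ∃ e : Iso (r.G.induce (r.G.componentSet r.root)) (r'.G.induce (r'.G.componentSet r'.root)),
    e.toEquiv (r.G.rootComponent r.root) = r'.G.rootComponent r'.root

theorem equivalent_equivalence : Equivalence (Equivalent (Ξ := Ξ) (Θ := Θ)) where
  refl r := ⟨Iso.refl _, rfl⟩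
  symm := by
    rintro r r' ⟨e, he⟩
    exact ⟨e.symm, by rw [← he]; exact e.toEquiv.symm_apply_apply _⟩
  trans := by
    rintro r r' r'' ⟨e, he⟩ ⟨f, hf⟩
    refine ⟨e.trans f, ?_⟩
    change f.toEquiv (e.toEquiv _) = _
    rw [he, hf]

instance instSetoid (Ξ : Type u) (Θ : Type v) : Setoid (RootedMarkedGraph Ξ Θ) where
  r := Equivalent
  iseqv := equivalent_equivalence

/-- An isomorphism of the whole graphs gives equivalent rooted graphs. -/
theorem equivalent_of_iso (r r' : RootedMarkedGraph Ξ Θ) (e : Iso r.G r'.G)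
    (he : e.toEquiv r.root = r'.root) : r ≈ r' := by
  refine ⟨e.induce _ _ fun v => ?_, Subtype.ext he⟩
  rw [← he]
  exact e.mem_componentSet _ _

/-- The induced rooted graph on a set of vertices containing the root. -/
def induce (r : RootedMarkedGraph Ξ Θ) (s : Set r.V) (hs : r.root ∈ s) :
    RootedMarkedGraph Ξ Θ where
  V := s
  countable := by have := r.countable; infer_instance
  G := r.G.induce s
  root := ⟨r.root, hs⟩

theorem induce_equivalent (r : RootedMarkedGraph Ξ Θ) (s : Set r.V)
    (hs : r.G.componentSet r.root ⊆ s) :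
    r.induce s (hs (SimpleGraph.Reachable.refl _)) ≈ r := by
  refine ⟨Iso.induceInduce r.G s _ _ fun v => ?_, rfl⟩
  constructor
  · intro hv
    exact ⟨hs hv, (r.G.mem_componentSet_induce s ⟨r.root, _⟩ ⟨v, hs hv⟩ hs).2 hv⟩
  · rintro ⟨hvs, hv⟩
    exact (r.G.mem_componentSet_induce s ⟨r.root, _⟩ ⟨v, hvs⟩ hs).1 hv

/-- The `h`-neighborhood `(G, o)_h` of the root. -/
def ball (r : RootedMarkedGraph Ξ Θ) (h : ℕ) : RootedMarkedGraph Ξ Θ :=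
  r.induce (r.G.ballSet r.root h) (r.G.rootBall r.root h).2

/-- The `k`-neighborhood may be computed in any vertex set containing it. -/
theorem ball_induce (r : RootedMarkedGraph Ξ Θ) (s : Set r.V) (hr : r.root ∈ s) (k : ℕ)
    (hs : r.G.ballSet r.root k ⊆ s) : (r.induce s hr).ball k ≈ r.ball k := by
  refine equivalent_of_iso _ _ (Iso.induceInduce r.G s _ _ fun v => ?_) rfl
  constructor
  · intro hv
    exact ⟨hs hv, (r.G.mem_ballSet_induce s ⟨r.root, hr⟩ ⟨v, hs hv⟩ k hs).2 hv⟩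
  · rintro ⟨hvs, hv⟩
    exact (r.G.mem_ballSet_induce s ⟨r.root, hr⟩ ⟨v, hvs⟩ k hs).1 hv

theorem ball_equivalent {r r' : RootedMarkedGraph Ξ Θ} (hr : r ≈ r') (h : ℕ) :
    r.ball h ≈ r'.ball h := by
  obtain ⟨e, he⟩ := hr
  have h1 := r.ball_induce (r.G.componentSet r.root) (r.G.rootComponent r.root).2 h
    (r.G.ballSet_subset_componentSet _ h)
  have h2 := r'.ball_induce (r'.G.componentSet r'.root) (r'.G.rootComponent r'.root).2 h
    (r'.G.ballSet_subset_componentSet _ h)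
  refine Setoid.trans (Setoid.symm h1) (Setoid.trans ?_ h2)
  refine equivalent_of_iso _ _ (e.induce _ _ fun v => ?_) (Subtype.ext he)
  have := e.mem_ballSet (r.G.rootComponent r.root) v h
  rw [he] at this
  exact this

theorem ball_ball (r : RootedMarkedGraph Ξ Θ) {k h : ℕ} (hk : k ≤ h) :
    (r.ball h).ball k ≈ r.ball k :=
  r.ball_induce _ _ k (r.G.ballSet_mono _ hk)

/-- Counting vertices in the component of the root is invariant under isomorphism. -/
theorem ncard_eq {r r' : RootedMarkedGraph Ξ Θ}
    (e : r.G.componentSet r.root ≃ r'.G.componentSet r'.root) (S : Set r.V) (S' : Set r'.V)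
    (hS : S ⊆ r.G.componentSet r.root) (hS' : S' ⊆ r'.G.componentSet r'.root)
    
    (h : ∀ v : r.G.componentSet r.root, (v : r.V) ∈ S ↔ (e v : r'.V) ∈ S') : S.ncard = S'.ncard := by
  refine Nat.card_congr (α := S) (β := S') ?_
  exact
    { toFun := fun v => ⟨e ⟨v.1, hS v.2⟩, (h _).1 v.2⟩
      invFun := fun v => ⟨e.symm ⟨v.1, hS' v.2⟩, (h _).2 (by simp)⟩
      left_inv := fun v => Subtype.ext (by simp)
      right_inv := fun v => Subtype.ext (by simp) }

/-- The degree of the root. -/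
noncomputable def deg (r : RootedMarkedGraph Ξ Θ) : ℕ := (r.G.graph.neighborSet r.root).ncard

/-- The number of neighbors `v` of the root `o` with `ξ(v, o) = x` and `ξ(o, v) = x'`. -/
noncomputable def degMark (x x' : Ξ) (r : RootedMarkedGraph Ξ Θ) : ℕ :=
  {v : r.V | ∃ a : r.G.graph.Adj r.root v,
    r.G.edgeMark v r.root a.symm = x ∧ r.G.edgeMark r.root v a = x'}.ncard

theorem deg_eq {r r' : RootedMarkedGraph Ξ Θ} (hr : r ≈ r') : r.deg = r'.deg := by
  obtain ⟨e, he⟩ := hr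
  refine ncard_eq e.toEquiv _ _ (fun v a => SimpleGraph.Adj.reachable a)
    (fun v a => SimpleGraph.Adj.reachable a) fun v => ?_
  have := e.adj_iff (r.G.rootComponent r.root) v
  simp only [Equiv.toFun_as_coe, he] at this
  exact this

theorem degMark_eq {r r' : RootedMarkedGraph Ξ Θ} (hr : r ≈ r') (x x' : Ξ) :
    r.degMark x x' = r'.degMark x x' := by
  obtain ⟨e, he⟩ := hr
  refine ncard_eq e.toEquiv _ _ (fun v a => a.1.reachable) (fun v a => a.1.reachable) fun v => ?_
  have h := e.adj_iff (r.G.rootComponent r.root) v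
  have h1 := e.edgeMark_eq (r.G.rootComponent r.root) v
  have h2 := e.edgeMark_eq v (r.G.rootComponent r.root)
  simp only [Equiv.toFun_as_coe, he] at h h1 h2
  constructor
  · rintro ⟨a, ha, ha'⟩
    exact ⟨h.1 a, (h2 a.symm (h.1 a).symm).trans ha, (h1 a (h.1 a)).trans ha'⟩
  · rintro ⟨a, ha, ha'⟩
    exact ⟨h.2 a, (h2 (h.2 a).symm a.symm).symm.trans ha, (h1 (h.2 a) a).symm.trans ha'⟩

theorem rootMark_eq {r r' : RootedMarkedGraph Ξ Θ} (hr : r ≈ r') :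
    r.G.vertexMark r.root = r'.G.vertexMark r'.root := by
  obtain ⟨e, he⟩ := hr
  have h := e.vertexMark_eq (r.G.rootComponent r.root)
  simp only [Equiv.toFun_as_coe, he] at h
  exact h.symm

end RootedMarkedGraph

/-- The space `𝒢_*(Ξ, Θ)` of isomorphism classes `[G, o]` of rooted marked graphs. -/
def GStar (Ξ : Type u) (Θ : Type v) : Type (max 1 u v) :=
  Quotient (RootedMarkedGraph.instSetoid Ξ Θ)

namespace MarkedGraph

variable {Ξ : Type u} {Θ : Type v} {V : Type} [Countable V]

/-- The isomorphism class `[G, o]`. -/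
def cls (G : MarkedGraph V Ξ Θ) (o : V) : GStar Ξ Θ :=
  Quotient.mk (RootedMarkedGraph.instSetoid Ξ Θ) ⟨V, inferInstance, G, o⟩

end MarkedGraph

namespace GStar

variable {Ξ : Type u} {Θ : Type v}

/-- The isomorphism class `[G, o]_h` of the `h`-neighborhood of the root. -/
def trunc (h : ℕ) : GStar Ξ Θ → GStar Ξ Θ :=
  Quotient.lift (fun r => Quotient.mk _ (r.ball h)) fun _ _ hr =>
    Quotient.sound (RootedMarkedGraph.ball_equivalent hr h)

/-- The degree of the root. -/
noncomputable def deg : GStar Ξ Θ → ℕ :=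
  Quotient.lift RootedMarkedGraph.deg fun _ _ hr => RootedMarkedGraph.deg_eq hr

/-- The number of edges at the root with mark `x` towards the root and mark `x'` towards the other
endpoint. -/
noncomputable def degMark (x x' : Ξ) : GStar Ξ Θ → ℕ :=
  Quotient.lift (RootedMarkedGraph.degMark x x') fun _ _ hr =>
    RootedMarkedGraph.degMark_eq hr x x'

/-- The mark of the root. -/
def rootMark : GStar Ξ Θ → Θ :=
  Quotient.lift (fun r => r.G.vertexMark r.root) fun _ _ hr => RootedMarkedGraph.rootMark_eq hr

/-- The subset `𝒯_*` of isomorphism classes `[T, o]` of rooted marked forests. -/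
def trees (Ξ : Type u) (Θ : Type v) : Set (GStar Ξ Θ) :=
  {g | ∃ r : RootedMarkedGraph Ξ Θ, Quotient.mk _ r = g ∧ r.G.graph.IsAcyclic}

/-- The subset `𝒯_*^h` of those elements of `𝒯_*` for which all vertices of the component of the
root are at distance at most `h` from the root. -/
def treesOfDepth (Ξ : Type u) (Θ : Type v) (h : ℕ) : Set (GStar Ξ Θ) :=
  {g | ∃ r : RootedMarkedGraph Ξ Θ, Quotient.mk _ r = g ∧ r.G.graph.IsAcyclic ∧
    r.G.componentSet r.root ⊆ r.G.ballSet r.root h}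

theorem trunc_trunc {k h : ℕ} (hk : k ≤ h) (g : GStar Ξ Θ) : (g.trunc h).trunc k = g.trunc k := by
  induction g using Quotient.inductionOn with
  | h r => exact Quotient.sound (r.ball_ball hk)

theorem trunc_eq_of_le {k h : ℕ} (hk : k ≤ h) {g g' : GStar Ξ Θ} (e : g.trunc h = g'.trunc h) :
    g.trunc k = g'.trunc k := by
  rw [← trunc_trunc hk g, e, trunc_trunc hk g']

/-! ### The local topology -/

open Classical in
/-- The local distance `d_*([G, o], [G', o'])`: it is `0` if all the `h`-neighborhoods agree, and
otherwise `1 / (1 + h_*)` with `h_*` the largest `h` for which they agree (`h_* = 0` if they agree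
for no `h`, i.e. if the root marks differ). -/
noncomputable def localDist (g g' : GStar Ξ Θ) : ℝ :=
  if ∀ h, g.trunc h = g'.trunc h then 0
  else 1 / (1 + (sSup {h : ℕ | g.trunc h = g'.trunc h} : ℕ))

theorem bddAbove_agree {g g' : GStar Ξ Θ} (hn : ¬ ∀ h, g.trunc h = g'.trunc h) :
    BddAbove {h : ℕ | g.trunc h = g'.trunc h} := by
  obtain ⟨h, hh⟩ := not_forall.1 hn
  refine ⟨h, fun k hk => ?_⟩
  by_contra hlt
  exact hh (trunc_eq_of_le (not_le.1 hlt).le hk)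

theorem localDist_le {g g' : GStar Ξ Θ} {h : ℕ} (e : g.trunc h = g'.trunc h) :
    localDist g g' ≤ 1 / (1 + (h : ℝ)) := by
  unfold localDist
  split_ifs with H
  · positivity
  · have h1 : h ≤ sSup {h : ℕ | g.trunc h = g'.trunc h} := le_csSup (bddAbove_agree H) e
    have h2 : (h : ℝ) ≤ (sSup {h : ℕ | g.trunc h = g'.trunc h} : ℕ) := by exact_mod_cast h1
    gcongr

theorem localDist_le_one (g g' : GStar Ξ Θ) : localDist g g' ≤ 1 := by
  unfold localDist
  split_ifs
  · exact zero_le_one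
  · rw [div_le_one (by positivity)]
    exact le_add_of_nonneg_right (Nat.cast_nonneg _)

theorem localDist_nonneg (g g' : GStar Ξ Θ) : 0 ≤ localDist g g' := by
  unfold localDist
  split_ifs <;> positivity

/-- A distance less than `1` and not `0` is attained at some agreement depth. -/
theorem localDist_cases (g g' : GStar Ξ Θ) :
    (∀ h, g.trunc h = g'.trunc h) ∨ localDist g g' = 1 ∨
      ∃ h : ℕ, g.trunc h = g'.trunc h ∧ localDist g g' = 1 / (1 + (h : ℝ)) := by
  by_cases H : ∀ h, g.trunc h = g'.trunc h
  · exact Or.inl H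
  right
  rcases Set.eq_empty_or_nonempty {h : ℕ | g.trunc h = g'.trunc h} with he | hne
  · left
    simp [localDist, H, he]
  · right
    exact ⟨_, Nat.sSup_mem hne (bddAbove_agree H), by simp only [localDist, if_neg H]⟩

theorem localDist_congr {x y x' y' : GStar Ξ Θ}
    (e : ∀ h, x.trunc h = y.trunc h ↔ x'.trunc h = y'.trunc h) :
    localDist x y = localDist x' y' := by
  have hset : {h : ℕ | x.trunc h = y.trunc h} = {h : ℕ | x'.trunc h = y'.trunc h} :=
    Set.ext e
  classical
  unfold localDist
  rw [hset]
  exact if_congr (forall_congr' e) rfl rfl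

theorem localDist_comm (g g' : GStar Ξ Θ) : localDist g g' = localDist g' g :=
  localDist_congr fun _ => eq_comm

theorem localDist_triangle (x y z : GStar Ξ Θ) :
    localDist x z ≤ localDist x y + localDist y z := by
  have hxy := localDist_nonneg x y
  have hyz := localDist_nonneg y z
  rcases localDist_cases x y with h1 | h1 | ⟨k, hk, h1⟩
  · have : localDist x z = localDist y z := localDist_congr fun h => by rw [h1]
    linarith
  · linarith [localDist_le_one x z]
  rcases localDist_cases y z with h2 | h2 | ⟨l, hl, h2⟩
  · have : localDist x z = localDist x y := localDist_congr fun h => by rw [h2]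
    linarith
  · linarith [localDist_le_one x z]
  rcases le_total k l with hkl | hkl
  · linarith [localDist_le (hk.trans (trunc_eq_of_le hkl hl))]
  · linarith [localDist_le ((trunc_eq_of_le hkl hk).trans hl)]

noncomputable instance instPseudoMetricSpace : PseudoMetricSpace (GStar Ξ Θ) where
  dist := localDist
  dist_self g := by simp [localDist]
  dist_comm := localDist_comm
  dist_triangle := localDist_triangle

noncomputable instance instMeasurableSpace : MeasurableSpace (GStar Ξ Θ) := borel _

instance instBorelSpace : BorelSpace (GStar Ξ Θ) := ⟨rfl⟩

theorem trunc_eq_of_dist_lt {g g' : GStar Ξ Θ} {h : ℕ} (hd : dist g g' < 1 / (1 + (h : ℝ))) :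
    g.trunc h = g'.trunc h := by
  change localDist g g' < _ at hd
  rcases localDist_cases g g' with h1 | h1 | ⟨k, hk, h1⟩
  · exact h1 h
  · rw [h1, lt_div_iff₀ (by positivity)] at hd
    linarith [(Nat.cast_nonneg h : (0 : ℝ) ≤ h)]
  · rw [h1, div_lt_div_iff_of_pos_left one_pos (by positivity) (by positivity)] at hd
    have : h < k := by exact_mod_cast lt_of_add_lt_add_left hd
    exact trunc_eq_of_le this.le hk

/-- A function that depends on the `h`-neighborhood of the root only is measurable. -/
theorem measurable_of_trunc {X : Type*} [MeasurableSpace X] (h : ℕ) (f : GStar Ξ Θ → X)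
    (hf : ∀ g g' : GStar Ξ Θ, g.trunc h = g'.trunc h → f g = f g') : Measurable f := by
  intro s _
  refine IsOpen.measurableSet (Metric.isOpen_iff.2 fun g hg => ?_)
  refine ⟨1 / (1 + (h : ℝ)), by positivity, fun g' hg' => ?_⟩
  have := hf g' g (trunc_eq_of_dist_lt hg')
  simpa [this] using hg

theorem measurable_trunc (h : ℕ) : Measurable (trunc h : GStar Ξ Θ → GStar Ξ Θ) :=
  measurable_of_trunc h _ fun _ _ e => e

end GStar

/-! ### Birooted marked graphs and unimodularity -/

/-- A marked graph with an ordered pair of distinguished vertices `o, v` in the same connected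
component. -/
structure BirootedMarkedGraph (Ξ : Type u) (Θ : Type v) where
  V : Type
  countable : Countable V
  G : MarkedGraph V Ξ Θ
  root : V
  second : V
  reachable : G.graph.Reachable root second

namespace BirootedMarkedGraph

open MarkedGraph

variable {Ξ : Type u} {Θ : Type v}

def Equivalent (r r' : BirootedMarkedGraph Ξ Θ) : Prop :=
  ∃ e : Iso (r.G.induce (r.G.componentSet r.root)) (r'.G.induce (r'.G.componentSet r'.root)),
    e.toEquiv ⟨r.root, SimpleGraph.Reachable.refl _⟩ = ⟨r'.root, SimpleGraph.Reachable.refl _⟩ ∧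
      e.toEquiv ⟨r.second, r.reachable⟩ = ⟨r'.second, r'.reachable⟩

theorem equivalent_equivalence : Equivalence (Equivalent (Ξ := Ξ) (Θ := Θ)) where
  refl r := ⟨Iso.refl _, rfl, rfl⟩
  symm := by
    rintro r r' ⟨e, he, he'⟩
    exact ⟨e.symm, by rw [← he]; exact e.toEquiv.symm_apply_apply _,
      by rw [← he']; exact e.toEquiv.symm_apply_apply _⟩
  trans := by
    rintro r r' r'' ⟨e, he, he'⟩ ⟨f, hf, hf'⟩
    refine ⟨e.trans f, ?_, ?_⟩
    · change f.toEquiv (e.toEquiv _) = _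
      rw [he, hf]
    · change f.toEquiv (e.toEquiv _) = _
      rw [he', hf']

instance instSetoid (Ξ : Type u) (Θ : Type v) : Setoid (BirootedMarkedGraph Ξ Θ) where
  r := Equivalent
  iseqv := equivalent_equivalence

open Classical in
/-- The rooted marked graph obtained from `(G, o, v)` by adding to each vertex mark a bit that
tells whether the vertex is `v`. -/
noncomputable def flag (r : BirootedMarkedGraph Ξ Θ) : RootedMarkedGraph Ξ (Θ × Bool) where
  V := r.V
  countable := r.countable
  G :=
    { graph := r.G.graph
      locallyFinite := r.G.locallyFinite
      edgeMark := r.G.edgeMark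
      vertexMark := fun w => (r.G.vertexMark w, decide (w = r.second)) }
  root := r.root

theorem flag_equivalent {r r' : BirootedMarkedGraph Ξ Θ} (h : r ≈ r') : r.flag ≈ r'.flag := by
  obtain ⟨e, he, he'⟩ := h
  refine ⟨⟨e.toEquiv, e.adj_iff, e.edgeMark_eq, fun v => ?_⟩, he⟩
  have h1 := e.vertexMark_eq v
  have h2 : (e.toEquiv v : r'.V) = r'.second ↔ v.1 = r.second := by
    have h3 := (e.toEquiv.apply_eq_iff_eq (x := v) (y := ⟨r.second, r.reachable⟩))
    rw [he'] at h3
    exact Subtype.ext_iff.symm.trans (h3.trans Subtype.ext_iff)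
  exact Prod.ext h1 (decide_eq_decide.2 h2)

/-- Exchanging the two distinguished vertices. -/
def swap (r : BirootedMarkedGraph Ξ Θ) : BirootedMarkedGraph Ξ Θ where
  V := r.V
  countable := r.countable
  G := r.G
  root := r.second
  second := r.root
  reachable := r.reachable.symm

theorem swap_equivalent {r r' : BirootedMarkedGraph Ξ Θ} (h : r ≈ r') : r.swap ≈ r'.swap := by
  obtain ⟨e, he, he'⟩ := h
  have key : ∀ (s : Set r.V) (s' : Set r'.V) (hs : s = r.G.componentSet r.root)
      (hs' : s' = r'.G.componentSet r'.root) (h1 : r.root ∈ s) (h2 : r.second ∈ s)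
      (h1' : r'.root ∈ s') (h2' : r'.second ∈ s'),
      ∃ f : Iso (r.G.induce s) (r'.G.induce s'),
        f.toEquiv ⟨r.second, h2⟩ = ⟨r'.second, h2'⟩ ∧ f.toEquiv ⟨r.root, h1⟩ = ⟨r'.root, h1'⟩ := by
    rintro s s' rfl rfl h1 h2 h1' h2'
    exact ⟨e, he', he⟩
  exact key _ _ (r.G.componentSet_eq r.reachable) (r'.G.componentSet_eq r'.reachable) _ _ _ _

end BirootedMarkedGraph

/-- The space `𝒢_**` of isomorphism classes `[G, o, v]` of connected marked graphs with an ordered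
pair of distinguished vertices. -/
def GStarStar (Ξ : Type u) (Θ : Type v) : Type (max 1 u v) :=
  Quotient (BirootedMarkedGraph.instSetoid Ξ Θ)

namespace GStarStar

variable {Ξ : Type u} {Θ : Type v}

/-- The class `[G, o, v]`, seen as the class of the graph rooted at `o` in which the vertex `v` is
distinguished by its mark. -/
noncomputable def flag : GStarStar Ξ Θ → GStar Ξ (Θ × Bool) :=
  Quotient.lift (fun r => Quotient.mk _ r.flag) fun _ _ h =>
    Quotient.sound (BirootedMarkedGraph.flag_equivalent h)

/-- The map `[G, o, v] ↦ [G, v, o]`. -/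
def swap : GStarStar Ξ Θ → GStarStar Ξ Θ :=
  Quotient.map BirootedMarkedGraph.swap fun _ _ h => BirootedMarkedGraph.swap_equivalent h

/-- The local topology of `𝒢_**`: two classes are close if large neighborhoods of the first
distinguished vertex agree, including the position of the second distinguished vertex. -/
noncomputable instance instTopologicalSpace : TopologicalSpace (GStarStar Ξ Θ) :=
  TopologicalSpace.induced flag inferInstance

noncomputable instance instMeasurableSpace : MeasurableSpace (GStarStar Ξ Θ) := borel _

instance instBorelSpace : BorelSpace (GStarStar Ξ Θ) := ⟨rfl⟩

end GStarStar

namespace GStar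

variable {Ξ : Type u} {Θ : Type v}

/-- The class `[G, o, v]` for a vertex `v` of the connected component of `o`. -/
def _root_.RootedMarkedGraph.withSecond (r : RootedMarkedGraph Ξ Θ)
    (w : r.G.componentSet r.root) : GStarStar Ξ Θ :=
  Quotient.mk (BirootedMarkedGraph.instSetoid Ξ Θ) ⟨r.V, r.countable, r.G, r.root, w, w.2⟩

/-- The sum `∑_v f([G, o, v])` over all vertices `v` of the connected component of `o`. -/
noncomputable def sumSecond (f : GStarStar Ξ Θ → ℝ≥0∞) : GStar Ξ Θ → ℝ≥0∞ :=
  Quotient.lift (fun r => ∑' w : r.G.componentSet r.root, f (r.withSecond w)) (by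
    rintro r r' ⟨e, he⟩
    rw [← e.toEquiv.tsum_eq]
    exact tsum_congr fun w => congrArg f (Quotient.sound ⟨e, he, rfl⟩))

end GStar

/-- A measure `μ` on `𝒢_*` is unimodular if
`∫ ∑_v f([G, o, v]) dμ([G, o]) = ∫ ∑_v f([G, v, o]) dμ([G, o])` for all measurable nonnegative
functions `f` on `𝒢_**`. -/
def IsUnimodular {Ξ : Type u} {Θ : Type v} (μ : Measure (GStar Ξ Θ)) : Prop :=
  ∀ f : GStarStar Ξ Θ → ℝ≥0, Measurable f →
    ∫⁻ g, g.sumSecond (fun x => f x) ∂μ = ∫⁻ g, g.sumSecond (fun x => f x.swap) ∂μ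

/-! ### Root statistics of a measure -/

/-- The expected degree `deg(μ)` of the root. -/
noncomputable def meanDegree {Ξ : Type u} {Θ : Type v} (μ : Measure (GStar Ξ Θ)) : ℝ≥0∞ :=
  ∫⁻ g, (g.deg : ℝ≥0∞) ∂μ

/-- The expected number `deg_{x, x'}(μ)` of edges at the root with mark `x` towards the root and
mark `x'` towards the other endpoint. -/
noncomputable def meanDegreeMark {Ξ : Type u} {Θ : Type v} (μ : Measure (GStar Ξ Θ))
    (x x' : Ξ) : ℝ≥0∞ :=
  ∫⁻ g, (g.degMark x x' : ℝ≥0∞) ∂μ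

/-- The probability that the root has mark `θ`. -/
noncomputable def rootMarkProb {Ξ : Type u} {Θ : Type v} (μ : Measure (GStar Ξ Θ)) (θ : Θ) : ℝ≥0∞ :=
  μ {g | g.rootMark = θ}

/-- The law `μ_h` of `[G, o]_h` when `[G, o]` has law `μ`. -/
noncomputable def truncLaw {Ξ : Type u} {Θ : Type v} (h : ℕ) (μ : Measure (GStar Ξ Θ)) :
    Measure (GStar Ξ Θ) :=
  μ.map (GStar.trunc h)

/-! ### Finite marked graphs and the upper BC entropy -/

section Finite

variable {Ξ : Type u} {Θ : Type v}

/-- The empirical neighborhood law `U(G) = |V|⁻¹ ∑_v δ_{[G, v]}` of a finite marked graph. -/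
noncomputable def MarkedGraph.empirical {V : Type} [Fintype V] (G : MarkedGraph V Ξ Θ) :
    Measure (GStar Ξ Θ) :=
  (Fintype.card V : ℝ≥0∞)⁻¹ • ∑ w : V, Measure.dirac (G.cls w)

/-- `m_G(x, x')`: the number of edges whose two marks are `x` and `x'`, in either order. -/
noncomputable def MarkedGraph.edgeMarkCount {V : Type} (G : MarkedGraph V Ξ Θ) (x x' : Ξ) : ℕ :=
  {e : Sym2 V | ∃ v w, ∃ a : G.graph.Adj v w,
    e = s(v, w) ∧ G.edgeMark v w a = x ∧ G.edgeMark w v a.symm = x'}.ncard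

/-- `u_G(θ)`: the number of vertices with mark `θ`. -/
noncomputable def MarkedGraph.vertexMarkCount {V : Type} (G : MarkedGraph V Ξ Θ) (θ : Θ) : ℕ :=
  {w : V | G.vertexMark w = θ}.ncard

/-- `‖m‖₁ = ∑_{x ≤ x'} m(x, x')`. -/
def edgeNorm [Fintype Ξ] [LinearOrder Ξ] (m : Ξ → Ξ → ℕ) : ℕ :=
  ∑ x : Ξ, ∑ x' : Ξ, if x ≤ x' then m x x' else 0

/-- The sequence `(m n, u n)`, `n ≥ 1`, of edge and vertex mark count vectors is adapted to the
average degree vector `d` and the probability distribution `Q`. -/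
structure IsAdapted [Fintype Ξ] [LinearOrder Ξ] [Fintype Θ] (d : Ξ → Ξ → ℝ) (Q : Θ → ℝ)
    (m : ℕ → Ξ → Ξ → ℕ) (u : ℕ → Θ → ℕ) : Prop where
  symm : ∀ n, 1 ≤ n → ∀ x x', m n x x' = m n x' x
  edge_le : ∀ n, 1 ≤ n → edgeNorm (m n) ≤ n.choose 2
  vertex_eq : ∀ n, 1 ≤ n → ∑ θ, u n θ = n
  tendsto_diag : ∀ x, Tendsto (fun n => (m n x x : ℝ) / n) atTop (𝓝 (d x x / 2))
  tendsto_offdiag : ∀ x x', x ≠ x' → Tendsto (fun n => (m n x x' : ℝ) / n) atTop (𝓝 (d x x'))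
  tendsto_vertex : ∀ θ, Tendsto (fun n => (u n θ : ℝ) / n) atTop (𝓝 (Q θ))
  edge_zero : ∀ x x', d x x' = 0 → ∀ n, 1 ≤ n → m n x x' = 0
  vertex_zero : ∀ θ, Q θ = 0 → ∀ n, 1 ≤ n → u n θ = 0

/-- The set of marked graphs on `n` labelled vertices with edge mark count vector `m`, vertex mark
count vector `u` and `d_LP(U(G), μ) < ε`. -/
def graphsNear (n : ℕ) (m : Ξ → Ξ → ℕ) (u : Θ → ℕ) (μ : Measure (GStar Ξ Θ)) (ε : ℝ) :
    Set (MarkedGraph (Fin n) Ξ Θ) :=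
  {G | (∀ x x', G.edgeMarkCount x x' = m x x') ∧ (∀ θ, G.vertexMarkCount θ = u θ) ∧
    levyProkhorovEDist G.empirical μ < ENNReal.ofReal ε}

variable [Fintype Ξ] [LinearOrder Ξ]

/-- The `ε`-upper BC entropy along the sequences `m, u`, with values in `[-∞, ∞]`
(and `log 0 = -∞`). -/
noncomputable def upperBCEntropyEps (m : ℕ → Ξ → Ξ → ℕ) (u : ℕ → Θ → ℕ) (μ : Measure (GStar Ξ Θ))
    (ε : ℝ) : EReal :=
  limsup (fun n : ℕ =>
    (ENNReal.log ((graphsNear n (m n) (u n) μ ε).encard : ℝ≥0∞)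
      - ((edgeNorm (m n) * Real.log n : ℝ) : EReal)) / (n : EReal)) atTop

theorem upperBCEntropyEps_mono (m : ℕ → Ξ → Ξ → ℕ) (u : ℕ → Θ → ℕ) (μ : Measure (GStar Ξ Θ)) :
    Monotone (upperBCEntropyEps m u μ) := by
  intro ε ε' hε
  refine limsup_le_limsup (Eventually.of_forall fun n => ?_)
  have hsub : graphsNear n (m n) (u n) μ ε ⊆ graphsNear n (m n) (u n) μ ε' :=
    fun G hG => ⟨hG.1, hG.2.1, hG.2.2.trans_le (ENNReal.ofReal_le_ofReal hε)⟩
  refine EReal.div_le_div_right_of_nonneg (by positivity) (EReal.sub_le_sub ?_ le_rfl)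
  exact ENNReal.log_monotone (ENat.toENNReal_mono (Set.encard_le_encard hsub))

/-- The upper BC entropy along the sequences `m, u`: the limit of the `ε`-upper BC entropy as
`ε ↓ 0`, which is an infimum by monotonicity in `ε`. -/
noncomputable def upperBCEntropy (m : ℕ → Ξ → Ξ → ℕ) (u : ℕ → Θ → ℕ) (μ : Measure (GStar Ξ Θ)) :
    EReal :=
  ⨅ ε : Ioi (0 : ℝ), upperBCEntropyEps m u μ ε

theorem tendsto_upperBCEntropyEps (m : ℕ → Ξ → Ξ → ℕ) (u : ℕ → Θ → ℕ) (μ : Measure (GStar Ξ Θ)) :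
    Tendsto (upperBCEntropyEps m u μ) (𝓝[>] 0) (𝓝 (upperBCEntropy m u μ)) := by
  have h := (upperBCEntropyEps_mono m u μ).tendsto_nhdsGT 0
  rwa [sInf_image'] at h

end Finite

/-! ### The functional `J_h` -/

namespace MarkedGraph

variable {Ξ : Type u} {Θ : Type v}

/-- `G[u, v]_k = (ξ_G(u, v), [G', v]_k)` for adjacent `u, v`, where `G'` is the connected
component of `v` after the removal of the edge between `u` and `v`. -/
def branch {V : Type} [Countable V] (G : MarkedGraph V Ξ Θ) (k : ℕ) (u v : V)
    (a : G.graph.Adj u v) : Ξ × GStar Ξ Θ :=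
  (G.edgeMark u v a, ((G.deleteEdge u v).cls v).trunc k)

theorem cls_eq_of_iso {V V' : Type} [Countable V] [Countable V'] {G : MarkedGraph V Ξ Θ}
    {G' : MarkedGraph V' Ξ Θ} (e : Iso G G') (o : V) : G.cls o = G'.cls (e.toEquiv o) :=
  Quotient.sound (RootedMarkedGraph.equivalent_of_iso ⟨V, _, G, o⟩ ⟨V', _, G', _⟩ e rfl)

theorem cls_induce {V : Type} [Countable V] (G : MarkedGraph V Ξ Θ) (s : Set V) (o : s)
    (hs : G.componentSet o ⊆ s) : (G.induce s).cls o = G.cls o :=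
  Quotient.sound (RootedMarkedGraph.induce_equivalent ⟨V, inferInstance, G, o⟩ s hs)

theorem branch_eq_of_iso {V V' : Type} [Countable V] [Countable V'] {G : MarkedGraph V Ξ Θ}
    {G' : MarkedGraph V' Ξ Θ} (e : Iso G G') (k : ℕ) (u v : V) (a : G.graph.Adj u v)
    (a' : G'.graph.Adj (e.toEquiv u) (e.toEquiv v)) :
    G'.branch k (e.toEquiv u) (e.toEquiv v) a' = G.branch k u v a :=
  Prod.ext (e.edgeMark_eq u v a a')
    (congrArg (GStar.trunc k) (cls_eq_of_iso (e.deleteEdge u v) v).symm)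

theorem branch_induce {V : Type} [Countable V] (G : MarkedGraph V Ξ Θ) (s : Set V) (k : ℕ)
    (u v : s) (hs : G.componentSet v ⊆ s) (a : (G.induce s).graph.Adj u v) :
    (G.induce s).branch k u v a = G.branch k u v a := by
  have h1 : ((G.induce s).deleteEdge u v).cls v = (G.deleteEdge (u : V) v).cls (v : V) :=
    (cls_eq_of_iso (Iso.induceDeleteEdge G s u v) v).trans
      (cls_induce _ s v ((G.deleteEdge_componentSet_subset _ _ _).trans hs))
  exact Prod.ext rfl (congrArg (GStar.trunc k) h1)

end MarkedGraph

namespace RootedMarkedGraph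

variable {Ξ : Type u} {Θ : Type v}

instance instCountable (r : RootedMarkedGraph Ξ Θ) : Countable r.V := r.countable

/-- The number of neighbors `v` of the root `o` with `G[v, o]_k = t` and `G[o, v]_k = t'`. -/
noncomputable def typeCount (k : ℕ) (t t' : Ξ × GStar Ξ Θ) (r : RootedMarkedGraph Ξ Θ) : ℕ :=
  {v : r.V | ∃ a : r.G.graph.Adj r.root v,
    r.G.branch k v r.root a.symm = t ∧ r.G.branch k r.root v a = t'}.ncard

theorem typeCount_eq {r r' : RootedMarkedGraph Ξ Θ} (hr : r ≈ r') (k : ℕ)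
    (t t' : Ξ × GStar Ξ Θ) : r.typeCount k t t' = r'.typeCount k t t' := by
  obtain ⟨e, he⟩ := hr
  have hb : ∀ (q : RootedMarkedGraph Ξ Θ) (x y : q.G.componentSet q.root) (a),
      (q.G.induce (q.G.componentSet q.root)).branch k x y a = q.G.branch k x y a :=
    fun q x y a => q.G.branch_induce _ k x y (q.G.componentSet_eq y.2).le a
  refine ncard_eq e.toEquiv _ _ (fun v a => a.1.reachable) (fun v a => a.1.reachable) fun v => ?_
  have h := e.adj_iff (r.G.rootComponent r.root) v
  have h1 := MarkedGraph.branch_eq_of_iso e k (r.G.rootComponent r.root) v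
  have h2 := MarkedGraph.branch_eq_of_iso e k v (r.G.rootComponent r.root)
  simp only [Equiv.toFun_as_coe, he] at h h1 h2
  have h1' : ∀ (a : r.G.graph.Adj r.root v) (a' : r'.G.graph.Adj r'.root (e.toEquiv v)),
      r'.G.branch k r'.root (e.toEquiv v) a' = r.G.branch k r.root v a := fun a a' =>
    (hb r' (r'.G.rootComponent r'.root) (e.toEquiv v) a').symm.trans
      ((h1 a a').trans (hb r (r.G.rootComponent r.root) v a))
  have h2' : ∀ (a : r.G.graph.Adj v r.root) (a' : r'.G.graph.Adj (e.toEquiv v) r'.root),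
      r'.G.branch k (e.toEquiv v) r'.root a' = r.G.branch k v r.root a := fun a a' =>
    (hb r' (e.toEquiv v) (r'.G.rootComponent r'.root) a').symm.trans
      ((h2 a a').trans (hb r v (r.G.rootComponent r.root) a))
  constructor
  · rintro ⟨a, ha, ha'⟩
    exact ⟨h.1 a, (h2' a.symm (h.1 a).symm).trans ha, (h1' a (h.1 a)).trans ha'⟩
  · rintro ⟨a, ha, ha'⟩
    exact ⟨h.2 a, (h2' (h.2 a).symm a.symm).symm.trans ha, (h1' (h.2 a) a).symm.trans ha'⟩

end RootedMarkedGraph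

section J

variable {Ξ : Type u} {Θ : Type v}

/-- `E_h(t, t')([G, o])`: the number of neighbors `v` of the root `o` with `G[v, o]_{h-1} = t` and
`G[o, v]_{h-1} = t'` (used for `h ≥ 1`). -/
noncomputable def GStar.typeCount (h : ℕ) (t t' : Ξ × GStar Ξ Θ) : GStar Ξ Θ → ℕ :=
  Quotient.lift (RootedMarkedGraph.typeCount (h - 1) t t') fun _ _ hr =>
    RootedMarkedGraph.typeCount_eq hr _ t t'

/-- The Shannon entropy `∑_i p_i log (1 / p_i) ∈ [0, ∞]` of a discrete probability vector. -/
noncomputable def shannonEntropy {ι : Type*} (p : ι → ℝ≥0∞) : ℝ≥0∞ :=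
  ∑' i, ENNReal.ofReal (Real.negMulLog (p i).toReal)

/-- The entropy `H(P)` of a probability measure `P` carried by a countable set. -/
noncomputable def discreteEntropy {X : Type*} [MeasurableSpace X] (P : Measure X) : ℝ≥0∞ :=
  shannonEntropy fun x => P {x}

/-- The set `(Ξ × 𝒯_*^{h-1}) × (Ξ × 𝒯_*^{h-1})` of pairs `(t, t')`. -/
abbrev EdgeTypes (Ξ : Type u) (Θ : Type v) (h : ℕ) : Type (max 1 u v) :=
  (Ξ × GStar.treesOfDepth Ξ Θ (h - 1)) × (Ξ × GStar.treesOfDepth Ξ Θ (h - 1))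

/-- `E_h(c)` for a pair `c = (t, t')`. -/
noncomputable def edgeTypeCount (h : ℕ) (c : EdgeTypes Ξ Θ h) (g : GStar Ξ Θ) : ℕ :=
  g.typeCount h (c.1.1, c.1.2) (c.2.1, c.2.2)

/-- `e_P(t, t')`, the expectation of `E_h(t, t')` under `P`. -/
noncomputable def meanTypeCount (h : ℕ) (P : Measure (GStar Ξ Θ)) (c : EdgeTypes Ξ Θ h) : ℝ≥0∞ :=
  ∫⁻ g, (edgeTypeCount h c g : ℝ≥0∞) ∂P

/-- `π_P(t, t') = e_P(t, t') / d`, where `d` is the expected degree of the root under `P`. -/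
noncomputable def edgeTypeLaw (h : ℕ) (P : Measure (GStar Ξ Θ)) (c : EdgeTypes Ξ Θ h) : ℝ≥0∞ :=
  meanTypeCount h P c / meanDegree P

/-- `s(d) = d / 2 - (d / 2) log d` (which is `0` for `d = 0`). -/
noncomputable def sFun (d : ℝ) : ℝ := d / 2 - d / 2 * Real.log d

/-- `J_h(P) = -s(d) + H(P) - (d / 2) H(π_P) - ∑_{t, t'} E_P[log E_h(t, t')!] ∈ [-∞, ∞)`, where `d`
is the expected degree of the root under `P`; meant for `0 < d < ∞` and `H(P) < ∞`. -/
noncomputable def JFunctional (h : ℕ) (P : Measure (GStar Ξ Θ)) : EReal :=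
  ((-sFun (meanDegree P).toReal : ℝ) : EReal) + (discreteEntropy P : EReal)
    - ((meanDegree P / 2 * shannonEntropy (edgeTypeLaw h P) : ℝ≥0∞) : EReal)
    - ((∑' c : EdgeTypes Ξ Θ h,
        ∫⁻ g, ENNReal.ofReal (Real.log ((edgeTypeCount h c g).factorial : ℝ)) ∂P : ℝ≥0∞) : EReal)

end J

/-! ### Counting functions and labelled graphs with prescribed statistics -/

section Counting

open Finset Nat

/-! The graphs close to `μ` are counted through a code that keeps finitely many local statistics.
Fix a finite set F of classes of h-balls and a finite set A of edge types, stable under exchanging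
the two ends. Each vertex records the class of its h-ball, or only its mark if the class is not in
F; each edge records its pair of branches, or only its two marks if the pair is not in A. The graph
can be recovered (`MarkedGraph.code_injective`), and a colour in F prescribes the degree of the
vertex in every label of A (`GStar.typeCount_trunc`).

For a fixed colouring and fixed numbers S(c) of half-edges with label c, the count follows the
configuration model (`card_labelledGraphs_le`). A graph with M edges has M! 2^M oriented
enumerations, and an enumeration amounts to a sequence of labels plus a placement of the half-edges
at vertices. If ∑ exp(-a(c)) ≤ 1, there are at most exp(½ ∑ S(c) a(c)) label sequences; the
half-edges with label c in A have about S(c)! / ∏ E(t,c)! placements, the product being over the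
vertices with colour t in F. Colourings are summed by the same Kraft argument with lengths b(t)
close to -log p(t).

Now let S(c) ≈ n e(c) with e = dπ, and M ≈ nd/2. Per vertex, label sequences contribute (d/2)H(π),
the factorials S(c)! contribute d log d - d H(π), and division by M! 2^M n^M, combined with the
linear Stirling terms, contributes -d/2 - (d/2) log d; the terms of order n log n cancel. The sum is
-s(d) - (d/2)H(π). Colourings add H(μ_h), and the denominators E(t,c)! subtract the expected
log-factorials. This is J_h.

Neither H(π) nor the sum of the log-factorial terms has to be finite. Since only an upper bound is
wanted, for each K > J_h one takes A and F so large that finite partial sums already bring the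
exponent below K. Lévy–Prokhorov closeness controls only the frequencies N(t)/n for t in F. The
totals S(c) are controlled because S(c) is at least ∑ N(t) E(t,c), and exceeds it by at most the
total degree outside F, which is 2M - ∑ N(t) deg(t). That is small because M/n tends to d/2, so no
degree mass escapes. This squeeze and the uniform exponent estimate are
`exists_eventually_exponent_le`. -/

theorem card_fiberCard_eq_mul_prod_factorial_le {α β : Type*} [Fintype α] [DecidableEq α]
    [Fintype β] [DecidableEq β] (D : β → ℕ) :
    (univ.filter fun f : α → β => ∀ b, (univ.filter fun a => f a = b).card = D b).card
      * ∏ b, (D b)! ≤ (Fintype.card α)! := by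
  set A := {f : α → β // ∀ b, (univ.filter fun a => f a = b).card = D b} with hA
  have hcard : (univ.filter fun f : α → β =>
      ∀ b, (univ.filter fun a => f a = b).card = D b).card = Fintype.card A :=
    (Fintype.card_subtype _).symm
  rw [hcard]
  rcases isEmpty_or_nonempty A with hE | ⟨⟨f₀, hf₀⟩⟩
  · simp
  have e : ∀ f : A, ∀ b, {a // f.1 a = b} ≃ Fin (D b) := fun f b =>
    Fintype.equivFinOfCardEq (by rw [Fintype.card_subtype]; exact f.2 b)
  -- A function with these fibre sizes, together with a permutation of every fibre, is a bijection
  -- of α with the disjoint union of the blocks `Fin (D b)`; its first coordinate gives the function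
  -- back.
  let Φ : A × (∀ b, Equiv.Perm (Fin (D b))) → (α ≃ Σ b, Fin (D b)) := fun x =>
    (Equiv.sigmaFiberEquiv x.1.1).symm.trans
      (Equiv.sigmaCongrRight fun b => (e x.1 b).trans (x.2 b))
  have hΦ : ∀ x a, Φ x a = ⟨x.1.1 a, x.2 _ (e x.1 _ ⟨a, rfl⟩)⟩ := fun x a => rfl
  have hinj : Function.Injective Φ := by
    rintro ⟨f, p⟩ ⟨f', p'⟩ hxy
    have hff : f = f' := by
      refine Subtype.ext (funext fun a => ?_)
      have := congrArg Sigma.fst (DFunLike.congr_fun hxy a)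
      rwa [hΦ, hΦ] at this
    subst hff
    refine Prod.ext rfl (funext fun b => Equiv.ext fun x => ?_)
    obtain ⟨⟨a, rfl⟩, rfl⟩ := (e f b).surjective x
    have := DFunLike.congr_fun hxy a
    rw [hΦ, hΦ] at this
    simpa using this
  have hc := Fintype.card_le_of_injective Φ hinj
  -- The element `f₀` supplies one bijection, so that the number of bijections is exactly |α|!.
  rw [Fintype.card_prod, Fintype.card_pi, Fintype.card_equiv (Φ (⟨f₀, hf₀⟩, fun _ => 1))] at hc
  simpa [Fintype.card_perm] using hc

/-- Summing the multinomial bound over the unknown fibre sizes outside `good` factorises; each free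
fibre costs at most ∑ 1/j! ≤ e. Exceptional vertices thus cost a bounded factor each, per label,
whatever their degrees are. -/
theorem card_fiberCard_eq_on_le {α β : Type*} [Fintype α] [DecidableEq α]
    [Fintype β] [DecidableEq β] (good : Finset β) (D : β → ℕ) :
    ((univ.filter fun f : α → β => ∀ b ∈ good, (univ.filter fun a => f a = b).card = D b).card : ℝ)
      ≤ (Fintype.card α)! * Real.exp (goodᶜ.card) / ∏ b ∈ good, ((D b)! : ℝ) := by
  set k := Fintype.card α with hk
  -- The possible fibre sizes at b: one value if prescribed, otherwise anything up to |α|.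
  set A : β → Finset ℕ := fun b => if b ∈ good then {D b} else range (k + 1) with hA
  have hmap : ∀ f ∈ univ.filter (fun f : α → β =>
      ∀ b ∈ good, (univ.filter fun a => f a = b).card = D b),
      (fun b => (univ.filter fun a => f a = b).card) ∈ Fintype.piFinset A := by
    intro f hf
    rw [Fintype.mem_piFinset]
    intro b
    by_cases hb : b ∈ good
    · simp [hA, hb, (mem_filter.1 hf).2 b hb]
    · simp only [hA, hb, if_false, Finset.mem_range]
      exact Nat.lt_succ_of_le (card_le_univ _)
  have hle : ∀ D' : β → ℕ, (((univ.filter fun f : α → β =>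
      ∀ b ∈ good, (univ.filter fun a => f a = b).card = D b).filter fun f =>
        (fun b => (univ.filter fun a => f a = b).card) = D').card : ℝ)
      ≤ (k ! : ℝ) * ∏ b, ((D' b)! : ℝ)⁻¹ := by
    intro D'
    rw [Finset.prod_inv_distrib, ← div_eq_mul_inv, le_div_iff₀ (by positivity)]
    have h1 := card_fiberCard_eq_mul_prod_factorial_le (α := α) D'
    have h2 : ((univ.filter fun f : α → β =>
      ∀ b ∈ good, (univ.filter fun a => f a = b).card = D b).filter fun f =>
        (fun b => (univ.filter fun a => f a = b).card) = D').card ≤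
        (univ.filter fun f : α → β => ∀ b, (univ.filter fun a => f a = b).card = D' b).card := by
      refine card_le_card fun f hf => ?_
      simp only [Finset.mem_filter, Finset.mem_univ, true_and] at hf ⊢
      exact fun b => congrFun hf.2 b
    exact_mod_cast (Nat.mul_le_mul_right _ h2).trans h1
  rw [card_eq_sum_card_fiberwise (t := Fintype.piFinset A) (f := fun (f : α → β) b =>
    (univ.filter fun a => f a = b).card) hmap]
  push_cast
  refine (sum_le_sum fun D' _ => hle D').trans ?_
  rw [← mul_sum, ← Finset.prod_univ_sum A (fun _ j => ((j ! : ℕ) : ℝ)⁻¹), mul_div_assoc]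
  refine mul_le_mul_of_nonneg_left ?_ (by positivity)
  rw [← Finset.prod_mul_prod_compl good, div_eq_mul_inv, mul_comm, ← Finset.prod_inv_distrib]
  have h0 : ∀ b, 0 ≤ ∑ j ∈ A b, ((j ! : ℕ) : ℝ)⁻¹ := fun b =>
    sum_nonneg fun _ _ => inv_nonneg.2 (Nat.cast_nonneg _)
  refine mul_le_mul ?_ ?_ (prod_nonneg fun b _ => h0 b) (Real.exp_pos _).le
  · rw [← Real.exp_one_pow, ← Finset.prod_const]
    refine Finset.prod_le_prod (fun b _ => h0 b) fun b hb => ?_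
    rw [Finset.mem_compl] at hb
    have h1 : A b = range (k + 1) := if_neg hb
    have h2 := Real.sum_le_exp_of_nonneg zero_le_one (k + 1)
    rw [h1]
    simpa only [one_pow, one_div] using h2
  · refine (Finset.prod_congr rfl fun b hb => ?_).le
    simp [hA, hb]

/-- One term of the exponential series of lam · n. It brings unconstrained placements into the form
k! times an error, so that labels outside A can be treated like those in A; for small lam the error
is small when k/n is much smaller than 1/|log lam|. -/
theorem card_pow_le_factorial_mul_exp {lam : ℝ} (hlam : 0 < lam) (n k : ℕ) :
    (n : ℝ) ^ k ≤ k ! * Real.exp (lam * n) / lam ^ k := by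
  have := Real.pow_div_factorial_le_exp (lam * n) (by positivity) k
  rw [div_le_iff₀ (by positivity), mul_pow] at this
  rw [le_div_iff₀ (by positivity)]
  linarith

/-! ### Labelled edges, half-edges and oriented enumerations -/

variable {V C : Type*} [DecidableEq V] [DecidableEq C]

/-- The number of ends of the labelled edge `q = (v', w', c')` that lie at `v` and carry the label
`c`, where the end at `v'` carries the label `c'` and the one at `w'` the label `bar c'`. -/
def endCount (bar : C → C) (v : V) (c : C) (q : V × V × C) : ℕ :=
  (if q.1 = v ∧ q.2.2 = c then 1 else 0) + (if q.2.1 = v ∧ bar q.2.2 = c then 1 else 0)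

/-- The number of ends at `v` with label `c` in a set of labelled edges. -/
def labelDegree (bar : C → C) (P : Finset (V × V × C)) (v : V) (c : C) : ℕ :=
  ∑ q ∈ P, endCount bar v c q

/-- Reversing a labelled edge. -/
def flipEdge (bar : C → C) (q : V × V × C) : V × V × C := (q.2.1, q.1, bar q.2.2)

theorem endCount_flipEdge {bar : C → C} (hbar : ∀ c, bar (bar c) = c) (v : V) (c : C)
    (q : V × V × C) : endCount bar v c (flipEdge bar q) = endCount bar v c q := by
  simp only [endCount, flipEdge, hbar]
  exact add_comm _ _

/-- The half-edges of a sequence of oriented labelled edges. -/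
def halfEdge {M : ℕ} (bar : C → C) (z : Fin M → V × V × C) (p : Fin M × Bool) : V × C :=
  if p.2 then ((z p.1).2.1, bar (z p.1).2.2) else ((z p.1).1, (z p.1).2.2)

theorem card_halfEdge_eq {M : ℕ} (bar : C → C) (z : Fin M → V × V × C) (v : V) (c : C) :
    (univ.filter fun p => halfEdge bar z p = (v, c)).card = ∑ i, endCount bar v c (z i) := by
  rw [card_filter, Fintype.sum_prod_type]
  refine sum_congr rfl fun i _ => ?_
  rw [Fintype.sum_bool, add_comm]
  simp [halfEdge, endCount, Prod.ext_iff]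

theorem sum_sum_endCount [Fintype V] [Fintype C] (bar : C → C) (q : V × V × C) :
    ∑ v, ∑ c, endCount bar v c q = 2 := by
  simp [endCount, sum_add_distrib, ite_and]

theorem sum_sum_labelDegree [Fintype V] [Fintype C] (bar : C → C) (P : Finset (V × V × C)) :
    ∑ c, ∑ v, labelDegree bar P v c = 2 * P.card := by
  unfold labelDegree
  rw [sum_comm]
  simp_rw [sum_comm (t := P)]
  rw [sum_congr rfl fun q _ => sum_sum_endCount bar q]
  simp [mul_comm]

/-- Each set of `M` labelled edges has `M! 2^M` oriented enumerations. -/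
theorem card_mul_le_card_enumerations [LinearOrder V] [Fintype V] [Fintype C] {bar : C → C}
    (hbar : ∀ c, bar (bar c) = c) {M : ℕ} (Fam : Finset (Finset (V × V × C)))
    (hM : ∀ P ∈ Fam, P.card = M) (hlt : ∀ P ∈ Fam, ∀ q ∈ P, q.1 < q.2.1)
    (Z : Finset (Fin M → V × V × C))
    (hZ : ∀ P ∈ Fam, ∀ z : Fin M → V × V × C,
      (∀ v c, (univ.filter fun p => halfEdge bar z p = (v, c)).card = labelDegree bar P v c) →
      z ∈ Z) :
    Fam.card * (M ! * 2 ^ M) ≤ Z.card := by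
  classical
  have e : ∀ P : Fam, Fin M ≃ P.1 := fun P =>
    (Fintype.equivFinOfCardEq (by rw [Fintype.card_coe]; exact hM P.1 P.2)).symm
  -- A permutation of the edges and one orientation bit per edge; end counts do not change under
  -- reversal.
  let Φ : Fam × Equiv.Perm (Fin M) × (Fin M → Bool) → (Fin M → V × V × C) := fun x i =>
    if x.2.2 i then flipEdge bar (e x.1 (x.2.1 i)).1 else (e x.1 (x.2.1 i)).1
  have hΦZ : ∀ x, Φ x ∈ Z := by
    rintro ⟨P, σ, s⟩
    refine hZ P.1 P.2 _ fun v c => ?_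
    rw [card_halfEdge_eq]
    have h1 : ∀ i, endCount bar v c (Φ (P, σ, s) i) = endCount bar v c (e P (σ i)).1 := by
      intro i
      simp only [Φ]
      split_ifs
      · exact endCount_flipEdge hbar _ _ _
      · rfl
    rw [sum_congr rfl fun i _ => h1 i, Equiv.sum_comp σ fun i => endCount bar v c (e P i).1,
      Equiv.sum_comp (e P) fun q => endCount bar v c q.1, labelDegree]
    exact sum_coe_sort P.1 fun q => endCount bar v c q
  -- Listed edges run from the smaller to the larger endpoint, so the orientation bits can be read
  -- off an enumeration.
  have hord : ∀ x i, (Φ x i).1 < (Φ x i).2.1 ↔ x.2.2 i = false := by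
    rintro ⟨P, σ, s⟩ i
    have := hlt P.1 P.2 _ (e P (σ i)).2
    rcases hs : s i with _ | _
    · simpa [Φ, hs] using this
    · simpa [Φ, hs, flipEdge] using this.le
  have hinj : Function.Injective Φ := by
    rintro ⟨P, σ, s⟩ ⟨P', σ', s'⟩ hxy
    have hs : s = s' := by
      funext i
      have h1 := hord (P, σ, s) i
      have h2 := hord (P', σ', s') i
      rw [hxy] at h1
      have h3 := h1.symm.trans h2
      exact Bool.eq_iff_iff.2 (by simpa using not_congr h3)
    subst hs
    have hflip : Function.Injective (flipEdge (V := V) bar) := fun a b hab => by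
      have := congrArg (flipEdge bar) hab
      simpa [flipEdge, hbar] using this
    have he : ∀ i, (e P (σ i)).1 = (e P' (σ' i)).1 := by
      intro i
      have h1 := congrFun hxy i
      simp only [Φ] at h1
      split_ifs at h1
      · exact hflip h1
      · exact h1
    have hPP : P = P' := by
      refine Subtype.ext (Finset.ext fun q => ⟨fun hq => ?_, fun hq => ?_⟩)
      · obtain ⟨j, hj⟩ := (e P).surjective ⟨q, hq⟩
        obtain ⟨i, rfl⟩ := σ.surjective j
        have := he i
        rw [hj] at this
        simp only at this
        rw [this]
        exact (e P' (σ' i)).2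
      · obtain ⟨j, hj⟩ := (e P').surjective ⟨q, hq⟩
        obtain ⟨i, rfl⟩ := σ'.surjective j
        have := he i
        rw [hj] at this
        simp only at this
        rw [← this]
        exact (e P (σ i)).2
    subst hPP
    have hσ : σ = σ' := Equiv.ext fun i => (e P).injective (Subtype.ext (he i))
    rw [hσ]
  have hc : (univ : Finset (Fam × Equiv.Perm (Fin M) × (Fin M → Bool))).card ≤ Z.card :=
    card_le_card_of_injOn Φ (fun x _ => hΦZ x) hinj.injOn
  simpa [Fintype.card_perm] using hc

/-- The label of a half-edge. -/
def halfLabel {M : ℕ} (bar : C → C) (x : Fin M → C) (p : Fin M × Bool) : C :=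
  if p.2 then bar (x p.1) else x p.1

/-- A Kraft argument: under a subprobability weight on labels, all sequences in question have the
same product weight exp(-½ ∑ S a), so there are at most as many as the inverse. The factor ½ appears
because an edge label determines both of its half-edge labels. -/
theorem card_labelSequences_le [Fintype C] (bar : C → C) (hbar : ∀ c, bar (bar c) = c) {M : ℕ}
    (S : C → ℕ) (a : C → ℝ) (ha : ∑ c, Real.exp (-a c) ≤ 1) :
    ((univ.filter fun x : Fin M → C =>
      ∀ c, (univ.filter fun p => halfLabel bar x p = c).card = S c).card : ℝ)
      ≤ Real.exp ((∑ c, S c * a c) / 2) := by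
  -- The geometric mean of the weights of the two half-edge labels; by AM–GM and invariance of the
  -- sum under `bar` it is still subnormalised.
  set w : C → ℝ := fun c => Real.exp (-((a c + a (bar c)) / 2)) with hw
  have hwsum : ∑ c, w c ≤ 1 := by
    have h1 : ∀ c, w c ≤ (Real.exp (-a c) + Real.exp (-a (bar c))) / 2 := by
      intro c
      have h2 : w c = Real.exp (-a c / 2) * Real.exp (-a (bar c) / 2) := by
        rw [← Real.exp_add]
        exact congrArg Real.exp (by ring)
      have h3 : Real.exp (-a c) = Real.exp (-a c / 2) ^ 2 := by
        rw [← Real.exp_nat_mul]; congr 1; push_cast; ring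
      have h4 : Real.exp (-a (bar c)) = Real.exp (-a (bar c) / 2) ^ 2 := by
        rw [← Real.exp_nat_mul]; congr 1; push_cast; ring
      rw [h2, h3, h4]
      nlinarith [sq_nonneg (Real.exp (-a c / 2) - Real.exp (-a (bar c) / 2))]
    have h5 : ∑ c, Real.exp (-a (bar c)) = ∑ c, Real.exp (-a c) :=
      Equiv.sum_comp (⟨bar, bar, hbar, hbar⟩ : C ≃ C) fun c => Real.exp (-a c)
    calc ∑ c, w c ≤ ∑ c, (Real.exp (-a c) + Real.exp (-a (bar c))) / 2 :=
          sum_le_sum fun c _ => h1 c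
      _ = ∑ c, Real.exp (-a c) := by rw [← sum_div, sum_add_distrib, h5]; ring
      _ ≤ 1 := ha
  have hseq : ∀ x ∈ (univ.filter fun x : Fin M → C =>
      ∀ c, (univ.filter fun p => halfLabel bar x p = c).card = S c),
      ∏ i, w (x i) = Real.exp (-((∑ c, S c * a c) / 2)) := by
    intro x hx
    have hx' := (mem_filter.1 hx).2
    have h1 : ∑ c, S c * a c = ∑ p, a (halfLabel bar x p) := by
      rw [← sum_fiberwise univ (halfLabel bar x) fun p => a (halfLabel bar x p)]
      refine sum_congr rfl fun c _ => ?_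
      rw [sum_congr rfl fun p hp => by rw [(mem_filter.1 hp).2], sum_const, hx' c, nsmul_eq_mul]
    rw [← Real.exp_sum, h1, Fintype.sum_prod_type, sum_neg_distrib, ← sum_div]
    simp [halfLabel, add_comm]
  have htot : ((univ.filter fun x : Fin M → C =>
      ∀ c, (univ.filter fun p => halfLabel bar x p = c).card = S c).card : ℝ)
        * Real.exp (-((∑ c, S c * a c) / 2)) ≤ 1 := by
    rw [← nsmul_eq_mul, ← sum_const, ← sum_congr rfl hseq]
    calc _ ≤ ∑ x : Fin M → C, ∏ i, w (x i) :=
          sum_le_sum_of_subset_of_nonneg (filter_subset _ _)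
            fun _ _ _ => prod_nonneg fun _ _ => (Real.exp_pos _).le
      _ = (∑ c, w c) ^ M := by
          rw [← Fintype.piFinset_univ, ← prod_univ_sum]; simp
      _ ≤ 1 := pow_le_one₀ (sum_nonneg fun _ _ => (Real.exp_pos _).le) hwsum
  rwa [Real.exp_neg, ← div_eq_mul_inv, div_le_one (Real.exp_pos _)] at htot


/-- The configuration-model count: an oriented enumeration is determined by its label sequence and
by the vertices at which the half-edges of each label sit. Once the label sequence is fixed, the
placements of different labels are bounded independently, forgetting that the graph is simple. -/
theorem card_labelledGraphs_le {A Q : Type*} [LinearOrder V] [Fintype V] [Fintype A] [Fintype Q]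
    [DecidableEq A] [DecidableEq Q] {bar : A ⊕ Q → A ⊕ Q} (hbar : ∀ c, bar (bar c) = c) {M : ℕ}
    (Fam : Finset (Finset (V × V × (A ⊕ Q))))
    (hM : ∀ P ∈ Fam, P.card = M) (hlt : ∀ P ∈ Fam, ∀ q ∈ P, q.1 < q.2.1)
    (S : A ⊕ Q → ℕ) (hS : ∀ P ∈ Fam, ∀ c, ∑ v, labelDegree bar P v c = S c)
    (good : Finset V) (D : V → A → ℕ)
    (hD : ∀ P ∈ Fam, ∀ v ∈ good, ∀ c, labelDegree bar P v (Sum.inl c) = D v c)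
    (a : A ⊕ Q → ℝ) (ha : ∑ c, Real.exp (-a c) ≤ 1) {lam : ℝ} (hlam : 0 < lam) :
    (Fam.card : ℝ) * (M ! * 2 ^ M) ≤ Real.exp ((∑ c, S c * a c) / 2) *
      ((∏ c : A, (S (Sum.inl c))! * Real.exp (goodᶜ.card) / ∏ v ∈ good, ((D v c)! : ℝ)) *
        ∏ q : Q, (S (Sum.inr q))! * Real.exp (lam * Fintype.card V) / lam ^ S (Sum.inr q)) := by
  classical
  set W : ℝ := (∏ c : A, (S (Sum.inl c))! * Real.exp (goodᶜ.card) / ∏ v ∈ good, ((D v c)! : ℝ)) *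
        ∏ q : Q, (S (Sum.inr q))! * Real.exp (lam * Fintype.card V) / lam ^ S (Sum.inr q) with hW
  set X := univ.filter fun x : Fin M → A ⊕ Q =>
      ∀ c, (univ.filter fun p => halfLabel bar x p = c).card = S c with hX
  set Z := univ.filter fun z : Fin M → V × V × (A ⊕ Q) =>
    (∀ c, (univ.filter fun p => (halfEdge bar z p).2 = c).card = S c) ∧
      ∀ v ∈ good, ∀ c, (univ.filter fun p => halfEdge bar z p = (v, Sum.inl c)).card = D v c with hZ
  have hlabel : ∀ (z : Fin M → V × V × (A ⊕ Q)) p,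
      (halfEdge bar z p).2 = halfLabel bar (fun i => (z i).2.2) p := by
    intro z p
    unfold halfEdge halfLabel
    split_ifs <;> rfl
  have h1 : Fam.card * (M ! * 2 ^ M) ≤ Z.card := by
    refine card_mul_le_card_enumerations hbar Fam hM hlt Z fun P hP z hz => ?_
    refine mem_filter.2 ⟨mem_univ _, fun c => ?_, fun v hv c => (hz v _).trans (hD P hP v hv c)⟩
    rw [← hS P hP c, card_eq_sum_card_fiberwise (f := fun p => (halfEdge bar z p).1)
      (t := univ) (fun _ _ => mem_univ _)]
    refine sum_congr rfl fun v _ => ?_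
    rw [← hz v c, filter_filter]
    congr 1
    ext p
    simp [Prod.ext_iff, and_comm]
  have hmap : ∀ z ∈ Z, (fun i => (z i).2.2) ∈ X := by
    intro z hz
    refine mem_filter.2 ⟨mem_univ _, fun c => ?_⟩
    simpa only [hlabel] using (mem_filter.1 hz).2.1 c
  have hfib : ∀ x ∈ X, ((Z.filter fun z => (fun i => (z i).2.2) = x).card : ℝ) ≤ W := by
    intro x hx
    have hxS : ∀ c, Fintype.card {p // halfLabel bar x p = c} = S c := fun c => by
      rw [Fintype.card_subtype]; exact (mem_filter.1 hx).2 c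
    -- Admissible placements of the half-edges with label c: prescribed numbers at good vertices if
    -- c comes from A, no constraint if c is in the second summand.
    let B : ∀ c, Finset ({p // halfLabel bar x p = c} → V) := fun c =>
      univ.filter fun f => ∀ a, c = Sum.inl a →
        ∀ v ∈ good, (univ.filter fun p => f p = v).card = D v a
    let Ψ : (Fin M → V × V × (A ⊕ Q)) → ∀ c, {p // halfLabel bar x p = c} → V :=
      fun z c p => (halfEdge bar z p.1).1
    have hle : (Z.filter fun z => (fun i => (z i).2.2) = x).card ≤ (Fintype.piFinset B).card := by
      refine card_le_card_of_injOn Ψ (fun z hz => ?_) fun z hz z' hz' hzz => ?_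
      · have hz := mem_filter.1 (mem_coe.1 hz)
        refine mem_coe.2 (Fintype.mem_piFinset.2 fun c => mem_filter.2 ⟨mem_univ _, ?_⟩)
        rintro a rfl v hv
        rw [← (mem_filter.1 hz.1).2.2 v hv a]
        refine card_bij (fun p _ => p.1) (fun p hp => ?_) (fun _ _ _ _ h => Subtype.ext h)
          fun p hp => ?_
        · have h2 := hlabel z p.1
          rw [hz.2, p.2] at h2
          exact mem_filter.2 ⟨mem_univ _, Prod.ext (mem_filter.1 hp).2 h2⟩
        · have hp := (mem_filter.1 hp).2
          have h2 := hlabel z p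
          rw [hz.2, hp] at h2
          refine ⟨⟨p, h2.symm⟩, mem_filter.2 ⟨mem_univ _, ?_⟩, rfl⟩
          simp [Ψ, hp]
      · have hz := (mem_filter.1 (mem_coe.1 hz)).2
        have hz' := (mem_filter.1 (mem_coe.1 hz')).2
        have hp : ∀ p, (halfEdge bar z p).1 = (halfEdge bar z' p).1 := fun p =>
          congrFun (congrFun hzz (halfLabel bar x p)) ⟨p, rfl⟩
        funext i
        refine Prod.ext (hp (i, false)) (Prod.ext (hp (i, true)) ?_)
        exact (congrFun hz i).trans (congrFun hz' i).symm
    have hprod : ((Fintype.piFinset B).card : ℝ) ≤ W := by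
      rw [Fintype.card_piFinset, Nat.cast_prod, Fintype.prod_sum_type]
      refine mul_le_mul ?_ ?_ (prod_nonneg fun _ _ => Nat.cast_nonneg _)
        (prod_nonneg fun _ _ => by positivity)
      · refine Finset.prod_le_prod (fun _ _ => Nat.cast_nonneg _) fun c _ => ?_
        have := card_fiberCard_eq_on_le (α := {p // halfLabel bar x p = Sum.inl c}) good
          (fun v => D v c)
        rw [hxS] at this
        refine le_trans (Nat.cast_le.2 (card_le_card fun f hf => ?_)) this
        exact mem_filter.2 ⟨mem_univ _, (mem_filter.1 hf).2 c rfl⟩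
      · refine Finset.prod_le_prod (fun _ _ => Nat.cast_nonneg _) fun q _ => ?_
        refine le_trans ?_ (card_pow_le_factorial_mul_exp hlam _ _)
        have := card_le_univ (B (Sum.inr q))
        rw [Fintype.card_fun, hxS] at this
        exact_mod_cast this
    exact (Nat.cast_le.2 hle).trans hprod
  have hW0 : 0 ≤ W := mul_nonneg (prod_nonneg fun _ _ => by positivity)
    (prod_nonneg fun _ _ => by positivity)
  calc (Fam.card : ℝ) * (M ! * 2 ^ M) ≤ Z.card := by exact_mod_cast h1
    _ = ∑ x ∈ X, ((Z.filter fun z => (fun i => (z i).2.2) = x).card : ℝ) := by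
        rw [card_eq_sum_card_fiberwise hmap, Nat.cast_sum]
    _ ≤ ∑ x ∈ X, W := sum_le_sum hfib
    _ = X.card * W := by rw [sum_const, nsmul_eq_mul]
    _ ≤ _ := mul_le_mul_of_nonneg_right (card_labelSequences_le bar hbar S a ha) hW0

/-- Counting labelled graphs together with a colouring of the vertices. The colour `inl t` of a
vertex determines its degrees for the labels in `A`. -/
theorem card_colouredLabelledGraphs_le {A Q F Θ : Type*} [LinearOrder V] [Fintype V] [Fintype A]
    [Fintype Q] [Fintype F] [Fintype Θ] [DecidableEq A] [DecidableEq Q] [DecidableEq F]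
    [DecidableEq Θ] {bar : A ⊕ Q → A ⊕ Q} (hbar : ∀ c, bar (bar c) = c) {M : ℕ}
    (K : Finset ((V → F ⊕ Θ) × Finset (V × V × (A ⊕ Q))))
    (hM : ∀ k ∈ K, k.2.card = M) (hlt : ∀ k ∈ K, ∀ q ∈ k.2, q.1 < q.2.1)
    (E : F → A → ℕ)
    (hE : ∀ k ∈ K, ∀ v t, k.1 v = Sum.inl t → ∀ c, labelDegree bar k.2 v (Sum.inl c) = E t c)
    (a : A ⊕ Q → ℝ) (ha : ∑ c, Real.exp (-a c) ≤ 1)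
    (b : F ⊕ Θ → ℝ) (hb : ∑ t, Real.exp (-b t) ≤ 1) {lam : ℝ} (hlam : 0 < lam) (X : ℝ)
    (hX : ∀ k ∈ K, ∀ S : A ⊕ Q → ℕ, (∀ c, S c = ∑ v, labelDegree bar k.2 v c) →
      ∑ v, Sum.elim (fun t => b (Sum.inl t) - ∑ c, Real.log (E t c)!)
          (fun θ => b (Sum.inr θ) + Fintype.card A) (k.1 v)
        + ∑ c, (S c * a c / 2 + Real.log (S c)!)
        + ∑ q : Q, (lam * Fintype.card V - S (Sum.inr q) * Real.log lam) ≤ X) :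
    (K.card : ℝ) * (M ! * 2 ^ M) ≤
      (2 * M + 1) ^ (Fintype.card A + Fintype.card Q) * Real.exp X := by
  classical
  -- Every label total is at most 2M, so only polynomially many profiles S occur.
  have hmap : ∀ k ∈ K, (k.1, fun c => ∑ v, labelDegree bar k.2 v c) ∈
      (univ : Finset (V → F ⊕ Θ)) ×ˢ Fintype.piFinset fun _ : A ⊕ Q => range (2 * M + 1) := by
    intro k hk
    refine mem_product.2 ⟨mem_univ _, Fintype.mem_piFinset.2 fun c => ?_⟩
    rw [Finset.mem_range, Nat.lt_succ_iff, ← hM k hk, ← sum_sum_labelDegree bar k.2]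
    exact single_le_sum (f := fun c => ∑ v, labelDegree bar k.2 v c)
      (fun _ _ => Nat.zero_le _) (mem_univ c)
  -- The weight of the colouring is kept outside `exp X`: summed over all T it becomes (∑
  -- exp(-b))^|V| ≤ 1, which is how colourings are counted without further combinatorics.
  have hfib : ∀ T : V → F ⊕ Θ, ∀ S : A ⊕ Q → ℕ,
      ((K.filter fun k => (k.1, fun c => ∑ v, labelDegree bar k.2 v c) = (T, S)).card : ℝ)
        * (M ! * 2 ^ M) ≤ Real.exp X * ∏ v, Real.exp (-b (T v)) := by
    intro T S
    set K' := K.filter fun k => (k.1, fun c => ∑ v, labelDegree bar k.2 v c) = (T, S) with hK'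
    rcases K'.eq_empty_or_nonempty with h0 | ⟨k₀, hk₀⟩
    · rw [h0]
      simp only [Finset.card_empty, Nat.cast_zero, zero_mul]
      exact mul_nonneg (Real.exp_pos _).le (prod_nonneg fun _ _ => (Real.exp_pos _).le)
    have hK1 : ∀ k ∈ K', k ∈ K ∧ k.1 = T ∧ ∀ c, ∑ v, labelDegree bar k.2 v c = S c := by
      intro k hk
      obtain ⟨h1, h2⟩ := mem_filter.1 hk
      exact ⟨h1, congrArg Prod.fst h2, congrFun (congrArg Prod.snd h2)⟩
    have hinj : Set.InjOn Prod.snd (K' : Set ((V → F ⊕ Θ) × Finset (V × V × (A ⊕ Q)))) :=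
      fun k hk k' hk' h => Prod.ext ((hK1 k hk).2.1.trans (hK1 k' hk').2.1.symm) h
    have hcard : (K'.image Prod.snd).card = K'.card := card_image_of_injOn hinj
    set good : Finset V := univ.filter fun v => (T v).isLeft with hgood
    have main := card_labelledGraphs_le hbar (M := M) (K'.image Prod.snd)
      (by
        intro P hP
        obtain ⟨k, hk, rfl⟩ := mem_image.1 hP
        exact hM k (hK1 k hk).1)
      (by
        intro P hP
        obtain ⟨k, hk, rfl⟩ := mem_image.1 hP
        exact hlt k (hK1 k hk).1)
      S
      (by
        intro P hP
        obtain ⟨k, hk, rfl⟩ := mem_image.1 hP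
        exact (hK1 k hk).2.2)
      -- The value 0 at vertices outside `good` is a filler; the degree condition is imposed only on
      -- `good`.
      good (fun v c => Sum.elim (fun t => E t c) (fun _ => 0) (T v))
      (by
        intro P hP v hv c
        obtain ⟨k, hk, rfl⟩ := mem_image.1 hP
        obtain ⟨t, ht⟩ := Sum.isLeft_iff.1 (mem_filter.1 hv).2
        rw [ht]
        exact hE k (hK1 k hk).1 v t ((congrFun (hK1 k hk).2.1 v).trans ht) c)
      a ha hlam
    rw [hcard] at main
    refine main.trans ?_
    -- The exponent depends on T and S only, so one representative of the fibre suffices.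
    have hXk := hX k₀ (hK1 k₀ hk₀).1 S fun c => ((hK1 k₀ hk₀).2.2 c).symm
    rw [(hK1 k₀ hk₀).2.1] at hXk
    have hf : ∀ m : ℕ, (m ! : ℝ) = Real.exp (Real.log m !) := fun m =>
      (Real.exp_log (by positivity)).symm
    have hA : ∏ c : A, ((S (Sum.inl c))! * Real.exp (goodᶜ.card) /
        ∏ v ∈ good, ((Sum.elim (fun t => E t c) (fun _ => 0) (T v))! : ℝ)) =
        Real.exp (∑ c : A, (Real.log (S (Sum.inl c))! + goodᶜ.card -
          ∑ v ∈ good, Real.log (Sum.elim (fun t => E t c) (fun _ => 0) (T v))!)) := by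
      rw [Real.exp_sum]
      refine prod_congr rfl fun c _ => ?_
      rw [Real.exp_sub, Real.exp_add, Real.exp_sum, ← hf]
      congr 1
      exact prod_congr rfl fun v _ => hf _
    have hQ : ∏ q : Q, ((S (Sum.inr q))! * Real.exp (lam * Fintype.card V) /
        lam ^ S (Sum.inr q)) = Real.exp (∑ q : Q, (Real.log (S (Sum.inr q))! +
          (lam * Fintype.card V - S (Sum.inr q) * Real.log lam))) := by
      rw [Real.exp_sum]
      refine prod_congr rfl fun q _ => ?_
      rw [Real.exp_add, Real.exp_sub, ← hf, Real.exp_nat_mul, Real.exp_log hlam, mul_div_assoc]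
    rw [hA, hQ, ← Real.exp_add, ← Real.exp_add, ← Real.exp_sum, ← Real.exp_add]
    refine Real.exp_le_exp.2 ?_
    have hvert : ∑ v, Sum.elim (fun t => b (Sum.inl t) - ∑ c, Real.log (E t c)!)
          (fun θ => b (Sum.inr θ) + Fintype.card A) (T v) = ∑ v, b (T v)
          + Fintype.card A * goodᶜ.card
          - ∑ c : A, ∑ v ∈ good, Real.log (Sum.elim (fun t => E t c) (fun _ => 0) (T v))! := by
      have h1 : (goodᶜ.card : ℝ) = ∑ v, if (T v).isLeft then (0 : ℝ) else 1 := by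
        have : goodᶜ = univ.filter fun v => ¬ (T v).isLeft := by
          ext v; simp [hgood]
        rw [this, card_filter]
        push_cast
        refine sum_congr rfl fun v _ => ?_
        rcases T v with t | θ <;> simp
      rw [sum_comm, h1, hgood, sum_filter, mul_sum, ← sum_add_distrib, ← sum_sub_distrib]
      refine sum_congr rfl fun v _ => ?_
      rcases T v with t | θ <;> simp
    rw [hvert, Fintype.sum_sum_type] at hXk
    simp only [sum_add_distrib, sum_sub_distrib, sum_const, Finset.card_univ, nsmul_eq_mul,
      sum_neg_distrib] at hXk ⊢
    have h2 : (∑ c, S c * a c) / 2 =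
        ∑ c : A, S (Sum.inl c) * a (Sum.inl c) / 2 + ∑ q : Q, S (Sum.inr q) * a (Sum.inr q) / 2 := by
      rw [Fintype.sum_sum_type, add_div, sum_div, sum_div]
    rw [h2]
    linarith
  have hK : (K.card : ℝ) = ∑ x ∈ (univ : Finset (V → F ⊕ Θ)) ×ˢ
      Fintype.piFinset (fun _ : A ⊕ Q => range (2 * M + 1)),
      ((K.filter fun k => (k.1, fun c => ∑ v, labelDegree bar k.2 v c) = x).card : ℝ) := by
    rw [card_eq_sum_card_fiberwise hmap, Nat.cast_sum]
  rw [hK, sum_mul]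
  calc _ ≤ ∑ x ∈ (univ : Finset (V → F ⊕ Θ)) ×ˢ
      Fintype.piFinset (fun _ : A ⊕ Q => range (2 * M + 1)),
        Real.exp X * ∏ v, Real.exp (-b (x.1 v)) := sum_le_sum fun x _ => hfib x.1 x.2
    _ = (2 * M + 1) ^ (Fintype.card A + Fintype.card Q) *
        (Real.exp X * (∑ t, Real.exp (-b t)) ^ Fintype.card V) := by
        rw [sum_product]
        have : (∑ t, Real.exp (-b t)) ^ Fintype.card V =
            ∑ T : V → F ⊕ Θ, ∏ v, Real.exp (-b (T v)) := by
          rw [← Fintype.piFinset_univ,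
            ← prod_univ_sum (fun _ : V => univ) fun _ t => Real.exp (-b t)]
          simp
        rw [this]
        simp only [sum_const, nsmul_eq_mul, ← mul_sum, Fintype.card_piFinset, card_range,
          prod_const, Finset.card_univ, Fintype.card_sum]
        push_cast
        ring
    _ ≤ _ := by
        have : (∑ t, Real.exp (-b t)) ^ Fintype.card V ≤ 1 :=
          pow_le_one₀ (sum_nonneg fun _ _ => (Real.exp_pos _).le) hb
        gcongr
        exact mul_le_of_le_one_right (Real.exp_pos _).le this

end Counting

/-! ### Root statistics depend on a neighborhood of the root -/

namespace MarkedGraph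

variable {Ξ : Type u} {Θ : Type v}

theorem ballSet_deleteEdge_subset {V : Type*} (G : MarkedGraph V Ξ Θ) (a b o : V) (k : ℕ) :
    (G.deleteEdge a b).ballSet o k ⊆ G.ballSet o k := by
  rintro w ⟨p, hp⟩
  exact ⟨p.mapLe (SimpleGraph.deleteEdges_le _), (SimpleGraph.Walk.length_map _ p).trans_le hp⟩

theorem ballSet_subset_of_adj {V : Type*} (G : MarkedGraph V Ξ Θ) {o v : V}
    (a : G.graph.Adj o v) (k : ℕ) : G.ballSet v k ⊆ G.ballSet o (k + 1) := by
  rintro w ⟨p, hp⟩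
  exact ⟨p.cons a, by simpa using hp⟩

theorem mem_ballSet_of_adj {V : Type*} (G : MarkedGraph V Ξ Θ) {o v : V}
    (a : G.graph.Adj o v) {h : ℕ} (hh : 1 ≤ h) : v ∈ G.ballSet o h :=
  ⟨a.toWalk, by simpa using hh⟩

/-- A branch cut at depth k sees only the k-ball of its root, and deleting an edge shrinks balls;
containing the whole component is not required. -/
theorem branch_induce_of_ballSet_subset {V : Type} [Countable V] (G : MarkedGraph V Ξ Θ)
    (s : Set V) (k : ℕ) (u v : s) (hs : G.ballSet v k ⊆ s) (a : (G.induce s).graph.Adj u v) :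
    (G.induce s).branch k u v a = G.branch k u v a := by
  have h1 : ((G.induce s).deleteEdge u v).cls v = ((G.deleteEdge (u : V) v).induce s).cls v :=
    cls_eq_of_iso (Iso.induceDeleteEdge G s u v) v
  refine Prod.ext rfl ((congrArg (GStar.trunc k) h1).trans ?_)
  exact Quotient.sound (RootedMarkedGraph.ball_induce ⟨V, inferInstance, G.deleteEdge (u : V) v, v⟩
    s v.2 k ((G.ballSet_deleteEdge_subset _ _ _ _).trans hs))

theorem finite_ballSet {V : Type*} (G : MarkedGraph V Ξ Θ) (o : V) (h : ℕ) :
    (G.ballSet o h).Finite := by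
  induction h generalizing o with
  | zero =>
    refine (Set.finite_singleton o).subset ?_
    rintro w ⟨p, hp⟩
    exact (SimpleGraph.Walk.eq_of_length_eq_zero (Nat.le_zero.1 hp)).symm
  | succ h ih =>
    refine ((Set.finite_singleton o).union
      ((G.locallyFinite o).biUnion fun v _ => ih v)).subset ?_
    rintro w ⟨p, hp⟩
    cases p with
    | nil => exact Or.inl rfl
    | cons a p => exact Or.inr (Set.mem_biUnion a ⟨p, by simpa using hp⟩)

theorem ext_of_forall {V : Type*} {G G' : MarkedGraph V Ξ Θ}
    (hadj : ∀ v w, G.graph.Adj v w ↔ G'.graph.Adj v w)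
    (hedge : ∀ v w a a', G.edgeMark v w a = G'.edgeMark v w a')
    (hvert : ∀ v, G.vertexMark v = G'.vertexMark v) : G = G' := by
  obtain ⟨g, l, e, t⟩ := G
  obtain ⟨g', l', e', t'⟩ := G'
  obtain rfl : g = g' := by
    ext v w
    exact hadj v w
  obtain rfl : e = e' := by
    funext v w a
    exact hedge v w a a
  obtain rfl : t = t' := funext hvert
  rfl

instance finite_of_finite {V : Type} [Finite V] [Finite Ξ] [Finite Θ] :
    Finite (MarkedGraph V Ξ Θ) := by
  classical
  refine Finite.of_injective
    (β := (V → V → Option Ξ) × (V → Θ))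
    (fun G => (fun v w => if a : G.graph.Adj v w then some (G.edgeMark v w a) else none,
      G.vertexMark)) fun G G' hGG => ?_
  have h1 : ∀ v w, (if a : G.graph.Adj v w then some (G.edgeMark v w a) else none) =
      if a : G'.graph.Adj v w then some (G'.edgeMark v w a) else none := fun v w =>
    congrFun (congrFun (congrArg Prod.fst hGG) v) w
  refine ext_of_forall (fun v w => ?_) (fun v w a a' => ?_) (congrFun (congrArg Prod.snd hGG))
  · have := h1 v w
    split_ifs at this <;> simp_all
  · simpa [a, a'] using h1 v w

end MarkedGraph

/-! ### Statistics of the root as functions of its h-ball -/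

namespace GStar

variable {Ξ : Type u} {Θ : Type v}

/-- Local finiteness makes balls finite, so each class is realised on some `Fin N`, where finite
mark sets leave finitely many graphs. -/
theorem countable_range_trunc [Finite Ξ] [Finite Θ] (h : ℕ) :
    (Set.range (trunc h : GStar Ξ Θ → GStar Ξ Θ)).Countable := by
  refine (Set.countable_range fun x : Σ N : ℕ, MarkedGraph (Fin N) Ξ Θ × Fin N =>
    x.2.1.cls x.2.2).mono ?_
  rintro _ ⟨g, rfl⟩
  induction g using Quotient.inductionOn with
  | h r =>
    have hfin : Finite (r.G.ballSet r.root h) := (r.G.finite_ballSet r.root h).to_subtype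
    obtain ⟨N, ⟨e⟩⟩ := Finite.exists_equiv_fin (r.G.ballSet r.root h)
    let K := r.G.induce (r.G.ballSet r.root h)
    let K' : MarkedGraph (Fin N) Ξ Θ :=
      { graph := K.graph.comap e.symm
        locallyFinite := fun _ => Set.toFinite _
        edgeMark := fun v w a => K.edgeMark (e.symm v) (e.symm w) a
        vertexMark := fun v => K.vertexMark (e.symm v) }
    let f : MarkedGraph.Iso K' K :=
      { toEquiv := e.symm
        adj_iff := fun _ _ => Iff.rfl
        edgeMark_eq := fun _ _ _ _ => rfl
        vertexMark_eq := fun _ => rfl }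
    refine ⟨⟨N, K', e (r.G.rootBall r.root h)⟩, ?_⟩
    refine (MarkedGraph.cls_eq_of_iso f _).trans ?_
    change K.cls (e.symm (e _)) = _
    rw [Equiv.symm_apply_apply]
    rfl

theorem rootMark_trunc (h : ℕ) (g : GStar Ξ Θ) : (g.trunc h).rootMark = g.rootMark := by
  induction g using Quotient.inductionOn with
  | h r => rfl

theorem degMark_trunc {h : ℕ} (hh : 1 ≤ h) (x x' : Ξ) (g : GStar Ξ Θ) :
    (g.trunc h).degMark x x' = g.degMark x x' := by
  induction g using Quotient.inductionOn with
  | h r =>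
    change (r.ball h).degMark x x' = r.degMark x x'
    unfold RootedMarkedGraph.degMark
    refine (Set.ncard_image_of_injective _ (Subtype.val_injective :
      Function.Injective ((↑) : r.G.ballSet r.root h → r.V))).symm.trans (congrArg _ ?_)
    ext w
    constructor
    · rintro ⟨v, ⟨a, ha⟩, rfl⟩
      exact ⟨a, ha⟩
    · rintro ⟨a, ha⟩
      exact ⟨⟨w, r.G.mem_ballSet_of_adj a hh⟩, ⟨a, ha⟩, rfl⟩

theorem deg_trunc {h : ℕ} (hh : 1 ≤ h) (g : GStar Ξ Θ) : (g.trunc h).deg = g.deg := by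
  induction g using Quotient.inductionOn with
  | h r =>
    change (r.ball h).deg = r.deg
    unfold RootedMarkedGraph.deg
    refine (Set.ncard_image_of_injective _ (Subtype.val_injective :
      Function.Injective ((↑) : r.G.ballSet r.root h → r.V))).symm.trans (congrArg _ ?_)
    ext w
    constructor
    · rintro ⟨v, a, rfl⟩
      exact a
    · intro a
      exact ⟨⟨w, r.G.mem_ballSet_of_adj a hh⟩, a, rfl⟩

/-- The depth h - 1 branches at both ends of a root edge lie in the h-ball of the root: the
(h-1)-ball of a neighbour is inside it. Hence the class of the h-ball fixes all type counts. -/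
theorem typeCount_trunc {h : ℕ} (hh : 1 ≤ h) (t t' : Ξ × GStar Ξ Θ) (g : GStar Ξ Θ) :
    (g.trunc h).typeCount h t t' = g.typeCount h t t' := by
  obtain ⟨k, rfl⟩ : ∃ k, h = k + 1 := ⟨h - 1, by omega⟩
  induction g using Quotient.inductionOn with
  | h r =>
    change (r.ball (k + 1)).typeCount k t t' = r.typeCount k t t'
    unfold RootedMarkedGraph.typeCount
    refine (Set.ncard_image_of_injective _ (Subtype.val_injective :
      Function.Injective ((↑) : r.G.ballSet r.root (k + 1) → r.V))).symm.trans (congrArg _ ?_)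
    have hb1 : ∀ (w : r.G.ballSet r.root (k + 1)) (a), (r.ball (k + 1)).G.branch k w
        (r.ball (k + 1)).root a = r.G.branch k w r.root a := fun w a =>
      r.G.branch_induce_of_ballSet_subset _ k w (r.G.rootBall r.root (k + 1))
        (r.G.ballSet_mono _ (Nat.le_succ k)) a
    have hb2 : ∀ (w : r.G.ballSet r.root (k + 1)) (a), (r.ball (k + 1)).G.branch k
        (r.ball (k + 1)).root w a = r.G.branch k r.root w a := fun w a =>
      r.G.branch_induce_of_ballSet_subset _ k (r.G.rootBall r.root (k + 1)) w
        (r.G.ballSet_subset_of_adj a k) a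
    ext w
    constructor
    · rintro ⟨v, ⟨a, ha, ha'⟩, rfl⟩
      exact ⟨a, (hb1 v _).symm.trans ha, (hb2 v _).symm.trans ha'⟩
    · rintro ⟨a, ha, ha'⟩
      exact ⟨⟨w, r.G.mem_ballSet_of_adj a hh⟩, ⟨a, (hb1 _ _).trans ha, (hb2 _ _).trans ha'⟩, rfl⟩

/-- The root degree is the sum of the numbers of neighbors of each mark pair. -/
theorem sum_degMark [Fintype Ξ] (g : GStar Ξ Θ) : ∑ x, ∑ x', g.degMark x x' = g.deg := by
  classical
  induction g using Quotient.inductionOn with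
  | h r =>
    change ∑ x, ∑ x', r.degMark x x' = r.deg
    have hfin := r.G.locallyFinite r.root
    have h1 : ∀ x x', r.degMark x x' = (hfin.toFinset.filter fun v =>
        ∃ a : r.G.graph.Adj r.root v, r.G.edgeMark v r.root a.symm = x ∧
          r.G.edgeMark r.root v a = x').card := by
      intro x x'
      unfold RootedMarkedGraph.degMark
      rw [← Set.ncard_coe_finset]
      congr 1
      ext v
      simp only [Finset.coe_filter, Set.mem_ofPred_eq, Set.Finite.mem_toFinset]
      exact ⟨fun ⟨a, ha⟩ => ⟨a, a, ha⟩, fun ha => ha.2⟩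
    simp_rw [h1, Finset.card_filter]
    rw [RootedMarkedGraph.deg, Set.ncard_eq_toFinset_card _ hfin, Finset.card_eq_sum_ones]
    simp_rw [Finset.sum_comm (t := hfin.toFinset)]
    refine Finset.sum_congr rfl fun v hv => ?_
    have a : r.G.graph.Adj r.root v := hfin.mem_toFinset.1 hv
    simp [a, ite_and]

/-- Guarantees that no root edge of a forest is missed when summing over `EdgeTypes`, whose branches
are restricted to trees. -/
theorem branch_mem_treesOfDepth {V : Type} [Countable V] {G : MarkedGraph V Ξ Θ}
    (hG : G.graph.IsAcyclic) (k : ℕ) (u v : V) (a : G.graph.Adj u v) :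
    (G.branch k u v a).2 ∈ treesOfDepth Ξ Θ k := by
  set r : RootedMarkedGraph Ξ Θ := ⟨V, inferInstance, G.deleteEdge u v, v⟩ with hr
  refine ⟨r.ball k, rfl, ?_, ?_⟩
  · have h1 : (G.deleteEdge u v).graph.IsAcyclic := hG.anti (SimpleGraph.deleteEdges_le _)
    exact h1.induce _
  · intro w _
    exact (r.G.mem_ballSet_induce _ (r.G.rootBall v k) w k subset_rfl).2 w.2

/-- For a tree, every edge at the root has a type. -/
theorem tsum_edgeTypeCount {h : ℕ} {g : GStar Ξ Θ} (hg : g ∈ trees Ξ Θ) :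
    ∑' c : EdgeTypes Ξ Θ h, (edgeTypeCount h c g : ℝ≥0∞) = g.deg := by
  classical
  obtain ⟨r, rfl, hr⟩ := hg
  have hfin := r.G.locallyFinite r.root
  let κ : EdgeTypes Ξ Θ h → (Ξ × GStar Ξ Θ) × (Ξ × GStar Ξ Θ) := fun c =>
    ((c.1.1, c.1.2), (c.2.1, c.2.2))
  have hκ : Function.Injective κ := by
    rintro ⟨⟨x, t⟩, x', t'⟩ ⟨⟨y, s⟩, y', s'⟩ hc
    simp only [κ, Prod.mk.injEq] at hc
    obtain ⟨⟨rfl, h1⟩, rfl, h2⟩ := hc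
    rw [Subtype.ext h1, Subtype.ext h2]
  have h1 : ∀ c : EdgeTypes Ξ Θ h, (edgeTypeCount h c (Quotient.mk _ r) : ℝ≥0∞) =
      ∑ v ∈ hfin.toFinset, if ∃ a : r.G.graph.Adj r.root v,
        (r.G.branch (h - 1) v r.root a.symm, r.G.branch (h - 1) r.root v a) = κ c
          then 1 else 0 := by
    intro c
    change (r.typeCount (h - 1) _ _ : ℝ≥0∞) = _
    unfold RootedMarkedGraph.typeCount
    rw [Finset.sum_boole, ← Set.ncard_coe_finset]
    congr 2
    ext v
    simp only [Finset.coe_filter, Set.mem_ofPred_eq, Set.Finite.mem_toFinset, κ, Prod.mk.injEq]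
    exact ⟨fun ⟨a, ha⟩ => ⟨a, a, ha⟩, fun ha => ha.2⟩
  simp_rw [h1]
  rw [Summable.tsum_finsetSum fun _ _ => ENNReal.summable]
  have h2 : ∀ v ∈ hfin.toFinset, (∑' c : EdgeTypes Ξ Θ h, if ∃ a : r.G.graph.Adj r.root v,
        (r.G.branch (h - 1) v r.root a.symm, r.G.branch (h - 1) r.root v a) = κ c
          then (1 : ℝ≥0∞) else 0) = 1 := by
    intro v hv
    have a : r.G.graph.Adj r.root v := hfin.mem_toFinset.1 hv
    obtain ⟨c₀, hc₀⟩ : ∃ c₀, κ c₀ =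
        (r.G.branch (h - 1) v r.root a.symm, r.G.branch (h - 1) r.root v a) :=
      ⟨⟨⟨_, _, branch_mem_treesOfDepth hr (h - 1) v r.root a.symm⟩,
        ⟨_, _, branch_mem_treesOfDepth hr (h - 1) r.root v a⟩⟩, rfl⟩
    rw [tsum_eq_single c₀]
    · simp [a, hc₀]
    · intro c hc
      simp only [a, exists_true_left, ← hc₀]
      exact if_neg fun hcc => hc (hκ hcc).symm
  rw [Finset.sum_congr rfl h2]
  change _ = ((r.deg : ℕ) : ℝ≥0∞)
  rw [RootedMarkedGraph.deg, Set.ncard_eq_toFinset_card _ hfin]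
  simp

end GStar

/-! ### Edge lists of labelled graphs -/

section EdgeList

open Classical in
/-- The list of labelled edges, oriented from the smaller to the larger endpoint. -/
noncomputable def edgeList {V C : Type*} [Fintype V] [LinearOrder V] [Fintype C]
    (G : SimpleGraph V) (lab : ∀ v w, G.Adj v w → C) : Finset (V × V × C) :=
  Finset.univ.filter fun q => q.1 < q.2.1 ∧ ∃ a, lab q.1 q.2.1 a = q.2.2

variable {V C : Type*} [Fintype V] [LinearOrder V] [Fintype C] {G : SimpleGraph V}
  {lab : ∀ v w, G.Adj v w → C}

theorem mem_edgeList {q : V × V × C} :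
    q ∈ edgeList G lab ↔ q.1 < q.2.1 ∧ ∃ a, lab q.1 q.2.1 a = q.2.2 := by
  simp [edgeList]

theorem card_edgeList :
    (edgeList G lab).card = {p : V × V | p.1 < p.2 ∧ G.Adj p.1 p.2}.ncard := by
  rw [← Set.ncard_coe_finset]
  refine (Set.InjOn.ncard_image (f := fun q : V × V × C => (q.1, q.2.1)) ?_).symm.trans
    (congrArg _ ?_)
  · rintro ⟨v, w, c⟩ hq ⟨v', w', c'⟩ hq' hqq
    simp only [Prod.mk.injEq] at hqq
    obtain ⟨rfl, rfl⟩ := hqq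
    obtain ⟨-, a, ha⟩ := mem_edgeList.1 hq
    obtain ⟨-, a', ha'⟩ := mem_edgeList.1 hq'
    exact congrArg (fun c => (v, w, c)) (ha.symm.trans ha')
  · ext ⟨v, w⟩
    constructor
    · rintro ⟨q, hq, hqq⟩
      obtain ⟨rfl, rfl⟩ := Prod.mk_inj.1 hqq
      obtain ⟨hlt, a, -⟩ := mem_edgeList.1 hq
      exact ⟨hlt, a⟩
    · rintro ⟨hlt, a⟩
      exact ⟨(v, w, lab v w a), mem_edgeList.2 ⟨hlt, a, rfl⟩, rfl⟩

theorem labelDegree_eq_card_add_card {V C : Type*} [DecidableEq V] [DecidableEq C] (bar : C → C)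
    (P : Finset (V × V × C)) (v : V) (c : C) : labelDegree bar P v c =
      (P.filter fun q => q.1 = v ∧ q.2.2 = c).card +
        (P.filter fun q => q.2.1 = v ∧ bar q.2.2 = c).card := by
  rw [Finset.card_filter, Finset.card_filter, ← Finset.sum_add_distrib]
  rfl

theorem card_filter_edgeList_fst [DecidableEq C] (v : V) (c : C) :
    ((edgeList G lab).filter fun q => q.1 = v ∧ q.2.2 = c).card =
      {w | v < w ∧ ∃ a, lab v w a = c}.ncard := by
  rw [← Set.ncard_coe_finset]
  refine (Set.InjOn.ncard_image (f := fun q : V × V × C => q.2.1) ?_).symm.trans (congrArg _ ?_)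
  · intro q hq q' hq' hqq
    have h1 := (Finset.mem_filter.1 (Finset.mem_coe.1 hq)).2
    have h2 := (Finset.mem_filter.1 (Finset.mem_coe.1 hq')).2
    exact Prod.ext (h1.1.trans h2.1.symm) (Prod.ext hqq (h1.2.trans h2.2.symm))
  · ext w
    constructor
    · rintro ⟨q, hq, rfl⟩
      obtain ⟨h1, h2, h3⟩ := Finset.mem_filter.1 (Finset.mem_coe.1 hq)
      subst h2 h3
      exact mem_edgeList.1 h1
    · intro hw
      exact ⟨(v, w, c), Finset.mem_coe.2 (Finset.mem_filter.2 ⟨mem_edgeList.2 hw, rfl, rfl⟩), rfl⟩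

theorem card_filter_edgeList_snd [DecidableEq C] {bar : C → C} (hbar : ∀ c, bar (bar c) = c)
    (hlab : ∀ v w a, lab w v (G.adj_symm a) = bar (lab v w a)) (v : V) (c : C) :
    ((edgeList G lab).filter fun q => q.2.1 = v ∧ bar q.2.2 = c).card =
      {w | w < v ∧ ∃ a, lab v w a = c}.ncard := by
  rw [← Set.ncard_coe_finset]
  refine (Set.InjOn.ncard_image (f := fun q : V × V × C => q.1) ?_).symm.trans (congrArg _ ?_)
  · intro q hq q' hq' hqq
    have h1 := (Finset.mem_filter.1 (Finset.mem_coe.1 hq)).2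
    have h2 := (Finset.mem_filter.1 (Finset.mem_coe.1 hq')).2
    refine Prod.ext hqq (Prod.ext (h1.1.trans h2.1.symm) ?_)
    rw [← hbar q.2.2, h1.2, ← h2.2, hbar]
  · ext w
    constructor
    · rintro ⟨q, hq, rfl⟩
      obtain ⟨h1, h2, h3⟩ := Finset.mem_filter.1 (Finset.mem_coe.1 hq)
      subst h2 h3
      obtain ⟨hlt, a, ha⟩ := mem_edgeList.1 h1
      exact ⟨hlt, G.adj_symm a, (hlab _ _ a).trans (congrArg bar ha)⟩
    · rintro ⟨hlt, a, ha⟩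
      exact ⟨(w, v, bar c), Finset.mem_coe.2 (Finset.mem_filter.2 ⟨mem_edgeList.2
        ⟨hlt, G.adj_symm a, (hlab _ _ a).trans (congrArg bar ha)⟩, rfl, hbar c⟩), rfl⟩

/-- Each edge is listed once, from its smaller endpoint: neighbours above v are seen at first ends,
those below v at second ends, where `bar` restores the label as seen from v. -/
theorem labelDegree_edgeList [DecidableEq C] {bar : C → C} (hbar : ∀ c, bar (bar c) = c)
    (hlab : ∀ v w a, lab w v (G.adj_symm a) = bar (lab v w a)) (v : V) (c : C) :
    labelDegree bar (edgeList G lab) v c = {w | ∃ a, lab v w a = c}.ncard := by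
  rw [labelDegree_eq_card_add_card, card_filter_edgeList_fst, card_filter_edgeList_snd hbar hlab,
    ← Set.ncard_union_eq]
  · congr 1
    ext w
    constructor
    · rintro (hw | hw)
      exacts [hw.2, hw.2]
    · rintro ⟨a, ha⟩
      rcases lt_or_gt_of_ne a.ne with hlt | hlt
      exacts [Or.inl ⟨hlt, a, ha⟩, Or.inr ⟨hlt, a, ha⟩]
  · exact Set.disjoint_left.2 fun w hw hw' => lt_asymm hw.1 hw'.1

theorem sum_ncard_label {V C : Type*} [Fintype V] [Fintype C] {G : SimpleGraph V}
    {lab : ∀ v w, G.Adj v w → C} (v : V) :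
    ∑ c, {w | ∃ a, lab v w a = c}.ncard = (G.neighborSet v).ncard := by
  classical
  have h1 : ∀ c, {w | ∃ a, lab v w a = c}.ncard =
      (Finset.univ.filter fun w => ∃ a, lab v w a = c).card := by
    intro c
    rw [← Set.ncard_coe_finset]
    congr 1
    ext w
    simp
  have h2 : (G.neighborSet v).ncard = (Finset.univ.filter fun w => G.Adj v w).card := by
    rw [← Set.ncard_coe_finset]
    congr 1
    ext w
    simp
  simp_rw [h1, h2, Finset.card_filter]
  rw [Finset.sum_comm]
  refine Finset.sum_congr rfl fun w _ => ?_
  by_cases a : G.Adj v w <;> simp [a]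

end EdgeList

/-- The number of edges is the total of the edge mark counts. -/
theorem MarkedGraph.edgeNorm_edgeMarkCount {Ξ : Type u} {Θ : Type v} [Fintype Ξ] [LinearOrder Ξ]
    {V : Type} [Fintype V] [LinearOrder V] (G : MarkedGraph V Ξ Θ) :
    edgeNorm G.edgeMarkCount = {p : V × V | p.1 < p.2 ∧ G.graph.Adj p.1 p.2}.ncard := by
  classical
  set W : Finset (V × V) := Finset.univ.filter fun p => p.1 < p.2 ∧ G.graph.Adj p.1 p.2 with hW
  have h0 : {p : V × V | p.1 < p.2 ∧ G.graph.Adj p.1 p.2}.ncard = W.card := by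
    rw [← Set.ncard_coe_finset]
    congr 1
    ext w
    simp [hW]
  have h1 : ∀ x x', G.edgeMarkCount x x' = (W.filter fun p => ∃ a : G.graph.Adj p.1 p.2,
      (G.edgeMark p.1 p.2 a = x ∧ G.edgeMark p.2 p.1 a.symm = x') ∨
        (G.edgeMark p.2 p.1 a.symm = x ∧ G.edgeMark p.1 p.2 a = x')).card := by
    intro x x'
    rw [← Set.ncard_coe_finset]
    symm
    refine (Set.InjOn.ncard_image (f := fun p : V × V => s(p.1, p.2)) ?_).symm.trans
      (congrArg _ ?_)
    · rintro ⟨v, w⟩ hp ⟨v', w'⟩ hp' hpp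
      have hp := (Finset.mem_filter.1 (Finset.mem_filter.1 (Finset.mem_coe.1 hp)).1).2.1
      have hp' := (Finset.mem_filter.1 (Finset.mem_filter.1 (Finset.mem_coe.1 hp')).1).2.1
      rcases Sym2.eq_iff.1 hpp with ⟨h1, h2⟩ | ⟨h1, h2⟩
      · exact Prod.ext h1 h2
      · simp only at hp hp' h1 h2
        rw [h1, h2] at hp
        exact absurd hp (not_lt_of_gt hp')
    · ext e
      constructor
      · rintro ⟨⟨v, w⟩, hp, rfl⟩
        obtain ⟨a, ha | ha⟩ := (Finset.mem_filter.1 (Finset.mem_coe.1 hp)).2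
        · exact ⟨v, w, a, rfl, ha⟩
        · exact ⟨w, v, a.symm, Sym2.eq_swap, ha⟩
      · rintro ⟨v, w, a, rfl, ha⟩
        rcases lt_or_gt_of_ne a.ne with hlt | hlt
        · exact ⟨(v, w), Finset.mem_coe.2 (Finset.mem_filter.2
            ⟨Finset.mem_filter.2 ⟨Finset.mem_univ _, hlt, a⟩, a, Or.inl ha⟩), rfl⟩
        · exact ⟨(w, v), Finset.mem_coe.2 (Finset.mem_filter.2
            ⟨Finset.mem_filter.2 ⟨Finset.mem_univ _, hlt, a.symm⟩, a.symm, Or.inr ha⟩),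
            Sym2.eq_swap⟩
  rw [h0, edgeNorm, Finset.card_eq_sum_ones]
  simp_rw [h1, Finset.card_filter]
  have h2 : ∀ x x' : Ξ, (if x ≤ x' then ∑ p ∈ W, (if ∃ a : G.graph.Adj p.1 p.2,
      (G.edgeMark p.1 p.2 a = x ∧ G.edgeMark p.2 p.1 a.symm = x') ∨
        (G.edgeMark p.2 p.1 a.symm = x ∧ G.edgeMark p.1 p.2 a = x') then 1 else 0) else 0) =
      ∑ p ∈ W, if x ≤ x' ∧ ∃ a : G.graph.Adj p.1 p.2,
      (G.edgeMark p.1 p.2 a = x ∧ G.edgeMark p.2 p.1 a.symm = x') ∨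
        (G.edgeMark p.2 p.1 a.symm = x ∧ G.edgeMark p.1 p.2 a = x') then 1 else 0 := by
    intro x x'
    split_ifs with hx <;> simp [hx]
  simp_rw [h2]
  simp_rw [Finset.sum_comm (t := W)]
  refine Finset.sum_congr rfl fun p hp => ?_
  have a := (Finset.mem_filter.1 hp).2.2
  -- An edge is counted by exactly one pair x ≤ x', the minimum and the maximum of its two marks.
  have h3 : ∀ x x' : Ξ, (x ≤ x' ∧ ∃ a : G.graph.Adj p.1 p.2,
      (G.edgeMark p.1 p.2 a = x ∧ G.edgeMark p.2 p.1 a.symm = x') ∨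
        (G.edgeMark p.2 p.1 a.symm = x ∧ G.edgeMark p.1 p.2 a = x')) ↔
      (min (G.edgeMark p.1 p.2 a) (G.edgeMark p.2 p.1 a.symm) = x ∧
        max (G.edgeMark p.1 p.2 a) (G.edgeMark p.2 p.1 a.symm) = x') := by
    intro x x'
    simp only [a, exists_true_left]
    constructor
    · rintro ⟨hx, ⟨rfl, rfl⟩ | ⟨rfl, rfl⟩⟩
      · exact ⟨min_eq_left hx, max_eq_right hx⟩
      · exact ⟨min_eq_right hx, max_eq_left hx⟩
    · rintro ⟨rfl, rfl⟩
      refine ⟨min_le_max, ?_⟩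
      rcases le_total (G.edgeMark p.1 p.2 a) (G.edgeMark p.2 p.1 a.symm) with hx | hx
      · exact Or.inl ⟨(min_eq_left hx).symm, (max_eq_right hx).symm⟩
      · exact Or.inr ⟨(min_eq_right hx).symm, (max_eq_left hx).symm⟩
  simp_rw [h3]
  simp [ite_and]

/-! ### Encoding marked graphs by labelled graphs -/

namespace MarkedGraph

variable {Ξ : Type u} {Θ : Type v} {h : ℕ}

/-- The pair `(t, t')` underlying an edge type. -/
def edgeTypePair (c : EdgeTypes Ξ Θ h) : (Ξ × GStar Ξ Θ) × (Ξ × GStar Ξ Θ) :=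
  ((c.1.1, c.1.2), (c.2.1, c.2.2))

theorem edgeTypePair_injective : Function.Injective (edgeTypePair (Ξ := Ξ) (Θ := Θ) (h := h)) := by
  rintro ⟨⟨x, t⟩, x', t'⟩ ⟨⟨y, s⟩, y', s'⟩ hc
  simp only [edgeTypePair, Prod.mk.injEq] at hc
  obtain ⟨⟨rfl, h1⟩, rfl, h2⟩ := hc
  rw [Subtype.ext h1, Subtype.ext h2]

open Classical in
/-- The label of the edge `vw` at `v`: its type if this lies in `A`, otherwise its pair of marks. -/
noncomputable def edgeLabel {V : Type} [Countable V] (G : MarkedGraph V Ξ Θ)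
    (A : Finset (EdgeTypes Ξ Θ h)) (v w : V) (a : G.graph.Adj v w) : A ⊕ (Ξ × Ξ) :=
  if hc : ∃ c : A, edgeTypePair c.1 = (G.branch (h - 1) w v a.symm, G.branch (h - 1) v w a) then
    Sum.inl hc.choose
  else Sum.inr (G.edgeMark w v a.symm, G.edgeMark v w a)

/-- Exchanging the two ends of an edge label. -/
def swapLabel (A : Finset (EdgeTypes Ξ Θ h)) (hA : ∀ c ∈ A, c.swap ∈ A) :
    A ⊕ (Ξ × Ξ) → A ⊕ (Ξ × Ξ) :=
  Sum.map (fun c => ⟨c.1.swap, hA _ c.2⟩) Prod.swap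

theorem swapLabel_swapLabel (A : Finset (EdgeTypes Ξ Θ h)) (hA : ∀ c ∈ A, c.swap ∈ A)
    (c : A ⊕ (Ξ × Ξ)) : swapLabel A hA (swapLabel A hA c) = c := by
  rcases c with c | c <;> rfl

variable {V : Type} [Countable V] (G : MarkedGraph V Ξ Θ) (A : Finset (EdgeTypes Ξ Θ h))

theorem edgeLabel_eq_inl_iff {v w : V} (a : G.graph.Adj v w) (c : A) :
    G.edgeLabel A v w a = Sum.inl c ↔
      edgeTypePair c.1 = (G.branch (h - 1) w v a.symm, G.branch (h - 1) v w a) := by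
  unfold edgeLabel
  split_ifs with hc
  · rw [Sum.inl.injEq]
    constructor
    · rintro rfl
      exact hc.choose_spec
    · intro hc'
      exact Subtype.ext (edgeTypePair_injective (hc.choose_spec.trans hc'.symm))
  · exact ⟨fun hc' => by simp at hc', fun hc' => absurd ⟨c, hc'⟩ hc⟩

theorem edgeLabel_swap (hA : ∀ c ∈ A, c.swap ∈ A) (v w : V) (a : G.graph.Adj v w) :
    G.edgeLabel A w v (G.graph.adj_symm a) = swapLabel A hA (G.edgeLabel A v w a) := by
  have hsw : ∀ (v w : V) (a : G.graph.Adj v w) (c : A), G.edgeLabel A v w a = Sum.inl c →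
      G.edgeLabel A w v (G.graph.adj_symm a) = Sum.inl ⟨c.1.swap, hA _ c.2⟩ := by
    intro v w a c hc
    rw [edgeLabel_eq_inl_iff] at hc ⊢
    exact congrArg Prod.swap hc
  by_cases hc : ∃ c, G.edgeLabel A v w a = Sum.inl c
  · obtain ⟨c, hc⟩ := hc
    rw [hc, hsw v w a c hc]
    rfl
  · have hc' : ¬ ∃ c, G.edgeLabel A w v (G.graph.adj_symm a) = Sum.inl c := by
      rintro ⟨c, hc'⟩
      exact hc ⟨_, hsw w v _ c hc'⟩
    have h1 : ∀ (v w : V) (a : G.graph.Adj v w), (¬ ∃ c, G.edgeLabel A v w a = Sum.inl c) →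
        G.edgeLabel A v w a = Sum.inr (G.edgeMark w v a.symm, G.edgeMark v w a) := by
      intro v w a hc
      simp_rw [edgeLabel_eq_inl_iff] at hc
      exact dif_neg hc
    rw [h1 v w a hc, h1 w v _ hc']
    rfl

/-- The two marks of an edge can be read off its label. -/
theorem marks_edgeLabel {v w : V} (a : G.graph.Adj v w) :
    Sum.elim (fun c : A => (c.1.1.1, c.1.2.1)) id (G.edgeLabel A v w a) =
      (G.edgeMark w v a.symm, G.edgeMark v w a) := by
  rcases hc : G.edgeLabel A v w a with c | q
  · have h1 := (G.edgeLabel_eq_inl_iff A a c).1 hc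
    exact congrArg (fun p : (Ξ × GStar Ξ Θ) × (Ξ × GStar Ξ Θ) => (p.1.1, p.2.1)) h1
  · unfold edgeLabel at hc
    split_ifs at hc
    exact (Sum.inr.inj hc).symm

theorem ncard_edgeLabel_eq_inl (v : V) (c : A) :
    {w | ∃ a, G.edgeLabel A v w a = Sum.inl c}.ncard = edgeTypeCount h c.1 (G.cls v) := by
  change _ = {w : V | ∃ a : G.graph.Adj v w, _}.ncard
  congr 1
  ext w
  refine exists_congr fun a => ?_
  rw [edgeLabel_eq_inl_iff, edgeTypePair, Prod.mk.injEq]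
  exact and_congr eq_comm eq_comm

open Classical in
/-- The colour of a vertex: the class of its `h`-neighborhood if this lies in `F`, otherwise its
mark. -/
noncomputable def vertexColour (h : ℕ) (F : Finset (GStar Ξ Θ)) (v : V) : F ⊕ Θ :=
  if hv : (G.cls v).trunc h ∈ F then Sum.inl ⟨_, hv⟩ else Sum.inr (G.vertexMark v)

theorem vertexColour_eq_inl_iff (F : Finset (GStar Ξ Θ)) (v : V) (t : F) :
    G.vertexColour h F v = Sum.inl t ↔ (G.cls v).trunc h = t := by
  unfold vertexColour
  split_ifs with hv
  · rw [Sum.inl.injEq]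
    exact Subtype.ext_iff
  · exact ⟨fun ht => by simp at ht, fun ht => absurd (ht ▸ t.2) hv⟩

theorem mark_vertexColour (F : Finset (GStar Ξ Θ)) (v : V) :
    Sum.elim (fun t : F => t.1.rootMark) id (G.vertexColour h F v) = G.vertexMark v := by
  unfold vertexColour
  split_ifs with hv
  · exact GStar.rootMark_trunc h (G.cls v)
  · rfl

/-- A marked graph is determined by the colours of its vertices and its labelled edges. -/
theorem code_injective [Fintype Ξ] [Fintype V] [LinearOrder V] (F : Finset (GStar Ξ Θ))
    (hA : ∀ c ∈ A, c.swap ∈ A) {G G' : MarkedGraph V Ξ Θ}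
    (h1 : G.vertexColour h F = G'.vertexColour h F)
    (h2 : edgeList G.graph (G.edgeLabel A) = edgeList G'.graph (G'.edgeLabel A)) : G = G' := by
  have key : ∀ {G G' : MarkedGraph V Ξ Θ},
      edgeList G.graph (G.edgeLabel A) = edgeList G'.graph (G'.edgeLabel A) →
      ∀ v w (a : G.graph.Adj v w), ∃ a', G'.edgeLabel A v w a' = G.edgeLabel A v w a := by
    intro G G' h2 v w a
    have hlt : ∀ v w (a : G.graph.Adj v w), v < w →
        ∃ a', G'.edgeLabel A v w a' = G.edgeLabel A v w a := by
      intro v w a hlt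
      have hm : (v, w, G.edgeLabel A v w a) ∈ edgeList G.graph (G.edgeLabel A) :=
        mem_edgeList.2 ⟨hlt, a, rfl⟩
      rw [h2] at hm
      exact (mem_edgeList.1 hm).2
    -- The list contains one orientation only; the label of the other follows by exchanging the
    -- ends.
    rcases lt_or_gt_of_ne a.ne with h3 | h3
    · exact hlt v w a h3
    · obtain ⟨a', ha'⟩ := hlt w v a.symm h3
      refine ⟨a'.symm, ?_⟩
      rw [G'.edgeLabel_swap A hA w v a', ha', ← G.edgeLabel_swap A hA w v a.symm]
  refine ext_of_forall (fun v w => ⟨fun a => (key h2 v w a).1, fun a => (key h2.symm v w a).1⟩)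
    (fun v w a a' => ?_) fun v => ?_
  · obtain ⟨_, h3⟩ := key h2 v w a
    have h4 := G.marks_edgeLabel A a
    rw [← h3, G'.marks_edgeLabel A] at h4
    exact (congrArg Prod.snd h4).symm
  · rw [← G.mark_vertexColour (h := h) F v, h1, G'.mark_vertexColour]

end MarkedGraph

open Nat in
/-- The counting bound for marked graphs. For `G` in the family, `N t` is the number of vertices
whose `h`-neighborhood has class `t ∈ F` and `S c` is the number of directed edges with label `c`. -/
theorem ncard_markedGraphs_le {Ξ : Type u} {Θ : Type v} [Fintype Ξ] [LinearOrder Ξ] [Fintype Θ]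
    {h : ℕ} (hh : 1 ≤ h) {n M : ℕ} (A : Finset (EdgeTypes Ξ Θ h)) (hA : ∀ c ∈ A, c.swap ∈ A)
    (F : Finset (GStar Ξ Θ)) (Fam : Set (MarkedGraph (Fin n) Ξ Θ))
    (hM : ∀ G ∈ Fam, edgeNorm G.edgeMarkCount = M)
    (a : A ⊕ (Ξ × Ξ) → ℝ) (ha : ∑ c, Real.exp (-a c) ≤ 1)
    (b : F → ℝ) (b' : ℝ)
    (hb : ∑ t, Real.exp (-b t) + Fintype.card Θ * Real.exp (-b') ≤ 1)
    {lam : ℝ} (hlam : 0 < lam) (X : ℝ)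
    (hX : ∀ G ∈ Fam, ∀ N : F → ℕ, ∀ S : A ⊕ (Ξ × Ξ) → ℕ,
      (∀ t, N t = {v | (G.cls v).trunc h = t}.ncard) →
      ∑ t, N t ≤ n →
      ∑ c, S c = 2 * M →
      (∀ c, ∑ t, N t * edgeTypeCount h c.1 t.1 ≤ S (Sum.inl c)) →
      (∀ c, S (Sum.inl c) + ∑ t, N t * t.1.deg ≤
        ∑ t, N t * edgeTypeCount h c.1 t.1 + 2 * M) →
      ∑ t, N t * (b t - ∑ c : A, Real.log (edgeTypeCount h c.1 t.1)!)
        + (n - ∑ t, (N t : ℝ)) * (b' + A.card)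
        + ∑ c, (S c * a c / 2 + Real.log (S c)!)
        + ∑ q : Ξ × Ξ, (lam * n - S (Sum.inr q) * Real.log lam) ≤ X) :
    (Fam.ncard : ℝ) * (M ! * 2 ^ M) ≤
      (2 * M + 1) ^ (A.card + Fintype.card (Ξ × Ξ)) * Real.exp X := by
  let _ : DecidableEq (EdgeTypes Ξ Θ h) := Classical.decEq _
  let _ : DecidableEq (GStar Ξ Θ) := Classical.decEq _
  let _ : DecidableEq Θ := Classical.decEq _
  let code : MarkedGraph (Fin n) Ξ Θ → (Fin n → F ⊕ Θ) × Finset (Fin n × Fin n × (A ⊕ (Ξ × Ξ))) :=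
    fun G => (G.vertexColour h F, edgeList G.graph (G.edgeLabel A))
  have hcode : Function.Injective code := fun G G' hGG =>
    MarkedGraph.code_injective A F hA (congrArg Prod.fst hGG) (congrArg Prod.snd hGG)
  set bar := MarkedGraph.swapLabel A hA with hbar_def
  have hbar : ∀ c, bar (bar c) = c := MarkedGraph.swapLabel_swapLabel A hA
  have hdeg : ∀ (G : MarkedGraph (Fin n) Ξ Θ) v c,
      labelDegree bar (edgeList G.graph (G.edgeLabel A)) v c =
        {w | ∃ a, G.edgeLabel A v w a = c}.ncard := fun G =>
    labelDegree_edgeList hbar (fun v w a => G.edgeLabel_swap A hA v w a)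
  have hdeg_inl : ∀ (G : MarkedGraph (Fin n) Ξ Θ) v c,
      labelDegree bar (edgeList G.graph (G.edgeLabel A)) v (Sum.inl c) =
        edgeTypeCount h c.1 ((G.cls v).trunc h) := by
    intro G v c
    rw [hdeg, G.ncard_edgeLabel_eq_inl A v c]
    exact (GStar.typeCount_trunc hh _ _ _).symm
  have hdeg_sum : ∀ (G : MarkedGraph (Fin n) Ξ Θ) v,
      ∑ c, labelDegree bar (edgeList G.graph (G.edgeLabel A)) v c = ((G.cls v).trunc h).deg := by
    intro G v
    rw [GStar.deg_trunc hh]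
    simp_rw [hdeg]
    exact sum_ncard_label v
  have hcard : ∀ G ∈ Fam, (edgeList G.graph (G.edgeLabel A)).card = M := fun G hG => by
    rw [card_edgeList, ← G.edgeNorm_edgeMarkCount, hM G hG]
  have hFfin : Fam.Finite := Set.toFinite _
  set K := hFfin.toFinset.map ⟨code, hcode⟩ with hK
  have hKcard : K.card = Fam.ncard := by
    rw [Finset.card_map, Set.ncard_eq_toFinset_card _ hFfin]
  have hmem : ∀ k ∈ K, ∃ G ∈ Fam, code G = k := by
    intro k hk
    obtain ⟨G, hG, rfl⟩ := Finset.mem_map.1 hk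
    exact ⟨G, hFfin.mem_toFinset.1 hG, rfl⟩
  have main := card_colouredLabelledGraphs_le (V := Fin n) hbar (M := M) K
    (by
      intro k hk
      obtain ⟨G, hG, rfl⟩ := hmem k hk
      exact hcard G hG)
    (by
      intro k hk q hq
      obtain ⟨G, hG, rfl⟩ := hmem k hk
      exact (mem_edgeList.1 hq).1)
    (fun t c => edgeTypeCount h c.1 t.1)
    (by
      intro k hk v t ht c
      obtain ⟨G, hG, rfl⟩ := hmem k hk
      exact (hdeg_inl G v c).trans (by rw [(G.vertexColour_eq_inl_iff F v t).1 ht]))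
    a ha (Sum.elim b fun _ => b') (by simpa [Fintype.sum_sum_type] using hb) hlam X
    (by
      intro k hk S hS
      obtain ⟨G, hG, rfl⟩ := hmem k hk
      set N : F → ℕ := fun t => {v | (G.cls v).trunc h = t}.ncard with hN
      have hN' : ∀ t, N t = (Finset.univ.filter fun v => G.vertexColour h F v = Sum.inl t).card := by
        intro t
        rw [← Set.ncard_coe_finset]
        refine congrArg Set.ncard ?_
        ext v
        simp [G.vertexColour_eq_inl_iff F v t]
      have hsplit : ∀ f : F ⊕ Θ → ℝ, ∑ v, f (G.vertexColour h F v) =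
          ∑ t, N t * f (Sum.inl t) + ∑ θ, ((Finset.univ.filter fun v =>
            G.vertexColour h F v = Sum.inr θ).card : ℝ) * f (Sum.inr θ) := by
        intro f
        have : ∀ x : F ⊕ Θ, ∑ v with G.vertexColour h F v = x, f (G.vertexColour h F v) =
            ((Finset.univ.filter fun v => G.vertexColour h F v = x).card : ℝ) * f x := by
          intro x
          rw [← nsmul_eq_mul, ← Finset.sum_const]
          exact Finset.sum_congr rfl fun v hv => by rw [(Finset.mem_filter.1 hv).2]
        rw [← Finset.sum_fiberwise Finset.univ (G.vertexColour h F), Finset.sum_congr rfl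
          fun x _ => this x, Fintype.sum_sum_type]
        simp_rw [hN']
      have hsplitN : ∀ f : F → ℕ, ∑ t, N t * f t =
          ∑ v, Sum.elim f (fun _ => 0) (G.vertexColour h F v) := by
        intro f
        have := hsplit fun x => ((Sum.elim f (fun _ => 0) x : ℕ) : ℝ)
        simp only [Sum.elim_inl, Sum.elim_inr, Nat.cast_zero, mul_zero, Finset.sum_const_zero,
          add_zero] at this
        exact_mod_cast this.symm
      have hle : ∀ f : GStar Ξ Θ → ℕ, ∀ v, Sum.elim (fun t : F => f t.1) (fun _ => 0)
          (G.vertexColour h F v) ≤ f ((G.cls v).trunc h) := by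
        intro f v
        rcases hv : G.vertexColour h F v with t | θ
        · rw [(G.vertexColour_eq_inl_iff F v t).1 hv, Sum.elim_inl]
        · exact Nat.zero_le _
      have hbad : ∑ θ, ((Finset.univ.filter fun v =>
            G.vertexColour h F v = Sum.inr θ).card : ℝ) = n - ∑ t, (N t : ℝ) := by
        have := hsplit fun _ => 1
        simp only [Finset.sum_const, Finset.card_univ, Fintype.card_fin, nsmul_eq_mul, mul_one]
          at this
        linarith
      have hSsum : ∑ c, S c = 2 * M := by
        rw [← hcard G hG, ← sum_sum_labelDegree bar]
        exact Finset.sum_congr rfl fun c _ => hS c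
      have hSl : ∀ c, S (Sum.inl c) = ∑ v, edgeTypeCount h c.1 ((G.cls v).trunc h) := fun c =>
        (hS _).trans (Finset.sum_congr rfl fun v _ => hdeg_inl G v c)
      have hdle : ∀ (c : A) (v : Fin n), edgeTypeCount h c.1 ((G.cls v).trunc h) ≤ ((G.cls v).trunc h).deg := by
        intro c v
        rw [← hdeg_inl G v c, ← hdeg_sum G v]
        exact Finset.single_le_sum (f := fun c => labelDegree bar (edgeList G.graph (G.edgeLabel A)) v c)
          (fun _ _ => Nat.zero_le _) (Finset.mem_univ _)
      have hXG := hX G hG N S (fun _ => rfl) (by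
          have h1 := hsplitN fun _ => 1
          simp only [mul_one] at h1
          rw [h1]
          calc _ ≤ ∑ v : Fin n, 1 := Finset.sum_le_sum fun v _ => hle (fun _ => 1) v
            _ = n := by simp) hSsum
        (by
          intro c
          rw [hSl, hsplitN]
          exact Finset.sum_le_sum fun v _ => hle (fun t => edgeTypeCount h c.1 t) v)
        (by
          intro c
          -- The total degree is 2M. At a vertex whose colour is not in F the degree in label c is
          -- unknown, but it is at most the degree, so the excess of S(c) is at most the degree sum
          -- over such vertices.
          have h2M : 2 * M = ∑ v, ((G.cls v).trunc h).deg := by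
            rw [← hcard G hG, ← sum_sum_labelDegree bar, Finset.sum_comm]
            exact Finset.sum_congr rfl fun v _ => hdeg_sum G v
          rw [hSl, hsplitN, hsplitN, h2M, ← Finset.sum_add_distrib, ← Finset.sum_add_distrib]
          refine Finset.sum_le_sum fun v _ => ?_
          rcases hv : G.vertexColour h F v with t | θ
          · rw [(G.vertexColour_eq_inl_iff F v t).1 hv, Sum.elim_inl, Sum.elim_inl]
          · simpa using hdle c v)
      refine le_trans (le_of_eq ?_) hXG
      simp only [Fintype.card_fin]
      congr 2
      rw [hsplit]
      simp only [Sum.elim_inl, Sum.elim_inr, ← Finset.sum_mul, hbad, Fintype.card_coe])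
  rw [hKcard, Fintype.card_coe] at main
  exact main

/-! ### Asymptotics of the counting bound -/

section Asymptotics

open Nat

/-- Induction from (k+1)(log(k+1) - log k) ≥ 1. Errors of order log k are harmless, as the number of
factorials does not grow with n; at k = 0 the convention log 0 = 0 applies. -/
theorem log_factorial_le_mul_log (k : ℕ) :
    Real.log k ! ≤ k * Real.log k - k + 1 + Real.log k := by
  induction k with
  | zero => simp
  | succ k ih =>
    rcases Nat.eq_zero_or_pos k with rfl | hk
    · simp
    have hk' : (0 : ℝ) < k := by exact_mod_cast hk
    have h1 : Real.log (k + 1)! = Real.log (k + 1) + Real.log k ! := by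
      rw [Nat.factorial_succ, Nat.cast_mul, Real.log_mul (by positivity) (by positivity)]
      push_cast
      rfl
    have h2 : 1 ≤ (k + 1) * (Real.log (k + 1) - Real.log k) := by
      rw [← Real.log_div (by positivity) hk'.ne']
      have := Real.one_sub_inv_le_log_of_pos (x := ((k : ℝ) + 1) / k) (by positivity)
      have h3 : 1 - (((k : ℝ) + 1) / k)⁻¹ = 1 / (k + 1) := by field_simp; ring
      rw [h3, div_le_iff₀ (by positivity)] at this
      linarith
    rw [h1]
    push_cast
    nlinarith

theorem mul_log_sub_le_log_factorial (k : ℕ) : k * Real.log k - k ≤ Real.log k ! := by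
  rcases Nat.eq_zero_or_pos k with rfl | hk
  · simp
  have hk' : (0 : ℝ) < k := by exact_mod_cast hk
  have h1 := Real.pow_div_factorial_le_exp (k : ℝ) hk'.le k
  have h2 := Real.log_le_log (by positivity) h1
  rw [Real.log_exp, Real.log_div (by positivity) (by positivity), Real.log_pow] at h2
  linarith

/-- Separates the density from the order n log n; for S = 0 both sides vanish by the convention log
0 = 0. -/
theorem nat_mul_log_eq (S n : ℕ) (hn : 1 ≤ n) :
    (S : ℝ) * Real.log S = n * ((S / n : ℝ) * Real.log (S / n : ℝ)) + S * Real.log n := by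
  have hn' : (0 : ℝ) < n := by exact_mod_cast hn
  rcases Nat.eq_zero_or_pos S with rfl | hS
  · simp
  have hS' : (0 : ℝ) < S := by exact_mod_cast hS
  rw [Real.log_div hS'.ne' hn'.ne']
  field_simp
  ring

/-- The label factorials carry 2M log n, which cancels against M log n from log M! and the
normalising M log n. What remains is n times a function of the densities, up to a logarithmic error.
-/
theorem sum_log_factorial_le {C : Type*} [Fintype C] (S : C → ℕ) (M n : ℕ) (hn : 1 ≤ n)
    (hS : ∑ c, S c = 2 * M) :
    ∑ c, Real.log (S c)! - Real.log M ! - M * Real.log 2 - M * Real.log n ≤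
      n * (∑ c, (S c / n : ℝ) * Real.log (S c / n : ℝ) - (M / n : ℝ)
        - (M / n : ℝ) * Real.log (2 * (M / n : ℝ)))
        + Fintype.card C * (1 + Real.log (2 * M + 1)) := by
  have hn' : (0 : ℝ) < n := by exact_mod_cast hn
  have hS' : ∑ c, (S c : ℝ) = 2 * M := by exact_mod_cast hS
  have h1 : ∀ c, Real.log (S c)! ≤ n * ((S c / n : ℝ) * Real.log (S c / n : ℝ))
      + S c * (Real.log n - 1) + (1 + Real.log (2 * M + 1)) := by
    intro c
    have h2 := log_factorial_le_mul_log (S c)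
    have h3 := nat_mul_log_eq (S c) n hn
    have h4 : Real.log (S c) ≤ Real.log (2 * M + 1) := by
      rcases Nat.eq_zero_or_pos (S c) with h0 | h0
      · rw [h0]
        simpa using Real.log_nonneg (by linarith [(Nat.cast_nonneg M : (0 : ℝ) ≤ M)])
      · refine Real.log_le_log (by exact_mod_cast h0) ?_
        have h5 : S c ≤ 2 * M := by
          rw [← hS]
          exact Finset.single_le_sum (fun _ _ => Nat.zero_le _) (Finset.mem_univ c)
        have h6 : (S c : ℝ) ≤ 2 * M := by exact_mod_cast h5
        linarith
    linarith
  have h2 := Finset.sum_le_sum fun c (_ : c ∈ Finset.univ) => h1 c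
  simp only [Finset.sum_add_distrib, ← Finset.mul_sum, ← Finset.sum_mul, hS', Finset.sum_const,
    Finset.card_univ, nsmul_eq_mul] at h2
  have h3 := mul_log_sub_le_log_factorial M
  have h4 : (n : ℝ) * ((M / n : ℝ) + (M / n : ℝ) * Real.log (2 * (M / n : ℝ))) =
      M + M * (Real.log 2 + Real.log M - Real.log n) := by
    rcases Nat.eq_zero_or_pos M with rfl | hM
    · simp
    have hM' : (0 : ℝ) < M := by exact_mod_cast hM
    rw [Real.log_mul two_ne_zero (by positivity), Real.log_div hM'.ne' hn'.ne']
    field_simp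
    ring
  linarith

theorem eventually_add_mul_log_le (c₁ c₂ : ℝ) {τ : ℝ} (hτ : 0 < τ) :
    ∀ᶠ n : ℕ in atTop, c₁ + c₂ * Real.log n ≤ τ * n := by
  have h1 : (fun x : ℝ => c₁ + c₂ * Real.log x) =o[atTop] (fun x : ℝ => x) :=
    (Asymptotics.isLittleO_const_id_atTop c₁).add (Real.isLittleO_log_id_atTop.const_mul_left c₂)
  have h2 := (h1.comp_tendsto tendsto_natCast_atTop_atTop).bound hτ
  filter_upwards [h2] with n hn
  have := (le_abs_self _).trans hn
  simpa using this

/-- The uniform upper bound for the exponents of the counting bound. -/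
theorem exists_eventually_exponent_le {A Q F : Type*} [Fintype A] [Fintype Q] [Fintype F]
    (E : F → A → ℕ) (D : F → ℕ) (p : F → ℝ) (e : A → ℝ) {d : ℝ} (hd : 0 < d)
    (a : A ⊕ Q → ℝ) (b : F → ℝ) {b' a' lam ω η z L : ℝ} (y : A → ℝ)
    (hω : 0 < ω)
    (hy : ∀ c, ∀ σ : ℝ, |σ - e c| ≤ ω → σ * a (Sum.inl c) / 2 + σ * Real.log σ ≤ y c)
    (hz : ∀ m : ℝ, |m - d / 2| ≤ ω → -m - m * Real.log (2 * m) ≤ z)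
    (ha : ∀ q, a (Sum.inr q) ≤ a') (ha' : 0 ≤ a') (hlam1 : Real.log lam ≤ 0)
    (hη : d - ∑ c, e c + (Fintype.card A + 2) * ω ≤ η) (hη1 : η ≤ 1)
    (hE : ∀ c, e c - ω / 2 ≤ ∑ t, p t * E t c) (hE' : ∀ c, ∑ t, p t * E t c ≤ e c)
    (hD : d - ω / 2 ≤ ∑ t, p t * D t) (hb' : 0 ≤ b')
    (hL : ∑ t, p t * (b t - ∑ c, Real.log (E t c)!) + (1 - ∑ t, p t) * (b' + Fintype.card A)
      + ∑ c, y c + z + Fintype.card Q * lam + η * (a' / 2 - Real.log lam) < L) :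
    ∃ κ > 0, ∀ᶠ n : ℕ in atTop, ∀ (M : ℕ) (N : F → ℕ) (S : A ⊕ Q → ℕ),
      |(M : ℝ) / n - d / 2| ≤ κ → (∀ t, |(N t : ℝ) / n - p t| ≤ κ) →
      ∑ c, S c = 2 * M →
      (∀ c, ∑ t, N t * E t c ≤ S (Sum.inl c)) →
      (∀ c, S (Sum.inl c) + ∑ t, N t * D t ≤ ∑ t, N t * E t c + 2 * M) →
      ∑ t, N t * (b t - ∑ c : A, Real.log (E t c)!)
        + (n - ∑ t, (N t : ℝ)) * (b' + Fintype.card A)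
        + ∑ c, (S c * a c / 2 + Real.log (S c)!)
        + ∑ q : Q, (lam * n - S (Sum.inr q) * Real.log lam) ≤
      n * L + M * Real.log n + Real.log M ! + M * Real.log 2
        - Fintype.card (A ⊕ Q) * Real.log (2 * M + 1) := by
  set β : F → ℝ := fun t => b t - ∑ c, Real.log (E t c)! with hβ
  set L₀ := ∑ t, p t * β t + (1 - ∑ t, p t) * (b' + Fintype.card A)
      + ∑ c, y c + z + Fintype.card Q * lam + η * (a' / 2 - Real.log lam) with hL₀
  -- Half of the gap pays for the deviation of the frequencies, the other half for the logarithmic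
  -- errors.
  set τ := (L - L₀) / 2 with hτdef
  have hτ : 0 < τ := half_pos (sub_pos.2 hL)
  -- Bounds the total drift, per unit of κ, of ∑ ν E, ∑ ν D and 2m, the three quantities that
  -- enclose σ(c).
  set B₁ : ℝ := ∑ t, ∑ c, (E t c : ℝ) + ∑ t, (D t : ℝ) + 2 with hB₁
  have hB₁pos : 0 < B₁ := by positivity
  set B₂ : ℝ := ∑ t, |β t| + Fintype.card F * (b' + Fintype.card A) + 1 with hB₂
  have hB₂pos : 0 < B₂ := by positivity
  set κ : ℝ := min (ω / 2 / B₁) (min (τ / B₂) (min ω 1)) with hκdef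
  have hκ : 0 < κ := by positivity
  have hκ1 : κ * B₁ ≤ ω / 2 := by
    rw [← le_div_iff₀ hB₁pos]; exact min_le_left _ _
  have hκ2 : κ * B₂ ≤ τ := by
    rw [← le_div_iff₀ hB₂pos]; exact (min_le_right _ _).trans (min_le_left _ _)
  have hκω : κ ≤ ω :=
    (min_le_right _ _).trans ((min_le_right _ _).trans (min_le_left _ _))
  have hκone : κ ≤ 1 :=
    (min_le_right _ _).trans ((min_le_right _ _).trans (min_le_right _ _))
  refine ⟨κ, hκ, ?_⟩
  set k : ℝ := ((Fintype.card (A ⊕ Q) : ℕ) : ℝ) with hk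
  filter_upwards [eventually_ge_atTop 1,
    -- The factor 2: log(2M+1) enters once through the factorials and once through the number of
    -- label profiles; 2M+1 ≤ (d+3)n, as m ≤ d/2 + 1 and n ≥ 1.
    eventually_add_mul_log_le (k * (1 + 2 * Real.log (d + 3))) (k * 2) hτ]
    with n hn herr M N S hM hN hS hSl hSu
  have hn' : (0 : ℝ) < n := by exact_mod_cast hn
  set ν : F → ℝ := fun t => N t / n with hν
  set σ : A ⊕ Q → ℝ := fun c => S c / n with hσ
  set m : ℝ := M / n with hm
  have hNν : ∀ t, (N t : ℝ) = n * ν t := fun t => by rw [hν]; field_simp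
  have hSσ : ∀ c, (S c : ℝ) = n * σ c := fun c => by rw [hσ]; field_simp
  have hMm : (M : ℝ) = n * m := by rw [hm]; field_simp
  have hσ0 : ∀ c, 0 ≤ σ c := fun c => by positivity
  have hm_le : m ≤ d / 2 + κ := by linarith [(abs_le.1 hM).2]
  have hsumσ : ∑ c, σ c = 2 * m := by
    have h1 : ∑ c, (S c : ℝ) = 2 * M := by exact_mod_cast hS
    rw [hσ, ← Finset.sum_div, h1, hm]; ring
  have hσl : ∀ c, ∑ t, ν t * E t c ≤ σ (Sum.inl c) := by
    intro c
    have h1 : ∑ t, (N t : ℝ) * E t c ≤ S (Sum.inl c) := by exact_mod_cast hSl c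
    simp only [hNν, hSσ, mul_assoc, ← Finset.mul_sum] at h1
    exact le_of_mul_le_mul_left h1 hn'
  have hσu : ∀ c, σ (Sum.inl c) + ∑ t, ν t * D t ≤ ∑ t, ν t * E t c + 2 * m := by
    intro c
    have h1 : (S (Sum.inl c) : ℝ) + ∑ t, (N t : ℝ) * D t ≤ ∑ t, (N t : ℝ) * E t c + 2 * M := by
      exact_mod_cast hSu c
    simp only [hNν, hSσ, hMm, mul_assoc, ← Finset.mul_sum] at h1
    refine le_of_mul_le_mul_left ?_ hn'
    linarith
  have hclose : ∀ f : F → ℕ, |∑ t, ν t * f t - ∑ t, p t * f t| ≤ κ * ∑ t, (f t : ℝ) := by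
    intro f
    rw [← Finset.sum_sub_distrib, Finset.mul_sum]
    refine (Finset.abs_sum_le_sum_abs _ _).trans (Finset.sum_le_sum fun t _ => ?_)
    rw [← sub_mul, abs_mul, Nat.abs_cast]
    exact mul_le_mul_of_nonneg_right (hN t) (Nat.cast_nonneg _)
  have hEsum : ∀ c, ∑ t, (E t c : ℝ) ≤ ∑ t, ∑ c, (E t c : ℝ) := fun c =>
    Finset.sum_le_sum fun t _ => Finset.single_le_sum (f := fun c => (E t c : ℝ))
      (fun _ _ => Nat.cast_nonneg _) (Finset.mem_univ c)
  have hD0 : 0 ≤ ∑ t, (D t : ℝ) := Finset.sum_nonneg fun _ _ => Nat.cast_nonneg _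
  have hEE0 : 0 ≤ ∑ t, ∑ c, (E t c : ℝ) :=
    Finset.sum_nonneg fun _ _ => Finset.sum_nonneg fun _ _ => Nat.cast_nonneg _
  -- The squeeze: σ(c) lies between ∑ ν E and ∑ ν E + (2m - ∑ ν D), and the last bracket is small
  -- because F carries almost all the mean degree. One ω/2 comes from the truncation to F, the other
  -- from κ · B₁.
  have hσe : ∀ c, |σ (Sum.inl c) - e c| ≤ ω := by
    intro c
    have h1 := abs_le.1 (hclose fun t => E t c)
    have h2 := abs_le.1 (hclose D)
    have h3 := mul_le_mul_of_nonneg_left (hEsum c) hκ.le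
    have h4 := hσl c
    have h5 := hσu c
    have h6 : κ * B₁ = κ * ∑ t, ∑ c, (E t c : ℝ) + κ * ∑ t, (D t : ℝ) + 2 * κ := by
      rw [hB₁]; ring
    have h7 := mul_nonneg hκ.le hD0
    have h8 := hE c
    have h9 := hE' c
    rw [abs_le]
    constructor <;> linarith
  -- The density outside A is 2m minus the densities in A: an error ω for each c in A and 2κ ≤ 2ω
  -- from m account for |A| + 2.
  have hσQ : ∑ q, σ (Sum.inr q) ≤ η := by
    rw [Fintype.sum_sum_type] at hsumσ
    have h1 : ∑ c : A, (e c - ω) ≤ ∑ c : A, σ (Sum.inl c) :=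
      Finset.sum_le_sum fun c _ => by linarith [(abs_le.1 (hσe c)).1]
    rw [Finset.sum_sub_distrib, Finset.sum_const, Finset.card_univ, nsmul_eq_mul] at h1
    linarith
  have hterm1 : ∑ t, ν t * β t + (1 - ∑ t, ν t) * (b' + Fintype.card A) ≤
      ∑ t, p t * β t + (1 - ∑ t, p t) * (b' + Fintype.card A) + τ := by
    have h1 : ∑ t, ν t * β t - ∑ t, p t * β t ≤ κ * ∑ t, |β t| := by
      rw [← Finset.sum_sub_distrib, Finset.mul_sum]
      refine Finset.sum_le_sum fun t _ => ?_
      rw [← sub_mul]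
      refine (le_abs_self _).trans ?_
      rw [abs_mul]
      exact mul_le_mul_of_nonneg_right (hN t) (abs_nonneg _)
    have h2 : ∑ t, p t - ∑ t, ν t ≤ κ * Fintype.card F := by
      rw [← Finset.sum_sub_distrib]
      refine (Finset.sum_le_sum fun t _ => show p t - ν t ≤ κ by
        linarith [(abs_le.1 (hN t)).1]).trans ?_
      rw [Finset.sum_const, Finset.card_univ, nsmul_eq_mul, mul_comm]
    have h3 := mul_le_mul_of_nonneg_right h2 (show 0 ≤ b' + (Fintype.card A : ℝ) by positivity)
    have h4 : κ * B₂ = κ * ∑ t, |β t| + κ * Fintype.card F * (b' + Fintype.card A) + κ := by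
      rw [hB₂]; ring
    linarith
  have hterm2 : ∑ c : A, (σ (Sum.inl c) * a (Sum.inl c) / 2
      + σ (Sum.inl c) * Real.log (σ (Sum.inl c))) ≤ ∑ c, y c :=
    Finset.sum_le_sum fun c _ => hy c _ (hσe c)
  have hterm3 : -m - m * Real.log (2 * m) ≤ z := hz m (hM.trans hκω)
  -- These densities are at most η ≤ 1, so σ log σ ≤ 0 can be dropped and the rest is linear in the
  -- total density.
  have hterm4 : ∑ q : Q, (σ (Sum.inr q) * a (Sum.inr q) / 2
      + σ (Sum.inr q) * Real.log (σ (Sum.inr q)) + (lam - σ (Sum.inr q) * Real.log lam)) ≤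
      Fintype.card Q * lam + η * (a' / 2 - Real.log lam) := by
    have h1 : ∀ q, σ (Sum.inr q) * a (Sum.inr q) / 2
      + σ (Sum.inr q) * Real.log (σ (Sum.inr q)) + (lam - σ (Sum.inr q) * Real.log lam) ≤
      lam + σ (Sum.inr q) * (a' / 2 - Real.log lam) := by
      intro q
      have h2 : σ (Sum.inr q) ≤ 1 := (Finset.single_le_sum (f := fun q => σ (Sum.inr q))
        (fun q _ => hσ0 _) (Finset.mem_univ q)).trans (hσQ.trans hη1)
      have h3 := Real.mul_log_nonpos (hσ0 (Sum.inr q)) h2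
      have h4 := mul_le_mul_of_nonneg_left (ha q) (hσ0 (Sum.inr q))
      linarith
    refine (Finset.sum_le_sum fun q _ => h1 q).trans ?_
    rw [Finset.sum_add_distrib, Finset.sum_const, Finset.card_univ, nsmul_eq_mul,
      ← Finset.sum_mul]
    have h5 := mul_le_mul_of_nonneg_right hσQ (show 0 ≤ a' / 2 - Real.log lam by linarith)
    linarith
  have hlog : Real.log (2 * M + 1) ≤ Real.log (d + 3) + Real.log n := by
    rw [← Real.log_mul (by positivity) hn'.ne']
    refine Real.log_le_log (by positivity) ?_
    have h1 : (1 : ℝ) ≤ n := by exact_mod_cast hn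
    have h2 : m * n ≤ (d / 2 + 1) * n := mul_le_mul_of_nonneg_right (by linarith) hn'.le
    rw [hMm]
    linarith
  have hk0 : 0 ≤ k := Nat.cast_nonneg _
  have hfact := sum_log_factorial_le S M n hn hS
  have hlogk := mul_le_mul_of_nonneg_left hlog hk0
  have hmain : ∑ t, ν t * β t + (1 - ∑ t, ν t) * (b' + Fintype.card A)
      + ∑ c, (σ c * a c / 2 + σ c * Real.log (σ c)) - m - m * Real.log (2 * m)
      + ∑ q : Q, (lam - σ (Sum.inr q) * Real.log lam) ≤ L₀ + τ := by
    rw [Fintype.sum_sum_type]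
    rw [Finset.sum_add_distrib] at hterm4
    linarith
  have hmain' := mul_le_mul_of_nonneg_left hmain hn'.le
  have e1 : ∑ t, (N t : ℝ) * β t = n * ∑ t, ν t * β t := by
    simp only [hNν, mul_assoc, ← Finset.mul_sum]
  have e2 : ∑ t, (N t : ℝ) = n * ∑ t, ν t := by simp only [hNν, ← Finset.mul_sum]
  have e3 : ∑ c, (S c * a c / 2 + Real.log (S c)!) =
      n * ∑ c, σ c * a c / 2 + ∑ c, Real.log (S c)! := by
    rw [Finset.sum_add_distrib, Finset.mul_sum]
    congr 1
    refine Finset.sum_congr rfl fun c _ => ?_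
    rw [hSσ]; ring
  have e4 : ∑ q : Q, (lam * n - S (Sum.inr q) * Real.log lam) =
      n * ∑ q : Q, (lam - σ (Sum.inr q) * Real.log lam) := by
    rw [Finset.mul_sum]
    refine Finset.sum_congr rfl fun q _ => ?_
    rw [hSσ]; ring
  rw [e1, e2, e3, e4]
  have e5 : (n : ℝ) * L = n * (L₀ + τ) + τ * n := by rw [hτdef]; ring
  rw [Finset.sum_add_distrib] at hmain'
  rw [e5]
  linarith

end Asymptotics

/-! ### The law of the `h`-neighborhood -/

section Law

variable {Ξ : Type u} {Θ : Type v}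

/-- The probability that the `h`-neighborhood of the root has class `t`. -/
noncomputable def ballProb (h : ℕ) (μ : Measure (GStar Ξ Θ)) (t : GStar Ξ Θ) : ℝ≥0∞ :=
  μ {g | g.trunc h = t}

theorem measurableSet_trunc_eq (h : ℕ) (t : GStar Ξ Θ) :
    MeasurableSet {g : GStar Ξ Θ | g.trunc h = t} := by
  have := GStar.measurable_of_trunc (Θ := Θ) (Ξ := Ξ) h (fun g => g.trunc h = t)
    fun g g' hg => by rw [hg]
  exact measurableSet_setOfPred.2 this

/-- Measurability of {t} is not used: one bound is the general inequality for image measures, the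
other replaces {t} by the measurable set of all classes with h-ball t. -/
theorem truncLaw_singleton (h : ℕ) (μ : Measure (GStar Ξ Θ)) {t : GStar Ξ Θ}
    (ht : t ∈ Set.range (GStar.trunc h)) : truncLaw h μ {t} = ballProb h μ t := by
  refine le_antisymm ?_ (Measure.le_map_apply (GStar.measurable_trunc h).aemeasurable {t})
  obtain ⟨g, rfl⟩ := ht
  refine (measure_mono (t := {g' | g'.trunc h = g.trunc h}) ?_).trans ?_
  · rintro _ rfl
    exact GStar.trunc_trunc le_rfl g
  · rw [truncLaw, Measure.map_apply (GStar.measurable_trunc h) (measurableSet_trunc_eq h _)]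
    refine measure_mono fun g' hg' => ?_
    exact (GStar.trunc_trunc le_rfl g').symm.trans hg'

theorem ballProb_eq_zero (h : ℕ) (μ : Measure (GStar Ξ Θ)) {t : GStar Ξ Θ}
    (ht : t ∉ Set.range (GStar.trunc h)) : ballProb h μ t = 0 := by
  have : {g : GStar Ξ Θ | g.trunc h = t} = ∅ :=
    Set.eq_empty_of_forall_notMem fun g hg => ht ⟨g, hg⟩
  rw [ballProb, this, measure_empty]

/-- The h-ball takes countably many values, so the integral is pushed to a countable discrete space;
this is why f may be arbitrary. -/
theorem lintegral_comp_trunc [Finite Ξ] [Finite Θ] (h : ℕ) (μ : Measure (GStar Ξ Θ))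
    (f : GStar Ξ Θ → ℝ≥0∞) : ∫⁻ g, f (g.trunc h) ∂μ = ∑' t, ballProb h μ t * f t := by
  set T := ↥(Set.range (GStar.trunc h : GStar Ξ Θ → GStar Ξ Θ))
  have : Countable T := (GStar.countable_range_trunc h).to_subtype
  let _ : MeasurableSpace T := ⊤
  let φ : GStar Ξ Θ → T := Set.rangeFactorization (GStar.trunc h)
  have hφ : Measurable φ := GStar.measurable_of_trunc h φ fun g g' hg => Subtype.ext hg
  have h1 : ∫⁻ g, f (g.trunc h) ∂μ = ∫⁻ t : T, f t ∂(μ.map φ) :=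
    (lintegral_map (f := fun t : T => f t) (fun _ _ => trivial) hφ).symm
  rw [h1, lintegral_countable']
  have h2 : ∀ t : T, μ.map φ {t} = ballProb h μ t := by
    intro t
    rw [Measure.map_apply hφ trivial, ballProb]
    congr 1
    ext g
    exact Subtype.ext_iff
  simp_rw [h2]
  rw [← tsum_subtype_eq_of_support_subset (s := Set.range (GStar.trunc h))]
  · exact tsum_congr fun t => mul_comm _ _
  · intro t ht
    by_contra h3
    exact ht (by simp [ballProb_eq_zero h μ h3])

theorem lintegral_truncLaw [Finite Ξ] [Finite Θ] (h : ℕ) (μ : Measure (GStar Ξ Θ))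
    (f : GStar Ξ Θ → ℝ≥0∞) (hf : ∀ g, f (g.trunc h) = f g) :
    ∫⁻ g, f g ∂(truncLaw h μ) = ∑' t, ballProb h μ t * f t := by
  rw [← lintegral_comp_trunc, truncLaw, lintegral_map _ (GStar.measurable_trunc h)]
  exact GStar.measurable_of_trunc h f fun g g' hg => by rw [← hf g, hg, hf]

theorem tsum_ballProb [Finite Ξ] [Finite Θ] (h : ℕ) (μ : Measure (GStar Ξ Θ))
    [IsProbabilityMeasure μ] : ∑' t, ballProb h μ t = 1 := by
  have := lintegral_comp_trunc h μ fun _ => 1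
  simpa using this.symm

theorem meanDegree_eq_tsum [Finite Ξ] [Finite Θ] {h : ℕ} (hh : 1 ≤ h) (μ : Measure (GStar Ξ Θ)) :
    meanDegree μ = ∑' t, ballProb h μ t * (t.deg : ℝ≥0∞) := by
  rw [← lintegral_comp_trunc, meanDegree]
  simp_rw [GStar.deg_trunc hh]

theorem meanDegree_truncLaw [Finite Ξ] [Finite Θ] {h : ℕ} (hh : 1 ≤ h) (μ : Measure (GStar Ξ Θ)) :
    meanDegree (truncLaw h μ) = meanDegree μ := by
  rw [meanDegree_eq_tsum hh μ, meanDegree, lintegral_truncLaw]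
  exact fun g => by rw [GStar.deg_trunc hh]

theorem edgeTypeCount_trunc {h : ℕ} (hh : 1 ≤ h) (c : EdgeTypes Ξ Θ h) (g : GStar Ξ Θ) :
    edgeTypeCount h c (g.trunc h) = edgeTypeCount h c g :=
  GStar.typeCount_trunc hh _ _ g

theorem meanTypeCount_truncLaw [Finite Ξ] [Finite Θ] {h : ℕ} (hh : 1 ≤ h)
    (μ : Measure (GStar Ξ Θ)) (c : EdgeTypes Ξ Θ h) :
    meanTypeCount h (truncLaw h μ) c = ∑' t, ballProb h μ t * (edgeTypeCount h c t : ℝ≥0∞) :=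
  lintegral_truncLaw h μ _ fun g => by rw [edgeTypeCount_trunc hh]

theorem lintegral_log_factorial_truncLaw [Finite Ξ] [Finite Θ] {h : ℕ} (hh : 1 ≤ h)
    (μ : Measure (GStar Ξ Θ)) (c : EdgeTypes Ξ Θ h) :
    ∫⁻ g, ENNReal.ofReal (Real.log ((edgeTypeCount h c g).factorial : ℝ)) ∂(truncLaw h μ) =
      ∑' t, ballProb h μ t * ENNReal.ofReal (Real.log ((edgeTypeCount h c t).factorial : ℝ)) :=
  lintegral_truncLaw h μ _ fun g => by rw [edgeTypeCount_trunc hh]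

/-- Tonelli reduces this to a single class of positive probability. Such a class is the h-ball of a
tree, all of whose root edges have a type, so π has total mass 1. -/
theorem tsum_meanTypeCount [Finite Ξ] [Finite Θ] {h : ℕ} (hh : 1 ≤ h) (μ : Measure (GStar Ξ Θ))
    (htree : ∀ᵐ g ∂μ, g ∈ GStar.trees Ξ Θ) :
    ∑' c, meanTypeCount h (truncLaw h μ) c = meanDegree μ := by
  simp_rw [meanTypeCount_truncLaw hh]
  rw [ENNReal.tsum_comm, meanDegree_eq_tsum hh]
  refine tsum_congr fun t => ?_
  rw [ENNReal.tsum_mul_left]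
  by_cases h0 : ballProb h μ t = 0
  · rw [h0, zero_mul, zero_mul]
  obtain ⟨g, rfl, hg⟩ : ∃ g : GStar Ξ Θ, g.trunc h = t ∧ g ∈ GStar.trees Ξ Θ := by
    by_contra hcon
    refine h0 (measure_mono_null (fun g hg => ?_) htree)
    exact fun hg' => hcon ⟨g, hg, hg'⟩
  simp_rw [edgeTypeCount_trunc hh]
  rw [GStar.tsum_edgeTypeCount hg, GStar.deg_trunc hh]

theorem sum_meanDegreeMark [Fintype Ξ] (μ : Measure (GStar Ξ Θ)) :
    ∑ x, ∑ x', meanDegreeMark μ x x' = meanDegree μ := by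
  have hm : ∀ x x' : Ξ, Measurable fun g : GStar Ξ Θ => (g.degMark x x' : ℝ≥0∞) := fun x x' =>
    GStar.measurable_of_trunc 1 _ fun g g' hg => by
      rw [← GStar.degMark_trunc le_rfl, hg, GStar.degMark_trunc le_rfl]
  unfold meanDegreeMark meanDegree
  simp_rw [← GStar.sum_degMark]
  push_cast
  rw [lintegral_finsetSum _ fun x _ => Finset.measurable_sum _ fun x' _ => hm x x']
  refine Finset.sum_congr rfl fun x _ => ?_
  rw [lintegral_finsetSum _ fun x' _ => hm x x']

/-- The edge density of an adapted sequence is half the mean degree. -/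
theorem IsAdapted.tendsto_edgeNorm [Fintype Ξ] [LinearOrder Ξ] [Fintype Θ] {d : Ξ → Ξ → ℝ}
    {Q : Θ → ℝ} {m : ℕ → Ξ → Ξ → ℕ} {u : ℕ → Θ → ℕ} (H : IsAdapted d Q m u) :
    Tendsto (fun n => (edgeNorm (m n) : ℝ) / n) atTop (𝓝 ((∑ x, ∑ x', d x x') / 2)) := by
  have hsymm : ∀ x x', d x x' = d x' x := by
    intro x x'
    rcases eq_or_ne x x' with rfl | hx
    · rfl
    refine tendsto_nhds_unique (H.tendsto_offdiag x x' hx)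
      ((H.tendsto_offdiag x' x hx.symm).congr' ?_)
    filter_upwards [eventually_ge_atTop 1] with n hn
    rw [H.symm n hn]
  set l : Ξ → Ξ → ℝ := fun x x' =>
    if x ≤ x' then (if x = x' then d x x' / 2 else d x x') else 0 with hl
  have hlim : Tendsto (fun n => (edgeNorm (m n) : ℝ) / n) atTop (𝓝 (∑ x, ∑ x', l x x')) := by
    simp only [edgeNorm, Nat.cast_sum, Finset.sum_div]
    refine tendsto_finsetSum _ fun x _ => tendsto_finsetSum _ fun x' _ => ?_
    rw [hl]
    dsimp only
    split_ifs with h1 h2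
    · subst h2
      exact H.tendsto_diag x
    · exact H.tendsto_offdiag x x' h2
    · simp
  convert hlim using 2
  -- Adding the transpose: off the diagonal exactly one of the two entries is nonzero, and on it the
  -- two halves add up.
  have h2 : ∑ x, ∑ x', l x x' + ∑ x, ∑ x', l x x' = ∑ x, ∑ x', d x x' := by
    refine (congrArg (∑ x, ∑ x', l x x' + ·) Finset.sum_comm).trans ?_
    rw [← Finset.sum_add_distrib]
    refine Finset.sum_congr rfl fun x _ => ?_
    rw [← Finset.sum_add_distrib]
    refine Finset.sum_congr rfl fun x' _ => ?_
    simp only [hl]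
    rcases lt_trichotomy x x' with h3 | rfl | h3
    · simp [h3.le, h3.ne, not_le.2 h3]
    · simp
    · simp [h3.le, h3.ne, not_le.2 h3, hsymm x x']
  linarith

/-- In a graph close to `μ`, the frequency of an `h`-neighborhood is close to its probability. -/
theorem abs_frequency_sub_ballProb_le {h n : ℕ} (hn : 1 ≤ n) (μ : Measure (GStar Ξ Θ))
    [IsProbabilityMeasure μ] {ε : ℝ} (hε : 0 < ε) (hεh : ε ≤ 1 / (1 + (h : ℝ)))
    (G : MarkedGraph (Fin n) Ξ Θ)
    (hG : levyProkhorovEDist G.empirical μ < ENNReal.ofReal ε) (t : GStar Ξ Θ) :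
    |({v | (G.cls v).trunc h = t}.ncard : ℝ) / n - (ballProb h μ t).toReal| ≤ ε := by
  classical
  set B : Set (GStar Ξ Θ) := {g | g.trunc h = t} with hB
  have hBm : MeasurableSet B := measurableSet_trunc_eq h t
  have hn' : (0 : ℝ) < n := by exact_mod_cast hn
  -- Points at distance less than 1/(1+h) share their h-ball, so the event equals its own thickening
  -- and closeness compares its two probabilities directly.
  have hthick : Metric.thickening (ENNReal.ofReal ε).toReal B ⊆ B := by
    rw [ENNReal.toReal_ofReal hε.le]
    intro g hg
    obtain ⟨g', hg', hgg⟩ := Metric.mem_thickening_iff.1 hg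
    exact (GStar.trunc_eq_of_dist_lt (hgg.trans_le hεh)).trans hg'
  have hemp : G.empirical B = ENNReal.ofReal (({v | (G.cls v).trunc h = t}.ncard : ℝ) / n) := by
    have h1 : {v | (G.cls v).trunc h = t}.ncard =
        (Finset.univ.filter fun v => G.cls v ∈ B).card := by
      rw [← Set.ncard_coe_finset]
      congr 1
      ext v
      simp [hB]
    rw [MarkedGraph.empirical, Measure.smul_apply, Measure.finsetSum_apply, Fintype.card_fin, h1,
      ENNReal.ofReal_div_of_pos hn', ENNReal.ofReal_natCast, ENNReal.ofReal_natCast,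
      smul_eq_mul, mul_comm, div_eq_mul_inv]
    congr 1
    simp_rw [Measure.dirac_apply' _ hBm, Set.indicator_apply]
    rw [Finset.sum_ite]
    simp
  have hne : ballProb h μ t ≠ ⊤ := measure_ne_top μ _
  have h1 := (left_measure_le_of_levyProkhorovEDist_lt hG hBm).trans
    (add_le_add_left (measure_mono hthick) _)
  have h2 := (right_measure_le_of_levyProkhorovEDist_lt hG hBm).trans
    (add_le_add_left (measure_mono hthick) _)
  rw [hemp] at h1 h2
  change _ ≤ ballProb h μ t + _ at h1
  change ballProb h μ t ≤ _ at h2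
  rw [← ENNReal.ofReal_toReal hne, ← ENNReal.ofReal_add ENNReal.toReal_nonneg hε.le,
    ENNReal.ofReal_le_ofReal_iff (by positivity)] at h1
  rw [← ENNReal.ofReal_toReal hne, ← ENNReal.ofReal_add (by positivity) hε.le,
    ENNReal.ofReal_le_ofReal_iff (by positivity)] at h2
  rw [abs_le]
  constructor <;> linarith

end Law

/-! ### The upper bound -/

section UpperBound

/-- Codeword lengths for a subprobability vector `w`, with a reserve `ρ` that is shared by `k`
further symbols. -/
noncomputable def codeLength (ρ : ℝ) (k : ℕ) (w : ℝ) : ℝ :=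
  -Real.log (w + ρ / (k + 1)) + Real.log (1 + 2 * ρ)

theorem exp_neg_codeLength {ρ : ℝ} (hρ : 0 < ρ) (k : ℕ) {w : ℝ} (hw : 0 ≤ w) :
    Real.exp (-codeLength ρ k w) = (w + ρ / (k + 1)) / (1 + 2 * ρ) := by
  rw [codeLength, neg_add, neg_neg, Real.exp_add, Real.exp_log (by positivity), Real.exp_neg,
    Real.exp_log (by positivity), ← div_eq_mul_inv]

/-- Of the mass 1 + 2ρ before normalisation, one ρ is spread over the symbols of ι, keeping lengths
finite where w = 0, and the other over the k fallback symbols. -/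
theorem kraft_codeLength {ι : Type*} [Fintype ι] {ρ : ℝ} (hρ : 0 < ρ) (k : ℕ) {w : ι → ℝ}
    (hw : ∀ i, 0 ≤ w i) (hw1 : ∑ i, w i ≤ 1) :
    ∑ i, Real.exp (-codeLength ρ (Fintype.card ι) (w i)) + k * Real.exp (-codeLength ρ k 0) ≤
      1 := by
  -- Dividing by j + 1 instead of j also covers an empty set of symbols.
  have hle : ∀ j : ℕ, j * (ρ / (j + 1)) ≤ ρ := by
    intro j
    rw [mul_div_assoc', div_le_iff₀ (by positivity)]
    nlinarith
  rw [Finset.sum_congr rfl fun i _ => exp_neg_codeLength hρ _ (hw i),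
    exp_neg_codeLength hρ k le_rfl, ← Finset.sum_div, mul_div_assoc', ← add_div,
    div_le_one (by positivity), Finset.sum_add_distrib, Finset.sum_const, Finset.card_univ,
    nsmul_eq_mul, zero_add]
  linarith [hle (Fintype.card ι), hle k]

/-- The reserve inside the logarithm only shortens a codeword, so the expected length exceeds the
entropy by the normalisation alone. -/
theorem mul_codeLength_le {ρ : ℝ} (hρ : 0 < ρ) (k : ℕ) {w : ℝ} (hw : 0 ≤ w) :
    w * codeLength ρ k w ≤ Real.negMulLog w + w * Real.log (1 + 2 * ρ) := by
  rw [codeLength, mul_add, Real.negMulLog]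
  rcases hw.eq_or_lt with rfl | hw
  · simp
  have := Real.log_le_log hw (show w ≤ w + ρ / (k + 1) by linarith [show 0 < ρ / ((k : ℝ) + 1) by positivity])
  nlinarith

theorem codeLength_zero_nonneg {ρ : ℝ} (hρ : 0 < ρ) (hρ1 : ρ ≤ 1) (k : ℕ) :
    0 ≤ codeLength ρ k 0 := by
  rw [codeLength, zero_add]
  have h1 : ρ / ((k : ℝ) + 1) ≤ 1 := by
    rw [div_le_one (by positivity)]
    linarith [(Nat.cast_nonneg k : (0 : ℝ) ≤ k)]
  have h2 := Real.log_nonpos (by positivity) h1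
  have h3 := Real.log_nonneg (show 1 ≤ 1 + 2 * ρ by linarith)
  linarith

theorem hasSum_toReal_of_tsum_eq {ι : Type*} {f : ι → ℝ≥0∞} {s : ℝ≥0∞} (h : ∑' i, f i = s)
    (hs : s ≠ ⊤) : HasSum (fun i => (f i).toReal) s.toReal := by
  rw [← h] at hs ⊢
  rw [ENNReal.tsum_toReal_eq fun i => ENNReal.ne_top_of_tsum_ne_top hs i]
  exact (ENNReal.summable_toReal hs).hasSum

/-- The deviations allowed around a point at which the exponent is continuous. -/
theorem exists_deviation {A : Type*} [Fintype A] (e : A → ℝ) (a : A → ℝ) {d τ θ : ℝ}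
    (hτ : 0 < τ) (hθ : 0 < θ) : ∃ ω > 0,
      (∀ c, ∀ σ : ℝ, |σ - e c| ≤ ω → σ * a c / 2 + σ * Real.log σ ≤
        e c * a c / 2 + e c * Real.log (e c) + τ / (Fintype.card A + 1)) ∧
      (∀ m : ℝ, |m - d / 2| ≤ ω → -m - m * Real.log (2 * m) ≤ -(d / 2) - d / 2 * Real.log d + τ) ∧
      (Fintype.card A + 2) * ω ≤ θ := by
  have h1 : ∀ c, ∀ᶠ σ in 𝓝 (e c), σ * a c / 2 + σ * Real.log σ ≤
        e c * a c / 2 + e c * Real.log (e c) + τ / (Fintype.card A + 1) := by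
    intro c
    have hc : Continuous fun σ : ℝ => σ * a c / 2 + σ * Real.log σ := by
      have := Real.continuous_mul_log
      fun_prop
    exact (hc.tendsto (e c)).eventually_le_const (lt_add_of_pos_right _ (by positivity))
  have h2 : ∀ᶠ m in 𝓝 (d / 2), -m - m * Real.log (2 * m) ≤
      -(d / 2) - d / 2 * Real.log d + τ := by
    -- Written through x log x at x = 2m, whose continuity at 0 needs no separate case.
    have hc : Continuous fun m : ℝ => -m - (2 * m) * Real.log (2 * m) / 2 := by
      have := Real.continuous_mul_log.comp (continuous_const_mul (2 : ℝ))
      simp only [Function.comp_def] at this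
      fun_prop
    have h3 := (hc.tendsto (d / 2)).eventually_le_const (lt_add_of_pos_right _ hτ)
    filter_upwards [h3] with m hm
    have e1 : (2 * (d / 2) : ℝ) = d := by ring
    rw [e1] at hm
    linarith
  have h1' : ∀ᶠ ω in 𝓝[>] (0 : ℝ), ∀ c, ∀ σ : ℝ, |σ - e c| ≤ ω → σ * a c / 2 + σ * Real.log σ ≤
        e c * a c / 2 + e c * Real.log (e c) + τ / (Fintype.card A + 1) := by
    refine eventually_all.2 fun c => ?_
    obtain ⟨r, hr, hball⟩ := Metric.eventually_nhds_iff.1 (h1 c)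
    filter_upwards [Ioo_mem_nhdsGT hr] with ω hω σ hσ
    exact hball (hσ.trans_lt hω.2)
  have h2' : ∀ᶠ ω in 𝓝[>] (0 : ℝ), ∀ m : ℝ, |m - d / 2| ≤ ω →
      -m - m * Real.log (2 * m) ≤ -(d / 2) - d / 2 * Real.log d + τ := by
    obtain ⟨r, hr, hball⟩ := Metric.eventually_nhds_iff.1 h2
    filter_upwards [Ioo_mem_nhdsGT hr] with ω hω m hm
    exact hball (hm.trans_lt hω.2)
  have h3' : ∀ᶠ ω in 𝓝[>] (0 : ℝ), (Fintype.card A + 2) * ω ≤ θ := by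
    filter_upwards [Ioo_mem_nhdsGT (show 0 < θ / (Fintype.card A + 2) by positivity)] with ω hω
    rw [← le_div_iff₀' (by positivity)]
    exact hω.2.le
  obtain ⟨ω, ⟨⟨ha, hb⟩, hc⟩, hd⟩ :=
    (((h1'.and h2').and h3').and self_mem_nhdsWithin).exists
  exact ⟨ω, hd, ha, hb, hc⟩

/-- The reserve of the codes. -/
theorem exists_reserve (d q : ℝ) {τ : ℝ} (hτ : 0 < τ) : ∃ ρ > 0, ρ ≤ 1 ∧
    (1 + d / 2) * Real.log (1 + 2 * ρ) ≤ τ ∧ q * ρ ≤ τ := by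
  have h1 : Tendsto (fun ρ : ℝ => (1 + d / 2) * Real.log (1 + 2 * ρ)) (𝓝[>] 0) (𝓝 0) := by
    have hc : ContinuousAt (fun ρ : ℝ => (1 + d / 2) * Real.log (1 + 2 * ρ)) 0 := by
      refine ContinuousAt.mul continuousAt_const (ContinuousAt.log (by fun_prop) (by simp))
    have := hc.tendsto
    simp only [mul_zero, add_zero, Real.log_one] at this
    exact this.mono_left nhdsWithin_le_nhds
  have h2 : Tendsto (fun ρ : ℝ => q * ρ) (𝓝[>] 0) (𝓝 0) := by
    have hc : ContinuousAt (fun ρ : ℝ => q * ρ) 0 := by fun_prop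
    have := hc.tendsto
    rw [mul_zero] at this
    exact this.mono_left nhdsWithin_le_nhds
  obtain ⟨ρ, ⟨⟨ha, hb⟩, hc⟩⟩ := (((h1.eventually_le_const hτ).and (h2.eventually_le_const hτ)).and
    (Ioo_mem_nhdsGT one_pos)).exists
  exact ⟨ρ, hc.1, hc.2.le, ha, hb⟩

end UpperBound

/-! ### From the exponent of the counting bound to the entropy -/

section Entropy

variable {Ξ : Type u} {Θ : Type v}

open Nat in
-- In the counting bound, M! 2^M and the number of profiles (2M+1)^k are exactly the terms set aside
-- in the assumed exponent. At most exp(nK + M log n) graphs remain for a single ε, which suffices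
-- since the entropy is an infimum over ε.
theorem upperBCEntropy_le_of_exponent_le [Fintype Ξ] [LinearOrder Ξ] [Fintype Θ]
    {h : ℕ} (hh : 1 ≤ h) (μ : Measure (GStar Ξ Θ)) [IsProbabilityMeasure μ]
    (m : ℕ → Ξ → Ξ → ℕ) (u : ℕ → Θ → ℕ) {d : ℝ}
    (hdens : Tendsto (fun n => (edgeNorm (m n) : ℝ) / n) atTop (𝓝 (d / 2)))
    (A : Finset (EdgeTypes Ξ Θ h)) (hA : ∀ c ∈ A, c.swap ∈ A) (F : Finset (GStar Ξ Θ))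
    (a : A ⊕ (Ξ × Ξ) → ℝ) (ha : ∑ c, Real.exp (-a c) ≤ 1) (b : F → ℝ) (b' : ℝ)
    (hb : ∑ t, Real.exp (-b t) + Fintype.card Θ * Real.exp (-b') ≤ 1)
    {lam : ℝ} (hlam : 0 < lam) {κ K : ℝ} (hκ : 0 < κ)
    (hexp : ∀ᶠ n : ℕ in atTop, ∀ (M : ℕ) (N : F → ℕ) (S : A ⊕ (Ξ × Ξ) → ℕ),
      |(M : ℝ) / n - d / 2| ≤ κ → (∀ t, |(N t : ℝ) / n - (ballProb h μ t.1).toReal| ≤ κ) →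
      ∑ c, S c = 2 * M →
      (∀ c, ∑ t, N t * edgeTypeCount h c.1 t.1 ≤ S (Sum.inl c)) →
      (∀ c, S (Sum.inl c) + ∑ t, N t * t.1.deg ≤
        ∑ t, N t * edgeTypeCount h c.1 t.1 + 2 * M) →
      ∑ t, N t * (b t - ∑ c : A, Real.log (edgeTypeCount h c.1 t.1)!)
        + (n - ∑ t, (N t : ℝ)) * (b' + Fintype.card A)
        + ∑ c, (S c * a c / 2 + Real.log (S c)!)
        + ∑ q : Ξ × Ξ, (lam * n - S (Sum.inr q) * Real.log lam) ≤
      n * K + M * Real.log n + Real.log M ! + M * Real.log 2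
        - Fintype.card (A ⊕ (Ξ × Ξ)) * Real.log (2 * M + 1)) :
    upperBCEntropy m u μ ≤ K := by
  -- κ is the tolerance for the frequencies; 1/(1+h) makes the Lévy–Prokhorov distance decide events
  -- about h-balls.
  set ε := min κ (1 / (1 + (h : ℝ))) with hεdef
  have hε : 0 < ε := by positivity
  refine (iInf_le _ (⟨ε, hε⟩ : Ioi (0 : ℝ))).trans (limsup_le_of_le (by isBoundedDefault) ?_)
  have hdens' : ∀ᶠ n : ℕ in atTop, |(edgeNorm (m n) : ℝ) / n - d / 2| ≤ κ := by
    filter_upwards [Metric.tendsto_nhds.1 hdens κ hκ] with n hn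
    exact hn.le
  filter_upwards [hexp, hdens', eventually_ge_atTop 1] with n hX hdn hn
  have hn' : (0 : ℝ) < n := by exact_mod_cast hn
  set M := edgeNorm (m n) with hM
  set X : ℝ := n * K + M * Real.log n + Real.log M ! + M * Real.log 2
        - Fintype.card (A ⊕ (Ξ × Ξ)) * Real.log (2 * M + 1) with hXdef
  have main := ncard_markedGraphs_le hh (M := M) A hA F (graphsNear n (m n) (u n) μ ε)
    (fun G hG => by
      have : G.edgeMarkCount = m n := funext fun x => funext fun x' => hG.1 x x'
      rw [this])
    a ha b b' hb hlam X
    (fun G hG N S hN _ hS hSl hSu => by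
      have := hX M N S hdn (fun t => by
        rw [hN t]
        exact (abs_frequency_sub_ballProb_le hn μ hε (min_le_right _ _) G hG.2.2 t.1).trans
          (min_le_left _ _)) hS hSl hSu
      simpa only [Fintype.card_coe] using this)
  have hbound : ((graphsNear n (m n) (u n) μ ε).ncard : ℝ) ≤
      Real.exp (n * K + M * Real.log n) := by
    have h1 : (2 * (M : ℝ) + 1) ^ (A.card + Fintype.card (Ξ × Ξ)) =
        Real.exp (Fintype.card (A ⊕ (Ξ × Ξ)) * Real.log (2 * M + 1)) := by
      rw [Real.exp_nat_mul, Real.exp_log (by positivity), Fintype.card_sum, Fintype.card_coe]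
    have h2 : (M ! * 2 ^ M : ℝ) = Real.exp (Real.log M ! + M * Real.log 2) := by
      rw [Real.exp_add, Real.exp_nat_mul, Real.exp_log (by positivity),
        Real.exp_log (by positivity)]
    rw [h1, h2, ← Real.exp_add, ← le_div_iff₀ (Real.exp_pos _), ← Real.exp_sub] at main
    refine main.trans (Real.exp_le_exp.2 (le_of_eq ?_))
    rw [hXdef]
    ring
  have hlog : ENNReal.log ((graphsNear n (m n) (u n) μ ε).encard : ℝ≥0∞) ≤
      ((n * K + M * Real.log n : ℝ) : EReal) := by
    rw [← (Set.toFinite (graphsNear n (m n) (u n) μ ε)).cast_ncard_eq, ENat.toENNReal_coe,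
      ← ENNReal.ofReal_natCast]
    refine (ENNReal.log_monotone (ENNReal.ofReal_le_ofReal hbound)).trans (le_of_eq ?_)
    rw [← EReal.exp_coe, EReal.log_exp]
  have hn0 : (0 : EReal) < (n : EReal) := by exact_mod_cast hn
  rw [EReal.div_le_iff_le_mul hn0 (EReal.natCast_ne_top n)]
  refine (EReal.sub_le_sub hlog le_rfl).trans (le_of_eq ?_)
  rw [← EReal.coe_sub, add_sub_cancel_right, EReal.coe_mul, EReal.coe_natCast]

/-- Stated in `EReal`, so that a divergent series is truncated in the same way as a convergent one.
-/
theorem eventually_lt_coe_add_sum {ι : Type*} (x : ℝ≥0∞) (f : ι → ℝ≥0∞) {y : EReal}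
    (hy : y < ((x + ∑' i, f i : ℝ≥0∞) : EReal)) :
    ∀ᶠ s : Finset ι in atTop, y < ((x + ∑ i ∈ s, f i : ℝ≥0∞) : EReal) :=
  ((continuous_coe_ennreal_ereal.tendsto _).comp
    (tendsto_const_nhds.add ENNReal.summable.hasSum)).eventually_const_lt hy

/-- Moves the two subtracted terms of J_h, either of which may be infinite, to one side of a strict
inequality, where they can be cut to finite sums. -/
theorem lt_add_of_sub_sub_lt {r K : ℝ} {H c₁ c₂ : ℝ≥0∞} (hH : H ≠ ⊤)
    (hJ : (r : EReal) + H - c₁ - c₂ < K) :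
    ((r + H.toReal - K : ℝ) : EReal) < ((c₁ + c₂ : ℝ≥0∞) : EReal) := by
  by_cases h1 : c₁ = ⊤
  · rw [h1, top_add]
    exact EReal.coe_lt_top _
  by_cases h2 : c₂ = ⊤
  · rw [h2, add_top]
    exact EReal.coe_lt_top _
  lift H to ℝ≥0 using hH
  lift c₁ to ℝ≥0 using h1
  lift c₂ to ℝ≥0 using h2
  have e : ∀ x : ℝ≥0, ((x : ℝ≥0∞) : EReal) = ((x : ℝ) : EReal) := fun _ => rfl
  rw [e, e, e, ← EReal.coe_add, ← EReal.coe_sub, ← EReal.coe_sub, EReal.coe_lt_coe_iff] at hJ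
  rw [← ENNReal.coe_add, e, EReal.coe_lt_coe_iff, ENNReal.coe_toReal, NNReal.coe_add]
  linarith

end Entropy

/-- Terms of the entropy series are nonnegative; elements of F that are not h-balls have probability
0 and contribute nothing. -/
theorem discreteEntropy_truncLaw_ge {Ξ : Type u} {Θ : Type v} (h : ℕ) (μ : Measure (GStar Ξ Θ))
    [IsProbabilityMeasure μ] (hH : discreteEntropy (truncLaw h μ) ≠ ⊤) (F : Finset (GStar Ξ Θ)) :
    ∑ t ∈ F, Real.negMulLog (ballProb h μ t).toReal ≤ (discreteEntropy (truncLaw h μ)).toReal := by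
  have h0 : ∀ t, 0 ≤ Real.negMulLog (ballProb h μ t).toReal := fun t =>
    Real.negMulLog_nonneg ENNReal.toReal_nonneg
      (ENNReal.toReal_mono ENNReal.one_ne_top prob_le_one)
  rw [← ENNReal.ofReal_le_iff_le_toReal hH, ENNReal.ofReal_sum_of_nonneg fun t _ => h0 t]
  refine le_trans (Finset.sum_le_sum fun t _ => ?_) (ENNReal.sum_le_tsum F)
  by_cases ht : t ∈ Set.range (GStar.trunc h)
  · dsimp only
    rw [truncLaw_singleton h μ ht]
  · rw [ballProb_eq_zero h μ ht]
    simp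

/-! ### The upper bound: choice of the codes and of the finite sets -/

set_option maxHeartbeats 1000000 in
theorem mainTheorem6 {Ξ : Type u} {Θ : Type v} [Fintype Ξ] [LinearOrder Ξ] [Fintype Θ]
    (h : ℕ) (hh : 1 ≤ h)
    (μ : Measure (GStar Ξ Θ)) [IsProbabilityMeasure μ]
    (htree : ∀ᵐ g ∂μ, g ∈ GStar.trees Ξ Θ)
    (hunim : IsUnimodular μ)
    (hpos : 0 < meanDegree μ) (hfin : meanDegree μ < ⊤)
    (hH : discreteEntropy (truncLaw h μ) < ⊤)
    (m : ℕ → Ξ → Ξ → ℕ) (u : ℕ → Θ → ℕ)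
    (hadapted : IsAdapted (fun x x' => (meanDegreeMark μ x x').toReal)
      (fun θ => (rootMarkProb μ θ).toReal) m u) :
    upperBCEntropy m u μ ≤ JFunctional h (truncLaw h μ) := by
  classical
  set d : ℝ := (meanDegree μ).toReal with hd
  have hd0 : 0 < d := ENNReal.toReal_pos hpos.ne' hfin.ne
  refine EReal.le_of_forall_lt_iff_le.1 fun K hK => ?_
  obtain ⟨K', hJK', hKK⟩ := EReal.lt_iff_exists_real_btwn.1 hK
  replace hKK : K' < K := EReal.coe_lt_coe_iff.1 hKK
  -- Seven errors of size τ arise: the normalisation of the codes, the fallback colours, two in the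
  -- sum over A, the continuity in m, the term q · ρ, and the edges with labels outside A.
  set τ : ℝ := (K - K') / 10 with hτdef
  have hτ : 0 < τ := by rw [hτdef]; linarith
  set p : GStar Ξ Θ → ℝ := fun t => (ballProb h μ t).toReal with hp
  set e : EdgeTypes Ξ Θ h → ℝ := fun c => (meanTypeCount h (truncLaw h μ) c).toReal with he
  set w : EdgeTypes Ξ Θ h → ℝ := fun c => (edgeTypeLaw h (truncLaw h μ) c).toReal with hw
  set G : EdgeTypes Ξ Θ h → GStar Ξ Θ → ℝ :=
    fun c t => Real.log ((edgeTypeCount h c t).factorial : ℝ) with hG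
  have hp0 : ∀ t, 0 ≤ p t := fun t => ENNReal.toReal_nonneg
  have he0 : ∀ c, 0 ≤ e c := fun c => ENNReal.toReal_nonneg
  have hw0 : ∀ c, 0 ≤ w c := fun c => ENNReal.toReal_nonneg
  have hG0 : ∀ c t, 0 ≤ G c t := fun c t => Real.log_natCast_nonneg _
  have he_tsum := tsum_meanTypeCount hh μ htree
  have he_top : ∀ c, meanTypeCount h (truncLaw h μ) c ≠ ⊤ := fun c =>
    ENNReal.ne_top_of_tsum_ne_top (he_tsum.trans_ne hfin.ne) c
  have he_sum : HasSum e d := hasSum_toReal_of_tsum_eq he_tsum hfin.ne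
  have hp_sum : HasSum p 1 := by
    simpa using hasSum_toReal_of_tsum_eq (tsum_ballProb h μ) ENNReal.one_ne_top
  have hdeg_sum : HasSum (fun t => p t * t.deg) d := by
    simpa [hp] using hasSum_toReal_of_tsum_eq (meanDegree_eq_tsum hh μ).symm hfin.ne
  have hE_sum : ∀ c, HasSum (fun t => p t * edgeTypeCount h c t) (e c) := fun c => by
    simpa [hp] using hasSum_toReal_of_tsum_eq (meanTypeCount_truncLaw hh μ c).symm (he_top c)
  have hew : ∀ c, e c = d * w c := by
    intro c
    simp only [hw, he, edgeTypeLaw, ENNReal.toReal_div, meanDegree_truncLaw hh, ← hd]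
    field_simp
  have hw_sum : HasSum w 1 := by
    have := he_sum.div_const d
    simp only [hew, div_self hd0.ne'] at this
    simpa [mul_div_cancel_left₀ _ hd0.ne'] using this
  have hw1 : ∀ c, w c ≤ 1 := fun c => le_hasSum hw_sum c fun c' _ => hw0 c'
  have hnml0 : ∀ c, 0 ≤ Real.negMulLog (w c) := fun c => Real.negMulLog_nonneg (hw0 c) (hw1 c)
  -- the two nonpositive terms of the functional as one series
  set y : ℝ := -sFun d + (discreteEntropy (truncLaw h μ)).toReal - K' with hy
  have hyJ : (y : EReal) < ((0 + ∑' c, (ENNReal.ofReal (d / 2 * Real.negMulLog (w c)) +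
      ∑' t, ENNReal.ofReal (p t * G c t)) : ℝ≥0∞) : EReal) := by
    have h1 : JFunctional h (truncLaw h μ) < K' := hJK'
    unfold JFunctional at h1
    have h2 := lt_add_of_sub_sub_lt hH.ne h1
    rw [meanDegree_truncLaw hh, ← hd] at h2
    have h3 : meanDegree μ / 2 = ENNReal.ofReal (d / 2) := by
      rw [ENNReal.ofReal_div_of_pos two_pos, ENNReal.ofReal_toReal hfin.ne, ENNReal.ofReal_ofNat]
    have h4 : meanDegree μ / 2 * shannonEntropy (edgeTypeLaw h (truncLaw h μ)) =
        ∑' c, ENNReal.ofReal (d / 2 * Real.negMulLog (w c)) := by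
      rw [shannonEntropy, ← ENNReal.tsum_mul_left, h3]
      exact tsum_congr fun c => (ENNReal.ofReal_mul (by positivity)).symm
    have h5 : ∀ c, ∫⁻ g, ENNReal.ofReal (Real.log ((edgeTypeCount h c g).factorial : ℝ))
        ∂(truncLaw h μ) = ∑' t, ENNReal.ofReal (p t * G c t) := by
      intro c
      rw [lintegral_log_factorial_truncLaw hh]
      refine tsum_congr fun t => ?_
      have hpt : ENNReal.ofReal (p t) = ballProb h μ t := ENNReal.ofReal_toReal (measure_ne_top μ _)
      rw [ENNReal.ofReal_mul (hp0 t), hpt]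
    rw [h4, tsum_congr h5, ← ENNReal.tsum_add] at h2
    rw [zero_add]
    exact h2
  -- the codes
  set q := Fintype.card (Ξ × Ξ) with hq
  obtain ⟨ρ, hρ, hρ1, hρlog, hρq⟩ := exists_reserve d (q : ℝ) hτ
  -- The fallback lengths depend on ρ and the mark sets only. Hence θ can be fixed before A, and F
  -- can be chosen after A.
  set a' := codeLength ρ q 0 with ha'
  set b' := codeLength ρ (Fintype.card Θ) 0 with hb'
  have ha'0 : 0 ≤ a' := codeLength_zero_nonneg hρ hρ1 _
  have hb'0 : 0 ≤ b' := codeLength_zero_nonneg hρ hρ1 _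
  have hlogρ : Real.log ρ ≤ 0 := Real.log_nonpos hρ.le hρ1
  have hlog2ρ : 0 ≤ Real.log (1 + 2 * ρ) := Real.log_nonneg (by linarith)
  have hk0 : 0 ≤ a' / 2 - Real.log ρ := by linarith
  -- Here 2θ will be η: one θ for the mean degree outside A, one for the deviations ω. The last
  -- condition handles e log e, where the lost mass is multiplied by log d.
  obtain ⟨θ, hθ, hθ1, hθk, hθd⟩ : ∃ θ : ℝ, 0 < θ ∧ 2 * θ ≤ 1 ∧
      2 * θ * (a' / 2 - Real.log ρ) ≤ τ ∧ θ * |Real.log d| ≤ τ := by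
    have h1 : ∀ r : ℝ, ∀ᶠ θ in 𝓝[>] (0 : ℝ), θ * r ≤ τ := fun r => by
      have hc : Tendsto (fun θ : ℝ => θ * r) (𝓝 0) (𝓝 (0 * r)) :=
        (continuous_mul_const r).tendsto 0
      rw [zero_mul] at hc
      exact (hc.mono_left nhdsWithin_le_nhds).eventually_le_const hτ
    obtain ⟨θ, ⟨h2, h3⟩, h4⟩ := (((h1 (2 * (a' / 2 - Real.log ρ))).and (h1 |Real.log d|)).and
      (Ioo_mem_nhdsGT (show (0 : ℝ) < 1 / 2 by norm_num))).exists
    exact ⟨θ, h4.1, by linarith [h4.2], by linarith, h3⟩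
  -- the edge types
  obtain ⟨A, hA, hyA, heA⟩ : ∃ A : Finset (EdgeTypes Ξ Θ h), (∀ c ∈ A, c.swap ∈ A) ∧
      (y : EReal) < ((0 + ∑ c ∈ A, (ENNReal.ofReal (d / 2 * Real.negMulLog (w c)) +
        ∑' t, ENNReal.ofReal (p t * G c t)) : ℝ≥0∞) : EReal) ∧ d - θ ≤ ∑ c ∈ A, e c := by
    -- The properties hold for every finite set containing `A₀`, so they survive closing it under
    -- exchange of the ends.
    obtain ⟨A₀, hA₀⟩ := eventually_atTop.1 ((eventually_lt_coe_add_sum _ _ hyJ).and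
      (he_sum.eventually_const_le (show d - θ < d by linarith)))
    obtain ⟨h1, h2⟩ := hA₀ (A₀ ∪ A₀.image Prod.swap) Finset.subset_union_left
    refine ⟨_, fun c hc => ?_, h1, h2⟩
    rcases Finset.mem_union.1 hc with hc | hc
    · exact Finset.mem_union_right _ (Finset.mem_image_of_mem _ hc)
    · obtain ⟨c', hc', rfl⟩ := Finset.mem_image.1 hc
      exact Finset.mem_union_left _ (by simpa using hc')
  set D : ℝ := ∑ c ∈ A, d / 2 * Real.negMulLog (w c) with hD
  have hD0 : 0 ≤ D := Finset.sum_nonneg fun c _ => mul_nonneg (by positivity) (hnml0 c)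
  set a : A ⊕ (Ξ × Ξ) → ℝ :=
    Sum.elim (fun c => codeLength ρ (Fintype.card A) (w c.1)) fun _ => a' with ha
  have hwA : ∑ c : A, w c.1 ≤ 1 := by
    rw [Finset.sum_coe_sort A w]
    exact sum_le_hasSum A (fun c _ => hw0 c) hw_sum
  have haK : ∑ c, Real.exp (-a c) ≤ 1 := by
    rw [Fintype.sum_sum_type]
    have := kraft_codeLength hρ q (fun c : A => hw0 c.1) hwA
    refine le_trans (le_of_eq ?_) this
    simp only [ha, Sum.elim_inl, Sum.elim_inr, Finset.sum_const, Finset.card_univ, nsmul_eq_mul,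
      ha', hq]
  obtain ⟨ω, hω, hωy, hωz, hωθ⟩ := exists_deviation (fun c : A => e c.1)
    (fun c : A => a (Sum.inl c)) (d := d) hτ hθ
  -- the classes of neighborhoods
  obtain ⟨F, ⟨⟨hFE, hFD⟩, hFp⟩, hyF⟩ : ∃ F : Finset (GStar Ξ Θ),
      (((∀ c ∈ A, e c - ω / 2 ≤ ∑ t ∈ F, p t * edgeTypeCount h c t) ∧
        d - ω / 2 ≤ ∑ t ∈ F, p t * t.deg) ∧
        1 - τ / (b' + A.card + 1) ≤ ∑ t ∈ F, p t) ∧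
        (y : EReal) < ((ENNReal.ofReal D + ∑ t ∈ F, ∑ c ∈ A, ENNReal.ofReal (p t * G c t) : ℝ≥0∞) :
          EReal) := by
    have h1 : ∀ᶠ F : Finset (GStar Ξ Θ) in atTop,
        ∀ c ∈ A, e c - ω / 2 ≤ ∑ t ∈ F, p t * edgeTypeCount h c t :=
      (Finset.eventually_all A).2 fun c _ =>
        (hE_sum c).eventually_const_le (by linarith)
    have h2 : ∀ᶠ F : Finset (GStar Ξ Θ) in atTop, d - ω / 2 ≤ ∑ t ∈ F, p t * t.deg :=
      hdeg_sum.eventually_const_le (by linarith)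
    have h3 : ∀ᶠ F : Finset (GStar Ξ Θ) in atTop, 1 - τ / (b' + A.card + 1) ≤ ∑ t ∈ F, p t :=
      hp_sum.eventually_const_le (by linarith [show 0 < τ / (b' + A.card + 1) by positivity])
    refine (((h1.and h2).and h3).and (eventually_lt_coe_add_sum _ _ ?_)).exists
    refine hyA.trans_eq ?_
    rw [zero_add, Finset.sum_add_distrib, hD,
      ENNReal.ofReal_sum_of_nonneg fun c _ => mul_nonneg (by positivity) (hnml0 c),
      Summable.tsum_finsetSum fun _ _ => ENNReal.summable]
  set R : ℝ := ∑ t ∈ F, ∑ c ∈ A, p t * G c t with hR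
  have hyDR : y < D + R := by
    have h0 : 0 ≤ R := Finset.sum_nonneg fun t _ => Finset.sum_nonneg fun c _ =>
      mul_nonneg (hp0 t) (hG0 c t)
    have h1 : ∑ t ∈ F, ∑ c ∈ A, ENNReal.ofReal (p t * G c t) = ENNReal.ofReal R := by
      rw [hR, ENNReal.ofReal_sum_of_nonneg fun t _ => Finset.sum_nonneg fun c _ =>
        mul_nonneg (hp0 t) (hG0 c t)]
      exact Finset.sum_congr rfl fun t _ => (ENNReal.ofReal_sum_of_nonneg fun c _ =>
        mul_nonneg (hp0 t) (hG0 c t)).symm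
    rw [h1, ← ENNReal.ofReal_add hD0 h0, EReal.coe_ennreal_ofReal,
      max_eq_left (add_nonneg hD0 h0)] at hyF
    exact EReal.coe_lt_coe_iff.1 hyF
  set b : F → ℝ := fun t => codeLength ρ (Fintype.card F) (p t.1) with hb
  have hpF : ∑ t : F, p t.1 ≤ 1 := by
    rw [Finset.sum_coe_sort F p]
    exact sum_le_hasSum F (fun t _ => hp0 t) hp_sum
  have hbK : ∑ t, Real.exp (-b t) + Fintype.card Θ * Real.exp (-b') ≤ 1 :=
    kraft_codeLength hρ (Fintype.card Θ) (fun t : F => hp0 t.1) hpF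
  have hT1 : ∑ t : F, p t.1 * (b t - ∑ c : A, Real.log ((edgeTypeCount h c.1 t.1).factorial : ℝ)) ≤
      (discreteEntropy (truncLaw h μ)).toReal + Real.log (1 + 2 * ρ) - R := by
    have h1 : ∑ t : F, p t.1 * b t ≤ ∑ t : F, Real.negMulLog (p t.1)
        + (∑ t : F, p t.1) * Real.log (1 + 2 * ρ) := by
      rw [Finset.sum_mul, ← Finset.sum_add_distrib]
      exact Finset.sum_le_sum fun t _ => mul_codeLength_le hρ _ (hp0 t.1)
    have h2 := discreteEntropy_truncLaw_ge h μ hH.ne F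
    have h3 := mul_le_mul_of_nonneg_right hpF hlog2ρ
    have h4 : ∑ t : F, p t.1 * ∑ c : A, Real.log ((edgeTypeCount h c.1 t.1).factorial : ℝ) = R := by
      rw [hR, ← Finset.sum_coe_sort F]
      refine Finset.sum_congr rfl fun t _ => ?_
      rw [← Finset.mul_sum, ← Finset.sum_coe_sort A]
    rw [← Finset.sum_coe_sort F] at h2
    simp only [mul_sub, Finset.sum_sub_distrib, h4]
    linarith
  have hT2 : (1 - ∑ t : F, p t.1) * (b' + Fintype.card A) ≤ τ := by
    rw [Finset.sum_coe_sort F p, Fintype.card_coe]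
    have h1 : 0 ≤ b' + (A.card : ℝ) := by positivity
    have h2 := mul_le_mul_of_nonneg_right
      (show 1 - ∑ t ∈ F, p t ≤ τ / (b' + A.card + 1) by linarith) h1
    refine h2.trans ?_
    rw [div_mul_eq_mul_div, div_le_iff₀ (by positivity)]
    nlinarith
  -- The sign of H(π) is settled here: the code gives at most +(d/2) times the entropy terms, up to
  -- its normalisation, e log e gives -d times them, and -D remains.
  have hT3 : ∑ c : A, (e c.1 * a (Sum.inl c) / 2 + e c.1 * Real.log (e c.1)
      + τ / (Fintype.card A + 1)) ≤
      -D + d / 2 * Real.log (1 + 2 * ρ) + d * Real.log d + 2 * τ := by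
    have h1 : ∀ c : A, e c.1 * a (Sum.inl c) / 2 + e c.1 * Real.log (e c.1) ≤
        -(d / 2 * Real.negMulLog (w c.1)) + d / 2 * Real.log (1 + 2 * ρ) * w c.1
          + Real.log d * e c.1 := by
      intro c
      have h2 : e c.1 * a (Sum.inl c) ≤
          d * (Real.negMulLog (w c.1) + w c.1 * Real.log (1 + 2 * ρ)) := by
        rw [hew, mul_assoc]
        exact mul_le_mul_of_nonneg_left (mul_codeLength_le hρ _ (hw0 c.1)) hd0.le
      have h3 : e c.1 * Real.log (e c.1) = Real.log d * e c.1 - d * Real.negMulLog (w c.1) := by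
        rw [hew, Real.negMulLog]
        rcases (hw0 c.1).eq_or_lt with h0 | h0
        · simp [← h0]
        · rw [Real.log_mul hd0.ne' h0.ne']
          ring
      linarith
    have h2 := Finset.sum_le_sum fun c (_ : c ∈ Finset.univ) => h1 c
    simp only [Finset.sum_add_distrib] at h2 ⊢
    have hD' : d / 2 * ∑ c : A, Real.negMulLog (w c.1) = D := by
      rw [Finset.sum_coe_sort A fun c => Real.negMulLog (w c), hD, Finset.mul_sum]
    simp only [Finset.sum_neg_distrib, ← Finset.mul_sum] at h2
    rw [hD', Finset.sum_coe_sort A e] at h2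
    have h3 : d / 2 * Real.log (1 + 2 * ρ) * ∑ c : A, w c.1 ≤ d / 2 * Real.log (1 + 2 * ρ) :=
      mul_le_of_le_one_right (by positivity) hwA
    have h4 : Real.log d * ∑ c ∈ A, e c ≤ d * Real.log d + τ := by
      have h5 : ∑ c ∈ A, e c ≤ d := sum_le_hasSum A (fun c _ => he0 c) he_sum
      have h6 : Real.log d * (∑ c ∈ A, e c - d) ≤ |Real.log d| * θ := by
        refine (le_abs_self _).trans ?_
        rw [abs_mul]
        refine mul_le_mul_of_nonneg_left ?_ (abs_nonneg _)
        rw [abs_le]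
        constructor <;> linarith
      linarith
    have h5 : ∑ _c : A, τ / (Fintype.card A + 1) ≤ τ := by
      rw [Finset.sum_const, Finset.card_univ, nsmul_eq_mul, mul_div_assoc',
        div_le_iff₀ (by positivity)]
      nlinarith
    linarith
  obtain ⟨κ, hκ, hexp⟩ := exists_eventually_exponent_le (A := A) (Q := Ξ × Ξ) (F := F)
    (fun t c => edgeTypeCount h c.1 t.1) (fun t => t.1.deg) (fun t => p t.1) (fun c => e c.1)
    hd0 a b (b' := b') (a' := a') (lam := ρ) (ω := ω) (η := 2 * θ)
    (z := -(d / 2) - d / 2 * Real.log d + τ) (L := K)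
    (fun c => e c.1 * a (Sum.inl c) / 2 + e c.1 * Real.log (e c.1) + τ / (Fintype.card A + 1))
    hω hωy hωz (fun _ => le_rfl) ha'0 hlogρ
    (by rw [Finset.sum_coe_sort A e]; linarith) hθ1
    (fun c => by
      rw [Finset.sum_coe_sort F fun t => p t * (edgeTypeCount h c.1 t : ℝ)]
      exact hFE c.1 c.2)
    (fun c => by
      rw [Finset.sum_coe_sort F fun t => p t * (edgeTypeCount h c.1 t : ℝ)]
      exact sum_le_hasSum F (fun t _ => mul_nonneg (hp0 t) (Nat.cast_nonneg _)) (hE_sum c.1))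
    (by
      rw [Finset.sum_coe_sort F fun t => p t * (t.deg : ℝ)]
      exact hFD)
    hb'0
    -- The balance: y < D + R, where y contains -s(d) and the entropy, leaves K' plus at most 7τ,
    -- below K = K' + 10τ.
    (by
      have hs : sFun d = d / 2 - d / 2 * Real.log d := rfl
      rw [← hq]
      linarith)
  have hdens : Tendsto (fun n => (edgeNorm (m n) : ℝ) / n) atTop (𝓝 (d / 2)) := by
    have h1 := hadapted.tendsto_edgeNorm
    have h2 : ∀ x x', meanDegreeMark μ x x' ≠ ⊤ := fun x x' => by
      refine ne_top_of_le_ne_top hfin.ne ?_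
      rw [← sum_meanDegreeMark μ]
      exact (Finset.single_le_sum (f := fun x' => meanDegreeMark μ x x') (fun _ _ => zero_le)
        (Finset.mem_univ x')).trans (Finset.single_le_sum
          (f := fun x => ∑ x', meanDegreeMark μ x x') (fun _ _ => zero_le) (Finset.mem_univ x))
    have h3 : ∑ x, ∑ x', (meanDegreeMark μ x x').toReal = d := by
      rw [hd, ← sum_meanDegreeMark μ, ENNReal.toReal_sum fun x _ =>
        ENNReal.sum_ne_top.2 fun x' _ => h2 x x']
      exact Finset.sum_congr rfl fun x _ => (ENNReal.toReal_sum fun x' _ => h2 x x').symm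
    rwa [h3] at h1
  exact upperBCEntropy_le_of_exponent_le hh μ m u hdens A hA F a haK b b' hbK hρ hκ hexp
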